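/- Let $Q_2=(0,1)^2$. For $\alpha\in(0,1)$ and $(x,y)\in \overline{Q_2}$ let $$\psi_\alpha(x,y)=2^\alpha\frac{\sin(\pi x)\sin(\pi y)}{(\sin(\pi x)+\sin(\pi y))^\alpha}$$ (with value $0$ at the corners), and for $f:Q_2\to\mathbb R$ let $T_f(r)=\int_{\{f=r\}}|\nabla f|^{-1}\,d\sigma\in[0,\infty]$, where $\{f=r\}\subseteq Q_2$ and $\sigma$ is arc length. Put $\psi^\alpha(x,y)=\int_0^{\psi_\alpha(x,y)}T_{\psi_\alpha}(r)\,dr$ and $m(\alpha)=\max\{\frac{\alpha}{2},\frac{2-2\alpha}{2-\alpha}\}$. For $0<\gamma<1$ and $f\in C^1(\overline{Q_2})$ let $\Lambda^\gamma f(z)=\int_{Q_2}\frac{f(z)-f(z')}{|z-z'|^{2+\gamma}}\,dz'$, and for $1\le p<\infty$ let $W^{\gamma,p}(Q_2)$ be the completion of $C^1(\overline{Q_2})$ in the norm $\|f\|_{L^p(Q_2)}+\|\Lambda^\gamma f\|_{L^p(Q_2)}$, regarded as a subspace of $L^p(Q_2)$; let $W^{0,p}(Q_2)=L^p(Q_2)$.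 For $s\ge1$, $f\in W^{s,p}(Q_2)$ means that all weak derivatives of $f$ of order at most $\lfloor s\rfloor$ (including $f$ itself) exist and belong to $W^{s-\lfloor s\rfloor,p}(Q_2)$. **Lemma.** For every $\alpha\in(0,1)$ the function $T_{\psi_\alpha}$ has finite integral over $(0,1)$, $\psi^\alpha\in W^{1,\infty}(Q_2)\cap W^{2,\infty}_{\rm loc}(Q_2)$, and: 1. $\psi^\alpha$ has the same level sets in $Q_2$ as $\psi_\alpha$; $\psi^\alpha>0$ on $Q_2$; $\psi^\alpha$ is continuous on $\overline{Q_2}$ and $\psi^\alpha=0$ on $\partial Q_2$. 2. $T_{\psi^\alpha}(r)=1$ for all $r\in(0,\|\psi^\alpha\|_{L^\infty(Q_2)})$. 3. For every $\gamma\in[0,1]$, $\psi^\alpha\in W^{2+\gamma,p}(Q_2)$ whenever $1\le p<(m(\alpha)+\gamma)^{-1}$. The range in 3 is largest for $\alpha_*=3-\sqrt5$: one has $\alpha_*\in(0,1)$ and $m(\alpha_*)<m(\alpha)$ for every $\alpha\in(0,1)\setminus\{\alpha_*\}$, and $\psi^{\alpha_*}\in W^{2+\gamma,p}(Q_2)$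 for all $\gamma\in[0,\frac{\sqrt5-1}{2})$ and $p\in[1,\frac{2}{3-\sqrt5+2\gamma})$. -/

import Mathlib

open MeasureTheory Set Filter Topology
open scoped ENNReal ContDiff

noncomputable section

namespace SquareFlow

/-- The Euclidean plane. -/
abbrev Plane : Type := EuclideanSpace ℝ (Fin 2)

/-- The open unit square `(0,1)²`. -/
def Q : Set Plane := {x | ∀ i, x i ∈ Ioo (0 : ℝ) 1}

/-- The stream function `2^α sin(πx) sin(πy) / (sin(πx) + sin(πy))^α`. On the sides of the closed
square the formula gives `0`; at the four corners it reads `0 / 0 = 0`, which is the limit there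
when `α < 2`. -/
def psi (α : ℝ) (x : Plane) : ℝ :=
  (2 : ℝ) ^ α * (Real.sin (Real.pi * x 0) * Real.sin (Real.pi * x 1)) /
    (Real.sin (Real.pi * x 0) + Real.sin (Real.pi * x 1)) ^ α

/-- The level set `{f = r}` in the open square. -/
def levelSet (f : Plane → ℝ) (r : ℝ) : Set Plane := {x | x ∈ Q ∧ f x = r}

/-- The traversal time `∫_{f = r} |∇f|⁻¹ dσ`, with `σ` arc length (one-dimensional Hausdorff
measure), as a number in `[0, ∞]`. -/
def period (f : Plane → ℝ) (r : ℝ) : ℝ≥0∞ :=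
  ∫⁻ x in levelSet f r, (ENNReal.ofReal ‖gradient f x‖)⁻¹ ∂(Measure.hausdorffMeasure 1)

/-- The reparametrized stream function `∫_0^{ψ_α(x)} T_{ψ_α}(r) dr`. -/
def psiRe (α : ℝ) (x : Plane) : ℝ :=
  (∫⁻ r in Ioo (0 : ℝ) (psi α x), period (psi α) r).toReal

/-- `g` is the weak partial derivative `∂_{J 0} ⋯ ∂_{J (k-1)} f` on the open set `U`. -/
def HasWeakPartial (U : Set Plane) (k : ℕ) (J : Fin k → Fin 2) (f g : Plane → ℝ) : Prop :=
  LocallyIntegrableOn f U ∧ LocallyIntegrableOn g U ∧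
    ∀ φ : Plane → ℝ, ContDiff ℝ ∞ φ → HasCompactSupport φ → tsupport φ ⊆ U →
      ∫ x in U, f x * iteratedFDeriv ℝ k φ x (fun i => EuclideanSpace.single (J i) (1 : ℝ)) =
        (-1) ^ k * ∫ x in U, g x * φ x

/-- The Sobolev space `W^{k,p}(U)` of integer order on an open set `U`. -/
def MemSobolev (U : Set Plane) (k : ℕ) (p : ℝ≥0∞) (f : Plane → ℝ) : Prop :=
  ∀ j ≤ k, ∀ J : Fin j → Fin 2, ∃ g : Plane → ℝ,
    HasWeakPartial U j J f g ∧ MemLp g p (volume.restrict U)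

/-- The local Sobolev space `W^{k,p}_loc(Q)`: in `W^{k,p}(U)` for every open `U` whose closure is a
compact subset of `Q`. -/
def MemSobolevLoc (k : ℕ) (p : ℝ≥0∞) (f : Plane → ℝ) : Prop :=
  ∀ U : Set Plane, IsOpen U → IsCompact (closure U) → closure U ⊆ Q → MemSobolev U k p f

/-- `Λ^γ f (x) = ∫_Q (f(x) - f(x')) / |x - x'|^{2+γ} dx'`, an absolutely convergent integral for
`x ∈ Q`, `0 < γ < 1` and `f` of class `C¹` up to the boundary. -/
def fracLap (γ : ℝ) (f : Plane → ℝ) (x : Plane) : ℝ :=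
  ∫ x' in Q, (f x - f x') / ‖x - x'‖ ^ (2 + γ)

/-- `W^{γ,p}(Q)` for `0 ≤ γ < 1`: it is `L^p(Q)` for `γ = 0`, and for `γ > 0` the completion of
`C¹` (up to the boundary, that is, restrictions to `Q` of `C¹` functions on the plane) in the norm
`‖f‖_{L^p} + ‖Λ^γ f‖_{L^p}`. By symmetry of `Λ^γ` against test functions the completion embeds in
`L^p(Q)`; its elements are the `L^p` limits of sequences `u n` for which `Λ^γ (u n)` converges in
`L^p(Q)` too. -/
def MemFrac (γ : ℝ) (p : ℝ≥0∞) (f : Plane → ℝ) : Prop :=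
  MemLp f p (volume.restrict Q) ∧
    (γ ≠ 0 → ∃ (u : ℕ → Plane → ℝ) (g : Plane → ℝ),
      (∀ n, ContDiff ℝ 1 (u n)) ∧
      (∀ n, MemLp (fracLap γ (u n)) p (volume.restrict Q)) ∧
      MemLp g p (volume.restrict Q) ∧
      Tendsto (fun n => eLpNorm (u n - f) p (volume.restrict Q)) atTop (𝓝 0) ∧
      Tendsto (fun n => eLpNorm (fracLap γ (u n) - g) p (volume.restrict Q)) atTop (𝓝 0))

/-- `W^{s,p}(Q)` for real `s ≥ 0`: all weak derivatives of order at most `⌊s⌋` belong to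
`W^{s-⌊s⌋,p}(Q)`. -/
def MemFracSobolev (s : ℝ) (p : ℝ≥0∞) (f : Plane → ℝ) : Prop :=
  ∀ j ≤ ⌊s⌋₊, ∀ J : Fin j → Fin 2, ∃ g : Plane → ℝ,
    HasWeakPartial Q j J f g ∧ MemFrac (s - ⌊s⌋₊) p g

/-- The exponent `max {α/2, (2-2α)/(2-α)}`. -/
def mexp (α : ℝ) : ℝ := max (α / 2) ((2 - 2 * α) / (2 - α))

end SquareFlow

end

/-! Put u = sin(πx), v = sin(πy). The stream function is homogeneous of degree 2 - α in (u, v): it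
equals u^(2-α) R(v/u) with R = `ratioFun α`, which is real analytic with positive derivative on (-1,
∞) and satisfies R(0) = 0, R(1) = 1. Let φ be the inverse of R, b = 1 - α/2, and write the level as
r = s^b.

Traversal time. The symmetries of the square cut {psi = r} into eight congruent arcs, up to a null
set; one lies in the triangle y < x < 1/2. There use η = u² = 1 - (1-s)t with 0 < t < 1 as
parameter; with ξ = (s/η)^b one has v = φ(ξ)u. Along the arc dσ/|∇psi| = |dx|/|∂_y psi|. Writing 1 -
φ(ξ)² = P(ξ)(1 - ξ^(1/b)), where P is positive and analytic on some (0, M) with M > 1, the vanishing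
factors 1 - s in dx and in cos(πy) cancel, and T(r) = (4/π²) ∫_0^1 t^(-1/2) η^(-b) φ'(ξ) (t +
(1-t)P(ξ))^(-1/2) dt. The right side still makes sense for s slightly larger than 1, so T extends as
a positive C² function beyond the maximal level r = 1 (`exists_ratioInverse`,
`RatioInverse.speed_mul_inv_gradient`). An s-derivative turns the size η^(-b) of the integrand into
η^(-b) ξ/s = s^(b-1) η^(-2b), and since 2b > 1 the integral of t^(-1/2) η^(-2b) is O(s^(1-2b)). In
terms of r this says that T is bounded, T' = O(r^(-κ)) and T'' = O(r^(-κ-1)), with κ = (2-2α)/(2-α)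
(`exists_periodProfile`).

Reparametrization. The new function is G(psi), where G is the strictly increasing primitive of T.
Level sets are therefore only relabelled, and on {psi = r} the gradient is multiplied by T(r), which
makes the traversal time 1.

Regularity. Let S = uv. By homogeneity the n-th derivative of psi is O((u+v)^(2-α-n)); moreover psi
≥ S and (u+v)² ≥ S. In D²(G(psi)) = T D²psi + T' ∇psi ⊗ ∇psi the two terms are O(S^(-α/2)) and
O(S^(-κ)), which is where m = max(α/2, κ) comes from; the third derivatives are O(S^(-m-1))
(`exists_bound_psiRe`). A function of size S^(-m) with gradient of size S^(-m-1) is θ-Hölder with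
weight S^(-(m+θ)), and this weight is in L^p as soon as p(m+θ) < 1. Choosing γ < θ < 1/p - m leaves
an integrable kernel |x-y|^(θ-γ-2), bounded on L^p by Schur's test. Composing with smooth
contractions of the square into its interior that increase S gives C¹ approximants dominated
uniformly, and dominated convergence concludes (`memFrac_of_bounds`).

Optimal α. α/2 increases and κ decreases; they agree where α² - 6α + 4 = 0, that is at α = 3 - √5 in
(0, 1). -/

namespace SquareFlow

/-! ### Arc length: the one-dimensional area formula for injective C¹ curves. -/

section Curve

variable {E : Type*} [NormedAddCommGroup E] [NormedSpace ℝ E] [MeasurableSpace E] [BorelSpace E]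

open scoped NNReal

/-- Near a point, a strictly differentiable curve distorts one-dimensional Hausdorff measure by a
factor close to its speed. -/
theorem exists_hausdorffMeasure_image_near {c : ℝ → E} {v : E} {t : ℝ}
    (hc : HasStrictDerivAt c v t) {ε : ℝ} (hε : 0 < ε) :
    ∃ δ > 0, ∀ A ⊆ Metric.ball t δ,
      Measure.hausdorffMeasure 1 (c '' A) ≤ ENNReal.ofReal (‖v‖ + ε) * volume A ∧
      ENNReal.ofReal (‖v‖ - ε) * volume A ≤ Measure.hausdorffMeasure 1 (c '' A) := by
  have h := (hasStrictFDerivAt_iff_isLittleO.1 hc.hasStrictFDerivAt).def hε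
  obtain ⟨δ, hδ, hδ'⟩ := Metric.eventually_nhds_iff_ball.1 h
  refine ⟨δ, hδ, fun A hA => ?_⟩
  -- Strict differentiability compares `c` on all of `A` with the affine map of slope `v`; this
  -- yields both a Lipschitz constant ‖v‖ + ε and, if ‖v‖ > ε, an antilipschitz constant 1/(‖v‖ -
  -- ε).
  have key : ∀ x ∈ A, ∀ y ∈ A, ‖c x - c y - (x - y) • v‖ ≤ ε * ‖x - y‖ := by
    intro x hx y hy
    have := hδ' (x, y) (by
      rw [Metric.mem_ball, Prod.dist_eq]
      exact max_lt (hA hx) (hA hy))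
    simpa using this
  constructor
  · have hL : LipschitzOnWith (Real.toNNReal (‖v‖ + ε)) c A := by
      refine LipschitzOnWith.of_dist_le_mul fun x hx y hy => ?_
      rw [Real.coe_toNNReal _ (by positivity), dist_eq_norm, dist_eq_norm]
      calc ‖c x - c y‖ = ‖(c x - c y - (x - y) • v) + (x - y) • v‖ := by abel_nf
        _ ≤ ‖c x - c y - (x - y) • v‖ + ‖(x - y) • v‖ := norm_add_le _ _
        _ ≤ ε * ‖x - y‖ + ‖x - y‖ * ‖v‖ := by rw [norm_smul]; gcongr; exact key x hx y hy
        _ = _ := by ring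
    have := hL.hausdorffMeasure_image_le (d := 1) zero_le_one
    rw [hausdorffMeasure_real] at this
    simpa [ENNReal.ofReal] using this
  · rcases le_or_gt (‖v‖ - ε) 0 with h0 | h0
    · simp [ENNReal.ofReal_of_nonpos h0]
    have hL : AntilipschitzWith (Real.toNNReal (‖v‖ - ε)⁻¹) (A.domRestrict c) := by
      refine AntilipschitzWith.of_le_mul_dist fun x y => ?_
      rw [Real.coe_toNNReal _ (by positivity), inv_mul_eq_div, le_div_iff₀ h0]
      have h1 := key x x.2 y y.2
      have h2 : ‖((x : ℝ) - y) • v‖ ≤ ‖c x - c y‖ + ‖c x - c y - ((x : ℝ) - y) • v‖ := by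
        have := norm_sub_le (c x - c y) (c x - c y - ((x : ℝ) - y) • v)
        simpa using this
      rw [norm_smul] at h2
      rw [Subtype.dist_eq, dist_eq_norm, dist_eq_norm]
      simp only [domRestrict_apply]
      nlinarith
    have := hL.le_hausdorffMeasure_image (d := 1) zero_le_one univ
    have h3 : Measure.hausdorffMeasure (X := A) 1 univ = volume A := by
      rw [← isometry_subtype_coe.hausdorffMeasure_image (Or.inl zero_le_one), image_univ,
        Subtype.range_coe, hausdorffMeasure_real]
    rw [h3, ENNReal.rpow_one, image_univ, range_domRestrict] at this
    calc ENNReal.ofReal (‖v‖ - ε) * volume A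
        ≤ ENNReal.ofReal (‖v‖ - ε) * (ENNReal.ofReal (‖v‖ - ε)⁻¹ *
            Measure.hausdorffMeasure 1 (c '' A)) := by gcongr; exact this
      _ = Measure.hausdorffMeasure 1 (c '' A) := by
        rw [← mul_assoc, ← ENNReal.ofReal_mul h0.le, mul_inv_cancel₀ h0.ne', ENNReal.ofReal_one,
          one_mul]

/-- A measure on the line whose local growth rate on an open interval is a continuous function
has that function as its density. -/
theorem restrict_eq_withDensity_of_growth {ν : Measure ℝ} {s : ℝ → ℝ} {a b : ℝ}
    (hs : ContinuousOn s (Ioo a b)) (hs0 : ∀ t, 0 ≤ s t)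
    (hν : ∀ t ∈ Ioo a b, ∀ ε > 0, ∃ δ > 0, ∀ A ⊆ Metric.ball t δ, A ⊆ Ioo a b → MeasurableSet A →
      ν A ≤ ENNReal.ofReal (s t + ε) * volume A ∧ ENNReal.ofReal (s t - ε) * volume A ≤ ν A) :
    ν.restrict (Ioo a b) = (volume.restrict (Ioo a b)).withDensity fun t => ENNReal.ofReal (s t) := by
  have hfin : ∀ p q, a < p → q < b → ν (Icc p q) < ⊤ := by
    intro p q hp hq
    refine isCompact_Icc.measure_lt_top_of_nhdsWithin fun x hx => ?_
    have hxI : x ∈ Ioo a b := ⟨hp.trans_le hx.1, hx.2.trans_lt hq⟩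
    obtain ⟨δ, hδ, h⟩ := hν x hxI 1 one_pos
    refine Measure.FiniteAtFilter.filter_mono nhdsWithin_le_nhds
      ⟨Metric.ball x δ ∩ Ioo a b, inter_mem (Metric.ball_mem_nhds _ hδ) (Ioo_mem_nhds hxI.1 hxI.2), ?_⟩
    refine ((h _ inter_subset_left inter_subset_right
      (measurableSet_ball.inter measurableSet_Ioo)).1).trans_lt ?_
    refine ENNReal.mul_lt_top ENNReal.ofReal_lt_top ?_
    exact (measure_mono inter_subset_left).trans_lt measure_ball_lt_top
  have hIoc : ∀ p q, a < p → p ≤ q → q < b →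
      ν (Ioc p q) = ∫⁻ t in Ioc p q, ENNReal.ofReal (s t) := by
    intro p q hp hpq hq
    obtain ⟨p', hp', hpp⟩ := exists_between hp
    obtain ⟨q', hqq, hq'⟩ := exists_between hq
    have hfin' : ∀ x y, p' ≤ x → y ≤ q' → ν (Ioc x y) ≠ ⊤ := fun x y hx hy =>
      ((measure_mono (Ioc_subset_Icc_self.trans (Icc_subset_Icc hx hy))).trans_lt
        (hfin p' q' hp' hq')).ne
    -- The distribution function of `ν` based at a point `p'` to the left of `p`. The growth
    -- hypothesis says exactly that it is differentiable with derivative `s`, so the fundamental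
    -- theorem of calculus evaluates `ν (Ioc p q)`.
    set F : ℝ → ℝ := fun x => (ν (Ioc p' x)).toReal with hF
    have hdiff : ∀ x y, p' ≤ x → x ≤ y → y ≤ q' → F y - F x = (ν (Ioc x y)).toReal := by
      intro x y hx hxy hy
      have : ν (Ioc p' y) = ν (Ioc p' x) + ν (Ioc x y) := by
        rw [← Ioc_union_Ioc_eq_Ioc hx hxy, measure_union (Ioc_disjoint_Ioc_of_le le_rfl)
          measurableSet_Ioc]
      simp only [hF]
      rw [this, ENNReal.toReal_add (hfin' _ _ le_rfl (hxy.trans hy)) (hfin' _ _ hx hy)]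
      ring
    have hder : ∀ x ∈ Ioo p' q', HasDerivAt F (s x) x := by
      intro x hx
      rw [hasDerivAt_iff_isLittleO, Asymptotics.isLittleO_iff]
      intro ε hε
      obtain ⟨δ, hδ, h⟩ := hν x ⟨hp'.trans hx.1, hx.2.trans hq'⟩ ε hε
      have est : ∀ y z, y ≤ z → p' < y → z < q' → Ioc y z ⊆ Metric.ball x δ →
          |(ν (Ioc y z)).toReal - s x * (z - y)| ≤ ε * (z - y) := by
        intro y z hyz hy hz hb
        obtain ⟨h1, h2⟩ := h _ hb (fun w hw => ⟨hp'.trans (hy.trans hw.1), hw.2.trans_lt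
          (hz.trans hq')⟩) measurableSet_Ioc
        rw [Real.volume_Ioc] at h1 h2
        have h1' := ENNReal.toReal_mono (ENNReal.mul_ne_top ENNReal.ofReal_ne_top
          ENNReal.ofReal_ne_top) h1
        have h2' := ENNReal.toReal_mono (hfin' _ _ hy.le hz.le) h2
        rw [ENNReal.toReal_mul, ENNReal.toReal_ofReal (by linarith [hs0 x]),
          ENNReal.toReal_ofReal (by linarith)] at h1'
        rw [ENNReal.toReal_mul, ENNReal.toReal_ofReal (sub_nonneg.2 hyz)] at h2'
        have h3 : (s x - ε) * (z - y) ≤ (ENNReal.ofReal (s x - ε)).toReal * (z - y) :=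
          mul_le_mul_of_nonneg_right ((le_max_left _ _).trans_eq
            (ENNReal.toReal_ofReal' ).symm) (sub_nonneg.2 hyz)
        rw [abs_le]
        constructor <;> nlinarith
      filter_upwards [Ioo_mem_nhds hx.1 hx.2, Metric.ball_mem_nhds x hδ] with y hy hyδ
      rw [Real.norm_eq_abs, Real.norm_eq_abs, smul_eq_mul]
      have hbx := Metric.mem_ball_self (x := x) hδ
      have hord : (Metric.ball x δ).OrdConnected := (convex_ball x δ).ordConnected
      rcases le_total x y with hxy | hxy
      · rw [hdiff x y hx.1.le hxy hy.2.le, mul_comm (y - x)]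
        rw [abs_of_nonneg (sub_nonneg.2 hxy)]
        exact est x y hxy hx.1 hy.2 (Ioc_subset_Icc_self.trans (hord.out hbx hyδ))
      · have h4 := hdiff y x hy.1.le hxy hx.2.le
        have h5 := est y x hxy hy.1 hx.2 (Ioc_subset_Icc_self.trans (hord.out hyδ hbx))
        rw [← h4] at h5
        rw [abs_sub_comm y x, abs_of_nonneg (sub_nonneg.2 hxy), ← abs_neg]
        convert! h5 using 2
        ring
    have hsc : ContinuousOn s (Icc p q) :=
      hs.mono fun x hx => ⟨hp.trans_le hx.1, hx.2.trans_lt hq⟩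
    have hint : ∫ t in p..q, s t = F q - F p := by
      refine intervalIntegral.integral_eq_sub_of_hasDerivAt (fun x hx => ?_) ?_
      · rw [uIcc_of_le hpq] at hx
        exact hder x ⟨hpp.trans_le hx.1, hx.2.trans_lt hqq⟩
      · exact (by rwa [uIcc_of_le hpq] : ContinuousOn s (uIcc p q)).intervalIntegrable
    rw [hdiff p q hpp.le hpq hqq.le, intervalIntegral.integral_of_le hpq] at hint
    rw [← ENNReal.ofReal_toReal (hfin' p q hpp.le hqq.le), ← hint,
      ofReal_integral_eq_lintegral_ofReal (hsc.integrableOn_Icc.mono_set Ioc_subset_Icc_self)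
      (ae_of_all _ hs0)]
  -- Countably many half-open intervals with rational ends exhaust the open interval. On each of
  -- them `ν` is finite, so equality on all `Ioc` sets determines it.
  let ι := {p : ℚ × ℚ // a < p.1 ∧ (p.2 : ℝ) < b}
  have hU : Ioo a b = ⋃ i : ι, Ioc (i.1.1 : ℝ) i.1.2 := by
    ext t
    simp only [mem_iUnion]
    constructor
    · intro ht
      obtain ⟨p, hp1, hp2⟩ := exists_rat_btwn ht.1
      obtain ⟨q, hq1, hq2⟩ := exists_rat_btwn ht.2
      exact ⟨⟨(p, q), hp1, hq2⟩, hp2, hq1.le⟩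
    · rintro ⟨i, h1, h2⟩
      exact ⟨i.2.1.trans h1, h2.trans_lt i.2.2⟩
  have hdens : (volume.restrict (Ioo a b)).withDensity (fun t => ENNReal.ofReal (s t)) =
      (volume.withDensity fun t => ENNReal.ofReal (s t)).restrict (Ioo a b) :=
    (restrict_withDensity measurableSet_Ioo _).symm
  rw [hdens, hU, Measure.restrict_iUnion_congr]
  intro i
  have : IsFiniteMeasure (ν.restrict (Ioc (i.1.1 : ℝ) i.1.2)) := by
    refine ⟨?_⟩
    rw [Measure.restrict_apply_univ]
    exact (measure_mono Ioc_subset_Icc_self).trans_lt (hfin _ _ i.2.1 i.2.2)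
  refine Measure.ext_of_Ioc _ _ fun p q _ => ?_
  rw [Measure.restrict_apply measurableSet_Ioc, Measure.restrict_apply measurableSet_Ioc,
    Ioc_inter_Ioc, withDensity_apply _ measurableSet_Ioc]
  rcases le_total (max p (i.1.1 : ℝ)) (min q i.1.2) with h | h
  · exact hIoc _ _ (i.2.1.trans_le (le_max_right _ _)) h ((min_le_right _ _).trans_lt i.2.2)
  · simp [Ioc_eq_empty_of_le h]

/-- Integration along an injective `C¹` curve with respect to arc length. -/
theorem lintegral_image_hausdorffMeasure_one [SecondCountableTopology E] {c c' : ℝ → E} {a b : ℝ}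
    (hc : ∀ t ∈ Ioo a b, HasStrictDerivAt c (c' t) t) (hc' : ContinuousOn c' (Ioo a b))
    (hinj : InjOn c (Ioo a b)) {f : E → ℝ≥0∞} (hf : Measurable f) :
    ∫⁻ x in c '' Ioo a b, f x ∂(Measure.hausdorffMeasure 1) =
      ∫⁻ t in Ioo a b, ENNReal.ofReal ‖c' t‖ * f (c t) := by
  have hcc : ContinuousOn c (Ioo a b) := fun t ht => (hc t ht).hasDerivAt.continuousAt.continuousWithinAt
  have hemb : MeasurableEmbedding ((Ioo a b).domRestrict c) :=
    hcc.measurableEmbedding measurableSet_Ioo hinj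
  set μ : Measure E := Measure.hausdorffMeasure 1
  -- Arc length pulled back to the parameter interval; its local growth rate at `t` is the speed ‖c'
  -- t‖.
  set ν : Measure ℝ := (μ.comap ((Ioo a b).domRestrict c)).map Subtype.val with hν
  have hνA : ∀ A, ν A = μ (c '' (A ∩ Ioo a b)) := by
    intro A
    rw [hν, (MeasurableEmbedding.subtype_coe measurableSet_Ioo).map_apply, hemb.comap_apply]
    congr 1
    ext x
    simp only [mem_image, mem_preimage, domRestrict_apply, Subtype.exists, mem_inter_iff]
    grind
  have h1 : ν.restrict (Ioo a b) =
      (volume.restrict (Ioo a b)).withDensity fun t => ENNReal.ofReal ‖c' t‖ := by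
    refine restrict_eq_withDensity_of_growth hc'.norm (fun t => norm_nonneg _) ?_
    intro t ht ε hε
    obtain ⟨δ, hδ, h⟩ := exists_hausdorffMeasure_image_near (hc t ht) hε
    refine ⟨δ, hδ, fun A hA hAI _ => ?_⟩
    rw [hνA, inter_eq_left.2 hAI]
    exact h A hA
  have h2 : ν.restrict (Ioo a b) = ν := by
    refine Measure.restrict_eq_self_of_ae_mem ?_
    rw [ae_iff]
    change ν (Ioo a b)ᶜ = 0
    rw [hνA]
    simp
  have h3 : c '' Ioo a b = range ((Ioo a b).domRestrict c) := by rw [range_domRestrict]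
  rw [h3, ← hemb.map_comap, hemb.lintegral_map]
  have h4 : ∫⁻ t, f ((Ioo a b).domRestrict c t) ∂(μ.comap ((Ioo a b).domRestrict c)) =
      ∫⁻ t, f (c t) ∂ν := by
    rw [hν, (MeasurableEmbedding.subtype_coe measurableSet_Ioo).lintegral_map]
    rfl
  rw [h4, ← h2, h1, lintegral_withDensity_eq_lintegral_mul₀]
  · rfl
  · exact (hc'.norm.aemeasurable measurableSet_Ioo).ennreal_ofReal
  · exact hf.comp_aemeasurable (hcc.aemeasurable measurableSet_Ioo)

end Curve

/-! ### Inverse functions, divided differences, and the profile of the stream function along rays.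
-/

/-- A function with positive derivative on an interval has an inverse of the same smoothness. -/
theorem exists_contDiffAt_inverse {f : ℝ → ℝ} {a b : ℝ} {n : WithTop ℕ∞} (hn : n ≠ 0) (hab : a ≤ b)
    (hf : ∀ x ∈ Icc a b, ContDiffAt ℝ n f x) (hd : ∀ x ∈ Icc a b, 0 < deriv f x) :
    StrictMonoOn f (Icc a b) ∧ ∃ g : ℝ → ℝ, (∀ x ∈ Ioo a b, g (f x) = x) ∧
      ∀ y ∈ Ioo (f a) (f b), g y ∈ Ioo a b ∧ f (g y) = y ∧ ContDiffAt ℝ n g y := by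
  have hcont : ContinuousOn f (Icc a b) := fun x hx => (hf x hx).continuousAt.continuousWithinAt
  have hmono : StrictMonoOn f (Icc a b) :=
    strictMonoOn_of_deriv_pos (convex_Icc a b) hcont fun x hx => hd x (interior_subset hx)
  have hinj : InjOn f (Ioo a b) := hmono.injOn.mono Ioo_subset_Icc_self
  have hleft : ∀ x ∈ Ioo a b, Function.invFunOn f (Ioo a b) (f x) = x := fun x hx =>
    hinj.leftInvOn_invFunOn hx
  refine ⟨hmono, Function.invFunOn f (Ioo a b), hleft, fun y hy => ?_⟩
  obtain ⟨x, hx, rfl⟩ := intermediate_value_Ioo hab hcont hy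
  have hxI := Ioo_subset_Icc_self hx
  refine ⟨by rwa [hleft x hx], by rw [hleft x hx], ?_⟩
  have hfx := hf x hxI
  have hda : HasFDerivAt f ((ContinuousLinearEquiv.unitsEquivAut ℝ
      (Units.mk0 (deriv f x) (hd x hxI).ne') : ℝ ≃L[ℝ] ℝ) : ℝ →L[ℝ] ℝ) x := by
    convert! ((hfx.differentiableAt hn).hasDerivAt).hasFDerivAt using 1
  have hs := hfx.hasStrictFDerivAt' hda hn
  refine (hfx.to_localInverse hda hn).congr_of_eventuallyEq ?_
  -- The global inverse inherits its smoothness from the local inverse: near `f x` the latter takes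
  -- values in `Ioo a b` and is a right inverse, so injectivity identifies the two.
  have h1 : ∀ᶠ y in 𝓝 (f x), f (hfx.localInverse hda hn y) = y := hs.eventually_right_inverse
  have h2 : ∀ᶠ y in 𝓝 (f x), hfx.localInverse hda hn y ∈ Ioo a b := by
    have h3 : Tendsto (hfx.localInverse hda hn) (𝓝 (f x)) (𝓝 x) := hs.localInverse_tendsto
    exact h3 (Ioo_mem_nhds hx.1 hx.2)
  filter_upwards [h1, h2] with y hy1 hy2
  conv_lhs => rw [← hy1]
  exact hleft _ hy2

/-- Away from `a` this is a quotient of analytic functions. At `a` the power series of `f` is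
shifted by one index, which is why analyticity `ω` is used rather than finite smoothness: no
derivative is lost. -/
theorem contDiffAt_dslope {f : ℝ → ℝ} {a x : ℝ} (ha : ContDiffAt ℝ ω f a)
    (hx : ContDiffAt ℝ ω f x) : ContDiffAt ℝ ω (dslope f a) x := by
  rcases eq_or_ne x a with rfl | h
  · obtain ⟨p, hp⟩ := hx.analyticAt
    exact (hp.has_fpower_series_dslope_fslope).analyticAt.contDiffAt
  · refine ContDiffAt.congr_of_eventuallyEq ?_ (dslope_eventuallyEq_slope_of_ne f h)
    have : slope f a = fun y => (y - a)⁻¹ * (f y - f a) := by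
      ext y; simp [slope]
    rw [this]
    exact ((contDiffAt_id.sub contDiffAt_const).inv (sub_ne_zero.2 h)).mul
      (hx.sub contDiffAt_const)

/-- The stream function along a ray from the corner: it equals `u ^ (2 - α)` times this function of
the ratio `v / u`. -/
noncomputable def ratioFun (α z : ℝ) : ℝ := z * (2 / (1 + z)) ^ α

theorem contDiffAt_ratioFun {α z : ℝ} {n : WithTop ℕ∞} (hz : -1 < z) :
    ContDiffAt ℝ n (ratioFun α) z := by
  unfold ratioFun
  have h : 1 + z ≠ 0 := by linarith
  refine contDiffAt_id.mul (ContDiffAt.rpow_const_of_ne ?_ ?_)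
  · exact contDiffAt_const.div (contDiffAt_const.add contDiffAt_id) h
  · exact div_ne_zero two_ne_zero h

theorem hasDerivAt_ratioFun {α z : ℝ} (hz : -1 < z) :
    HasDerivAt (ratioFun α) ((2 / (1 + z)) ^ α * ((1 + (1 - α) * z) / (1 + z))) z := by
  unfold ratioFun
  have h : 0 < 1 + z := by linarith
  have h2 : 0 < 2 / (1 + z) := by positivity
  have h1 : HasDerivAt (fun z : ℝ => 2 / (1 + z)) (-2 / (1 + z) ^ 2) z := by
    have := ((hasDerivAt_id z).const_add 1).inv h.ne' |>.const_mul 2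
    convert! this using 1
    simp; ring
  have := (hasDerivAt_id z).mul (h1.rpow_const (p := α) (Or.inl h2.ne'))
  convert! this using 1
  rw [Real.rpow_sub_one h2.ne']
  simp only [id]
  field_simp
  ring

theorem deriv_ratioFun_pos {α z : ℝ} (h0 : 0 < α) (h1 : α < 1) (hz : -1 < z) :
    0 < deriv (ratioFun α) z := by
  rw [(hasDerivAt_ratioFun hz).deriv]
  have h : 0 < 1 + z := by linarith
  have : 0 < 1 + (1 - α) * z := by nlinarith
  positivity

theorem ratioFun_zero (α : ℝ) : ratioFun α 0 = 0 := by simp [ratioFun]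

theorem ratioFun_one (α : ℝ) : ratioFun α 1 = 1 := by norm_num [ratioFun]

/-- The inverse of `ratioFun α`. -/
theorem exists_ratioInv {α : ℝ} (h0 : 0 < α) (h1 : α < 1) :
    ∃ (φ : ℝ → ℝ) (ω₀ ω₁ : ℝ), ω₀ < 0 ∧ 1 < ω₁ ∧ (∀ ξ ∈ Ioo ω₀ ω₁, ContDiffAt ℝ ω φ ξ) ∧
      (∀ z ∈ Ioo (0 : ℝ) 1, φ (ratioFun α z) = z ∧ ratioFun α z ∈ Ioo (0 : ℝ) 1) ∧
      (∀ ξ ∈ Ioo ω₀ ω₁, ratioFun α (φ ξ) = ξ) ∧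
      (∀ ξ ∈ Ioo ω₀ ω₁, 0 < deriv φ ξ ∧
        deriv φ ξ = (deriv (ratioFun α) (φ ξ))⁻¹) ∧
      φ 0 = 0 ∧ φ 1 = 1 := by
  have hmem : ∀ {x}, x ∈ Icc (-1 / 2 : ℝ) 2 → -1 < x := fun hx => by linarith [hx.1]
  -- Any compact interval inside (-1, ∞) with 0 and 1 in its interior would do. The margin makes the
  -- inverse analytic across both values 0 and 1.
  obtain ⟨hmono, φ, hl, hr⟩ := exists_contDiffAt_inverse (f := ratioFun α) (a := -1 / 2) (b := 2)
    (n := ω) (by simp) (by norm_num) (fun x hx => contDiffAt_ratioFun (hmem hx))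
    (fun x hx => deriv_ratioFun_pos h0 h1 (hmem hx))
  refine ⟨φ, ratioFun α (-1 / 2), ratioFun α 2, ?_, ?_, fun ξ hξ => (hr ξ hξ).2.2, ?_,
    fun ξ hξ => (hr ξ hξ).2.1, ?_, ?_, ?_⟩
  · rw [← ratioFun_zero α]; exact hmono (by norm_num) (by norm_num) (by norm_num)
  · rw [← ratioFun_one α]; exact hmono (by norm_num) (by norm_num) (by norm_num)
  · intro z hz
    refine ⟨hl z ⟨by linarith [hz.1], by linarith [hz.2]⟩, ?_, ?_⟩
    · rw [← ratioFun_zero α]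
      exact hmono (by norm_num) ⟨by linarith [hz.1], by linarith [hz.2]⟩ hz.1
    · conv_rhs => rw [← ratioFun_one α]
      exact hmono ⟨by linarith [hz.1], by linarith [hz.2]⟩ (by norm_num) hz.2
  · intro ξ hξ
    obtain ⟨hI, hξ', hc⟩ := hr ξ hξ
    have hz := hmem (Ioo_subset_Icc_self hI)
    have hp := deriv_ratioFun_pos h0 h1 hz
    have h3 : HasDerivAt φ (deriv φ ξ) ξ := (hc.differentiableAt (by simp)).hasDerivAt
    have h4 : HasDerivAt (ratioFun α) (deriv (ratioFun α) (φ ξ)) (φ ξ) :=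
      ((contDiffAt_ratioFun (n := 1) hz).differentiableAt (by simp)).hasDerivAt
    have h5 : HasDerivAt (fun x => ratioFun α (φ x)) (deriv (ratioFun α) (φ ξ) * deriv φ ξ) ξ :=
      h4.comp ξ h3
    have h6 : HasDerivAt (fun x => ratioFun α (φ x)) 1 ξ := by
      refine (hasDerivAt_id ξ).congr_of_eventuallyEq ?_
      filter_upwards [Ioo_mem_nhds hξ.1 hξ.2] with x hx using (hr x hx).2.1
    have h7 := h5.unique h6
    have h8 : deriv φ ξ = (deriv (ratioFun α) (φ ξ))⁻¹ := eq_inv_of_mul_eq_one_right h7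
    exact ⟨by rw [h8]; positivity, h8⟩
  · have := hl 0 (by norm_num)
    rwa [ratioFun_zero] at this
  · have := hl 1 (by norm_num)
    rwa [ratioFun_one] at this

/-! ### Profiles: functions of the relative level with a mild singularity at 0. -/

/-- Functions on `(0, M)` that are bounded with their first derivative, and whose second derivative
is at most of the size of `ξ⁻¹`. -/
structure IsProfile (M : ℝ) (Θ : ℝ → ℝ) : Prop where
  analyticAt : ∀ ξ ∈ Ioo 0 M, AnalyticAt ℝ Θ ξ
  bound : ∃ C, ∀ ξ ∈ Ioo 0 M, |Θ ξ| ≤ C ∧ |deriv Θ ξ| ≤ C ∧ |deriv (deriv Θ) ξ| ≤ C / ξ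

theorem exists_bound_of_analyticAt {Θ : ℝ → ℝ} {a c : ℝ} (h : ∀ ξ ∈ Icc a c, AnalyticAt ℝ Θ ξ) :
    ∃ C, 0 ≤ C ∧ ∀ ξ ∈ Icc a c, |Θ ξ| ≤ C ∧ |deriv Θ ξ| ≤ C ∧ |deriv (deriv Θ) ξ| ≤ C := by
  obtain ⟨C₀, h₀⟩ := isCompact_Icc.exists_bound_of_continuousOn (f := Θ) (s := Icc a c)
    fun ξ hξ => (h ξ hξ).continuousAt.continuousWithinAt
  obtain ⟨C₁, h₁⟩ := isCompact_Icc.exists_bound_of_continuousOn (f := deriv Θ) (s := Icc a c)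
    fun ξ hξ => (h ξ hξ).deriv.continuousAt.continuousWithinAt
  obtain ⟨C₂, h₂⟩ := isCompact_Icc.exists_bound_of_continuousOn (f := deriv (deriv Θ)) (s := Icc a c)
    fun ξ hξ => (h ξ hξ).deriv.deriv.continuousAt.continuousWithinAt
  refine ⟨max 0 (max C₀ (max C₁ C₂)), le_max_left _ _, fun ξ hξ => ⟨?_, ?_, ?_⟩⟩
  · exact (h₀ ξ hξ).trans (by simp)
  · exact (h₁ ξ hξ).trans (by simp)
  · exact (h₂ ξ hξ).trans (by simp)

theorem IsProfile.of_analyticAt_Icc {Θ : ℝ → ℝ} {M : ℝ} (h : ∀ ξ ∈ Icc 0 M, AnalyticAt ℝ Θ ξ) :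
    IsProfile M Θ := by
  obtain ⟨C, hC0, hC⟩ := exists_bound_of_analyticAt h
  refine ⟨fun ξ hξ => h ξ (Ioo_subset_Icc_self hξ), max C (C * M), fun ξ hξ => ?_⟩
  obtain ⟨h1, h2, h3⟩ := hC ξ (Ioo_subset_Icc_self hξ)
  refine ⟨h1.trans (le_max_left _ _), h2.trans (le_max_left _ _), ?_⟩
  rw [le_div_iff₀ hξ.1]
  exact (mul_le_mul h3 hξ.2.le hξ.1.le hC0).trans (le_max_right _ _)

theorem analyticAt_rpow_const {k ξ : ℝ} (hξ : 0 < ξ) : AnalyticAt ℝ (fun x : ℝ => x ^ k) ξ :=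
  (Real.contDiffAt_rpow_const_of_ne (n := ω) hξ.ne').analyticAt

theorem analyticAt_dslope_rpow {k ξ : ℝ} (hξ : 0 < ξ) :
    AnalyticAt ℝ (dslope (fun x : ℝ => x ^ k) 1) ξ :=
  (contDiffAt_dslope (Real.contDiffAt_rpow_const_of_ne one_ne_zero)
    (Real.contDiffAt_rpow_const_of_ne hξ.ne')).analyticAt

/-- The divided difference of a power with exponent at least `1`. -/
theorem isProfile_dslope_rpow {k : ℝ} (hk : 1 ≤ k) {M : ℝ} :
    IsProfile M (dslope (fun x : ℝ => x ^ k) 1) := by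
  set E := dslope (fun x : ℝ => x ^ k) 1 with hE
  have hEeq : ∀ ξ, E ξ * (ξ - 1) = ξ ^ k - 1 := by
    intro ξ
    have := sub_smul_dslope (fun x : ℝ => x ^ k) 1 ξ
    simp only [smul_eq_mul, Real.one_rpow] at this
    rw [hE, ← this, mul_comm]
  have han : ∀ ξ, 0 < ξ → AnalyticAt ℝ E ξ := fun ξ hξ => analyticAt_dslope_rpow hξ
  have hE1 : ∀ ξ, 0 < ξ → deriv E ξ * (ξ - 1) + E ξ = k * ξ ^ (k - 1) := by
    intro ξ hξ
    have h1 : HasDerivAt (fun x => E x * (x - 1)) (deriv E ξ * (ξ - 1) + E ξ * 1) ξ :=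
      (han ξ hξ).differentiableAt.hasDerivAt.mul ((hasDerivAt_id ξ).sub_const 1)
    have h2 : HasDerivAt (fun x => E x * (x - 1)) (k * ξ ^ (k - 1)) ξ := by
      simp_rw [hEeq]
      exact (Real.hasDerivAt_rpow_const (Or.inl hξ.ne')).sub_const 1
    simpa using h1.unique h2
  have hE2 : ∀ ξ, 0 < ξ →
      deriv (deriv E) ξ * (ξ - 1) + 2 * deriv E ξ = k * ((k - 1) * ξ ^ (k - 1 - 1)) := by
    intro ξ hξ
    have h1 : HasDerivAt (fun x => deriv E x * (x - 1) + E x)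
        (deriv (deriv E) ξ * (ξ - 1) + deriv E ξ * 1 + deriv E ξ) ξ :=
      ((han ξ hξ).deriv.differentiableAt.hasDerivAt.mul ((hasDerivAt_id ξ).sub_const 1)).add
        (han ξ hξ).differentiableAt.hasDerivAt
    have h2 : HasDerivAt (fun x => deriv E x * (x - 1) + E x) (k * ((k - 1) * ξ ^ (k - 1 - 1))) ξ := by
      refine HasDerivAt.congr_of_eventuallyEq
        ((Real.hasDerivAt_rpow_const (Or.inl hξ.ne')).const_mul k) ?_
      filter_upwards [Ioi_mem_nhds hξ] with x hx using hE1 x hx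
    have := h1.unique h2
    linarith
  refine ⟨fun ξ hξ => han ξ hξ.1, ?_⟩
  obtain ⟨C, hC0, hC⟩ := exists_bound_of_analyticAt (Θ := E) (a := 1 / 2) (c := M)
    fun ξ hξ => han ξ (by linarith [hξ.1])
  refine ⟨max (max C (C * M)) (2 * (k * (k - 1) + 4 * (k + 4))), fun ξ hξ => ?_⟩
  have hξ0 := hξ.1
  -- For ξ ≥ 1/2 compactness suffices. For ξ ≤ 1/2 the factor ξ - 1 is at least 1/2 in modulus, so
  -- E(ξ)(ξ - 1) = ξ^k - 1 and its two derived identities can be solved for E, E', E''. The only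
  -- unbounded term is ξ^(k-2), at most 1/ξ because k ≥ 1.
  rcases le_total (1 / 2) ξ with h | h
  · obtain ⟨h1, h2, h3⟩ := hC ξ ⟨h, hξ.2.le⟩
    refine ⟨h1.trans (by simp), h2.trans (by simp), ?_⟩
    rw [le_div_iff₀ hξ0]
    exact (mul_le_mul h3 hξ.2.le hξ0.le hC0).trans (by simp)
  · have a1 : ξ ^ k ≤ 1 := Real.rpow_le_one hξ0.le (by linarith) (by linarith)
    have a2 : ξ ^ (k - 1) ≤ 1 := Real.rpow_le_one hξ0.le (by linarith) (by linarith)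
    have a3 : ξ ^ (k - 1 - 1) * ξ ≤ 1 := by
      rw [Real.rpow_sub_one hξ0.ne' (k - 1), div_mul_cancel₀ _ hξ0.ne']
      exact a2
    have p1 : 0 ≤ ξ ^ k := by positivity
    have p2 : 0 ≤ ξ ^ (k - 1) := by positivity
    have p3 : 0 ≤ ξ ^ (k - 1 - 1) * ξ := by positivity
    have key : ∀ {x y : ℝ}, x * (ξ - 1) = y → |x| ≤ 2 * |y| := by
      intro x y hxy
      rw [← hxy, abs_mul, abs_of_nonpos (by linarith : ξ - 1 ≤ 0)]
      nlinarith [abs_nonneg x]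
    have e0 : |E ξ| ≤ 2 := by
      refine (key (hEeq ξ)).trans ?_
      rw [abs_of_nonpos (by linarith)]
      linarith
    have e1 : |deriv E ξ| ≤ 2 * (k + 2) := by
      refine (key (y := k * ξ ^ (k - 1) - E ξ) (by linarith [hE1 ξ hξ0])).trans ?_
      have : |k * ξ ^ (k - 1) - E ξ| ≤ |k * ξ ^ (k - 1)| + |E ξ| := abs_sub _ _
      rw [abs_of_nonneg (by positivity : 0 ≤ k * ξ ^ (k - 1))] at this
      nlinarith
    have e2 : |deriv (deriv E) ξ| * ξ ≤ 2 * (k * (k - 1) + 4 * (k + 4)) := by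
      have h3 := key (x := deriv (deriv E) ξ) (y := k * ((k - 1) * ξ ^ (k - 1 - 1)) - 2 * deriv E ξ)
        (by linarith [hE2 ξ hξ0])
      have h4 : |k * ((k - 1) * ξ ^ (k - 1 - 1)) - 2 * deriv E ξ| ≤
          |k * ((k - 1) * ξ ^ (k - 1 - 1))| + |2 * deriv E ξ| := abs_sub _ _
      have h5 : 0 ≤ k - 1 := by linarith
      rw [abs_of_nonneg (by positivity : 0 ≤ k * ((k - 1) * ξ ^ (k - 1 - 1))), abs_mul,
        abs_two] at h4
      have h6 : k * (k - 1) * (ξ ^ (k - 1 - 1) * ξ) ≤ k * (k - 1) * 1 := by gcongr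
      have h7 : |deriv E ξ| * ξ ≤ 2 * (k + 2) * (1 / 2) := by gcongr
      nlinarith
    refine ⟨e0.trans ?_, e1.trans ?_, ?_⟩
    · exact le_max_of_le_right (by nlinarith)
    · exact le_max_of_le_right (by nlinarith)
    · rw [le_div_iff₀ hξ0]
      exact e2.trans (le_max_right _ _)

/-- The divided difference at `1` of a function that crosses its value there upwards is positive. -/
theorem dslope_pos {f : ℝ → ℝ} {a x : ℝ} (hd : 0 < deriv f a) (hlt : x < a → f x < f a)
    (hgt : a < x → f a < f x) : 0 < dslope f a x := by
  rcases lt_trichotomy x a with h | rfl | h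
  · rw [dslope_of_ne f h.ne, slope_def_field]
    exact div_pos_of_neg_of_neg (by linarith [hlt h]) (by linarith)
  · rwa [dslope_same]
  · rw [dslope_of_ne f h.ne', slope_def_field]
    exact div_pos (by linarith [hgt h]) (by linarith)

/-- Write ξ^k = ξ · ξ^(k-1): the second factor lies on the same side of 1 as ξ. The bound keeps the
denominator of the quotient P away from 0. -/
theorem one_le_dslope_rpow {k ξ : ℝ} (hk : 1 ≤ k) (hξ : 0 < ξ) :
    1 ≤ dslope (fun x : ℝ => x ^ k) 1 ξ := by
  have hsplit : ξ ^ k = ξ * ξ ^ (k - 1) := by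
    rw [mul_comm, Real.rpow_sub_one hξ.ne', div_mul_cancel₀ _ hξ.ne']
  rcases lt_trichotomy ξ 1 with h | rfl | h
  · rw [dslope_of_ne _ h.ne, slope_def_field, Real.one_rpow, le_div_iff_of_neg (by linarith), hsplit]
    have : ξ ^ (k - 1) ≤ 1 := Real.rpow_le_one hξ.le h.le (by linarith)
    nlinarith
  · rw [dslope_same, Real.deriv_rpow_const]
    simpa using hk
  · rw [dslope_of_ne _ h.ne', slope_def_field, Real.one_rpow, le_div_iff₀ (by linarith), hsplit]
    have : 1 ≤ ξ ^ (k - 1) := Real.one_le_rpow h.le (by linarith)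
    nlinarith

/-! ### Scaling estimates for families depending on the level and on the curve parameter. -/

/-- The affine interpolation `(1 - t) + s t`. -/
def lerp (s t : ℝ) : ℝ := 1 - (1 - s) * t

/-- The relative level `(s / lerp s t) ^ b`. -/
noncomputable def relLevel (b s t : ℝ) : ℝ := (s / lerp s t) ^ b

theorem lerp_pos {s t : ℝ} (hs : 0 < s) (ht : t ∈ Ioo (0 : ℝ) 1) : 0 < lerp s t := by
  unfold lerp; nlinarith [ht.1, ht.2, mul_pos hs ht.1]

theorem one_sub_le_lerp {s t : ℝ} (hs : 0 < s) (ht : t ∈ Ioo (0 : ℝ) 1) : 1 - t ≤ lerp s t := by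
  unfold lerp; nlinarith [ht.1, ht.2, mul_pos hs ht.1]

theorem mul_le_lerp {s t : ℝ} (ht : t ∈ Ioo (0 : ℝ) 1) : s * t ≤ lerp s t := by
  unfold lerp; nlinarith [ht.1, ht.2]

theorem min_le_lerp {s t : ℝ} (ht : t ∈ Ioo (0 : ℝ) 1) : min s 1 ≤ lerp s t := by
  unfold lerp
  rcases le_total s 1 with h | h
  · rw [min_eq_left h]; nlinarith [ht.1, ht.2]
  · rw [min_eq_right h]; nlinarith [ht.1, ht.2]

/-- The interpolation lies between `s` and 1, so the quotient is at most max(s, 1). Levels `s` above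
1 are admitted on purpose, to continue the traversal time past the maximum of the stream function.
-/
theorem div_lerp_lt {s t s₁ : ℝ} (hs : s ∈ Ioo 0 s₁) (h1 : 1 < s₁) (ht : t ∈ Ioo (0 : ℝ) 1) :
    s / lerp s t < s₁ := by
  rw [div_lt_iff₀ (lerp_pos hs.1 ht)]
  have h0 := hs.1
  rcases le_total s 1 with h | h
  · have : s ≤ lerp s t := by simpa [min_eq_left h] using min_le_lerp (s := s) ht
    nlinarith
  · have : 1 ≤ lerp s t := by simpa [min_eq_right h] using min_le_lerp (s := s) ht
    nlinarith [hs.2]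

theorem relLevel_mem {b s t s₁ : ℝ} (hb : 0 < b) (hs : s ∈ Ioo 0 s₁) (h1 : 1 < s₁)
    (ht : t ∈ Ioo (0 : ℝ) 1) : relLevel b s t ∈ Ioo 0 (s₁ ^ b) := by
  have h0 := hs.1
  have := lerp_pos h0 ht
  unfold relLevel
  exact ⟨by positivity, Real.rpow_lt_rpow (by positivity) (div_lerp_lt hs h1 ht) hb⟩

/-- Families of functions of `s` with parameter `t` that have size `lerp s t ^ k` and whose
logarithmic derivatives up to order two in `s` gain the relative level. -/
structure ScaledBound (b s₁ k : ℝ) (F F₁ F₂ : ℝ → ℝ → ℝ) : Prop where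
  cont : ContinuousOn (fun p : ℝ × ℝ => F p.1 p.2) (Ioo 0 s₁ ×ˢ Ioo 0 1)
  cont₁ : ContinuousOn (fun p : ℝ × ℝ => F₁ p.1 p.2) (Ioo 0 s₁ ×ˢ Ioo 0 1)
  cont₂ : ContinuousOn (fun p : ℝ × ℝ => F₂ p.1 p.2) (Ioo 0 s₁ ×ˢ Ioo 0 1)
  deriv₁ : ∀ s ∈ Ioo 0 s₁, ∀ t ∈ Ioo (0 : ℝ) 1, HasDerivAt (fun s => F s t) (F₁ s t) s
  deriv₂ : ∀ s ∈ Ioo 0 s₁, ∀ t ∈ Ioo (0 : ℝ) 1, HasDerivAt (fun s => F₁ s t) (F₂ s t) s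
  bound : ∃ C, 0 ≤ C ∧ ∀ s ∈ Ioo 0 s₁, ∀ t ∈ Ioo (0 : ℝ) 1,
    |F s t| ≤ C * lerp s t ^ k ∧ |F₁ s t| ≤ C * lerp s t ^ k * (relLevel b s t / s) ∧
      |F₂ s t| ≤ C * lerp s t ^ k * (relLevel b s t / s ^ 2)

namespace ScaledBound

variable {b s₁ k l : ℝ} {F F₁ F₂ G G₁ G₂ : ℝ → ℝ → ℝ}

/-- Leibniz rule. Cross terms of two first derivatives carry the relative level squared; one factor
is absorbed by its bound s₁^b, whence the constant 2 + 2 s₁^b. -/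
theorem mul (hb : 0 < b) (h1 : 1 < s₁) (hF : ScaledBound b s₁ k F F₁ F₂)
    (hG : ScaledBound b s₁ l G G₁ G₂) :
    ScaledBound b s₁ (k + l) (fun s t => F s t * G s t)
      (fun s t => F₁ s t * G s t + F s t * G₁ s t)
      (fun s t => (F₂ s t * G s t + F₁ s t * G₁ s t) + (F₁ s t * G₁ s t + F s t * G₂ s t)) where
  cont := hF.cont.mul hG.cont
  cont₁ := (hF.cont₁.mul hG.cont).add (hF.cont.mul hG.cont₁)
  cont₂ := ((hF.cont₂.mul hG.cont).add (hF.cont₁.mul hG.cont₁)).add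
    ((hF.cont₁.mul hG.cont₁).add (hF.cont.mul hG.cont₂))
  deriv₁ s hs t ht := (hF.deriv₁ s hs t ht).mul (hG.deriv₁ s hs t ht)
  deriv₂ s hs t ht := ((hF.deriv₂ s hs t ht).mul (hG.deriv₁ s hs t ht)).add
    ((hF.deriv₁ s hs t ht).mul (hG.deriv₂ s hs t ht))
  bound := by
    obtain ⟨C, hC0, hC⟩ := hF.bound
    obtain ⟨D, hD0, hD⟩ := hG.bound
    refine ⟨C * D * (2 + 2 * s₁ ^ b), by positivity, fun s hs t ht => ?_⟩
    obtain ⟨f0, f1, f2⟩ := hC s hs t ht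
    obtain ⟨g0, g1, g2⟩ := hD s hs t ht
    have hη := lerp_pos hs.1 ht
    obtain ⟨w0, w1⟩ := relLevel_mem hb hs h1 ht
    have hs0 := hs.1
    rw [Real.rpow_add hη]
    set x := lerp s t ^ k
    set y := lerp s t ^ l
    have hx : 0 < x := by positivity
    have hy : 0 < y := by positivity
    set w := relLevel b s t
    set M := s₁ ^ b
    have hM : 0 < M := w0.trans w1
    have p1 : |F₁ s t * G s t| ≤ (C * x * (w / s)) * (D * y) := by
      rw [abs_mul]; gcongr
    have p2 : |F s t * G₁ s t| ≤ (C * x) * (D * y * (w / s)) := by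
      rw [abs_mul]; gcongr
    have p3 : |F₁ s t * G₁ s t| ≤ (C * x * (w / s)) * (D * y * (w / s)) := by
      rw [abs_mul]; gcongr
    have p4 : |F₂ s t * G s t| ≤ (C * x * (w / s ^ 2)) * (D * y) := by
      rw [abs_mul]; gcongr
    have p5 : |F s t * G₂ s t| ≤ (C * x) * (D * y * (w / s ^ 2)) := by
      rw [abs_mul]; gcongr
    have hxy : 0 ≤ C * D * (x * y) := by positivity
    refine ⟨?_, ?_, ?_⟩
    · rw [abs_mul]
      calc |F s t| * |G s t| ≤ (C * x) * (D * y) := by gcongr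
        _ = C * D * (x * y) * 1 := by ring
        _ ≤ C * D * (x * y) * (2 + 2 * M) := by gcongr; linarith
        _ = _ := by ring
    · refine (abs_add_le _ _).trans ((add_le_add p1 p2).trans ?_)
      calc _ = C * D * (x * y) * (w / s) * 2 := by ring
        _ ≤ C * D * (x * y) * (w / s) * (2 + 2 * M) := by gcongr; linarith
        _ = _ := by ring
    · refine (abs_add_le _ _).trans ((add_le_add ((abs_add_le _ _).trans (add_le_add p4 p3))
        ((abs_add_le _ _).trans (add_le_add p3 p5))).trans ?_)
      calc _ = C * D * (x * y) * (w / s ^ 2) * (2 + 2 * w) := by field_simp; ring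
        _ ≤ C * D * (x * y) * (w / s ^ 2) * (2 + 2 * M) := by gcongr
        _ = _ := by ring

/-- The bound on Θ'' is required only after multiplication by the square of the inner derivative.
This admits outer functions whose second derivative blows up at relative level 0. -/
theorem comp (hF : ScaledBound b s₁ k F F₁ F₂) {Θ : ℝ → ℝ}
    (hΘ : ∀ s ∈ Ioo 0 s₁, ∀ t ∈ Ioo (0 : ℝ) 1, AnalyticAt ℝ Θ (F s t)) (hk : k = 0)
    (hbd : ∃ C, 0 ≤ C ∧ ∀ s ∈ Ioo 0 s₁, ∀ t ∈ Ioo (0 : ℝ) 1, |Θ (F s t)| ≤ C ∧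
      |deriv Θ (F s t)| ≤ C ∧ |deriv (deriv Θ) (F s t)| * F₁ s t ^ 2 ≤ C * (relLevel b s t / s ^ 2)) :
    ScaledBound b s₁ 0 (fun s t => Θ (F s t)) (fun s t => deriv Θ (F s t) * F₁ s t)
      (fun s t => deriv (deriv Θ) (F s t) * F₁ s t * F₁ s t + deriv Θ (F s t) * F₂ s t) := by
  subst hk
  have c0 : ContinuousOn (fun p : ℝ × ℝ => Θ (F p.1 p.2)) (Ioo 0 s₁ ×ˢ Ioo 0 1) := fun p hp =>
    (hΘ p.1 hp.1 p.2 hp.2).continuousAt.comp_continuousWithinAt (f := fun p : ℝ × ℝ => F p.1 p.2)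
      (hF.cont p hp)
  have c1 : ContinuousOn (fun p : ℝ × ℝ => deriv Θ (F p.1 p.2)) (Ioo 0 s₁ ×ˢ Ioo 0 1) := fun p hp =>
    (hΘ p.1 hp.1 p.2 hp.2).deriv.continuousAt.comp_continuousWithinAt
      (f := fun p : ℝ × ℝ => F p.1 p.2) (hF.cont p hp)
  have c2 : ContinuousOn (fun p : ℝ × ℝ => deriv (deriv Θ) (F p.1 p.2)) (Ioo 0 s₁ ×ˢ Ioo 0 1) :=
    fun p hp => (hΘ p.1 hp.1 p.2 hp.2).deriv.deriv.continuousAt.comp_continuousWithinAt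
      (f := fun p : ℝ × ℝ => F p.1 p.2) (hF.cont p hp)
  refine ⟨c0, c1.mul hF.cont₁, ((c2.mul hF.cont₁).mul hF.cont₁).add (c1.mul hF.cont₂), ?_, ?_, ?_⟩
  · intro s hs t ht
    exact (hΘ s hs t ht).differentiableAt.hasDerivAt.comp s (hF.deriv₁ s hs t ht)
  · intro s hs t ht
    exact ((hΘ s hs t ht).deriv.differentiableAt.hasDerivAt.comp s (hF.deriv₁ s hs t ht)).mul
      (hF.deriv₂ s hs t ht)
  · obtain ⟨C, hC0, hC⟩ := hF.bound
    obtain ⟨D, hD0, hD⟩ := hbd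
    refine ⟨D + D * C + (D + D * C), by positivity, fun s hs t ht => ?_⟩
    obtain ⟨f0, f1, f2⟩ := hC s hs t ht
    obtain ⟨g0, g1, g2⟩ := hD s hs t ht
    simp only [Real.rpow_zero, mul_one] at f0 f1 f2 ⊢
    have hs0 := hs.1
    have hη := lerp_pos hs.1 ht
    have w0 : 0 < relLevel b s t := by unfold relLevel; positivity
    set w := relLevel b s t
    have hDC : 0 ≤ D * C := by positivity
    refine ⟨g0.trans (by linarith), ?_, ?_⟩
    · rw [abs_mul]
      calc _ ≤ D * (C * (w / s)) := by gcongr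
        _ = D * C * (w / s) := by ring
        _ ≤ _ := by gcongr; linarith
    · refine (abs_add_le _ _).trans ?_
      have e1 : |deriv (deriv Θ) (F s t) * F₁ s t * F₁ s t| ≤ D * (w / s ^ 2) := by
        rw [mul_assoc, abs_mul, ← sq, abs_of_nonneg (sq_nonneg (F₁ s t))]
        exact g2
      have e2 : |deriv Θ (F s t) * F₂ s t| ≤ D * (C * (w / s ^ 2)) := by
        rw [abs_mul]; gcongr
      calc _ ≤ D * (w / s ^ 2) + D * (C * (w / s ^ 2)) := add_le_add e1 e2
        _ = (D + D * C) * (w / s ^ 2) := by ring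
        _ ≤ _ := by gcongr <;> linarith

/-- With Θ'' bounded, the square of the inner derivative is O(w²/s²), w being the relative level,
and one spare factor w is at most s₁^b. -/
theorem comp_of_bounded (hb : 0 < b) (h1 : 1 < s₁) (hF : ScaledBound b s₁ k F F₁ F₂) {Θ : ℝ → ℝ}
    (hΘ : ∀ s ∈ Ioo 0 s₁, ∀ t ∈ Ioo (0 : ℝ) 1, AnalyticAt ℝ Θ (F s t)) (hk : k = 0)
    (hbd : ∃ C, 0 ≤ C ∧ ∀ s ∈ Ioo 0 s₁, ∀ t ∈ Ioo (0 : ℝ) 1, |Θ (F s t)| ≤ C ∧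
      |deriv Θ (F s t)| ≤ C ∧ |deriv (deriv Θ) (F s t)| ≤ C) :
    ScaledBound b s₁ 0 (fun s t => Θ (F s t)) (fun s t => deriv Θ (F s t) * F₁ s t)
      (fun s t => deriv (deriv Θ) (F s t) * F₁ s t * F₁ s t + deriv Θ (F s t) * F₂ s t) := by
  refine hF.comp hΘ hk ?_
  subst hk
  obtain ⟨C, hC0, hC⟩ := hbd
  obtain ⟨D, hD0, hD⟩ := hF.bound
  refine ⟨max C (C * D ^ 2 * s₁ ^ b), le_max_of_le_left hC0, fun s hs t ht => ?_⟩
  obtain ⟨g0, g1, g2⟩ := hC s hs t ht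
  obtain ⟨-, f1, -⟩ := hD s hs t ht
  refine ⟨g0.trans (le_max_left _ _), g1.trans (le_max_left _ _), ?_⟩
  obtain ⟨w0, w1⟩ := relLevel_mem hb hs h1 ht
  have hs0 := hs.1
  simp only [Real.rpow_zero, mul_one] at f1
  have f2 : F₁ s t ^ 2 ≤ (D * (relLevel b s t / s)) ^ 2 := by
    rw [← sq_abs]; gcongr
  calc _ ≤ C * (D * (relLevel b s t / s)) ^ 2 := by gcongr
    _ = C * D ^ 2 * relLevel b s t * (relLevel b s t / s ^ 2) := by field_simp
    _ ≤ C * D ^ 2 * s₁ ^ b * (relLevel b s t / s ^ 2) := by gcongr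
    _ ≤ _ := by gcongr; exact le_max_right _ _

/-- Convex combination with the constant `1`. -/
theorem lerp_one (hF : ScaledBound b s₁ 0 F F₁ F₂) :
    ScaledBound b s₁ 0 (fun s t => t + (1 - t) * F s t) (fun s t => (1 - t) * F₁ s t)
      (fun s t => (1 - t) * F₂ s t) := by
  have ct : ContinuousOn (fun p : ℝ × ℝ => 1 - p.2) (Ioo 0 s₁ ×ˢ Ioo 0 1) := by fun_prop
  refine ⟨continuous_snd.continuousOn.add (ct.mul hF.cont), ct.mul hF.cont₁, ct.mul hF.cont₂,
    fun s hs t ht => ((hF.deriv₁ s hs t ht).const_mul _).const_add _,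
    fun s hs t ht => (hF.deriv₂ s hs t ht).const_mul _, ?_⟩
  obtain ⟨C, hC0, hC⟩ := hF.bound
  refine ⟨1 + C, by positivity, fun s hs t ht => ?_⟩
  obtain ⟨f0, f1, f2⟩ := hC s hs t ht
  simp only [Real.rpow_zero, mul_one] at f0 f1 f2 ⊢
  have hs0 := hs.1
  have hη := lerp_pos hs.1 ht
  have w0 : 0 < relLevel b s t := by unfold relLevel; positivity
  have key : ∀ {x y : ℝ}, |x| ≤ C * y → 0 ≤ y → |(1 - t) * x| ≤ C * y := by
    intro x y hx hy
    rw [abs_mul, abs_of_nonneg (by linarith [ht.2])]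
    have : 0 ≤ |x| := abs_nonneg x
    nlinarith [ht.1, ht.2]
  refine ⟨(abs_add_le _ _).trans ?_, (key f1 (by positivity)).trans ?_,
    (key f2 (by positivity)).trans ?_⟩
  · have := key (x := F s t) (y := 1) (by simpa using f0) zero_le_one
    rw [abs_of_pos ht.1]
    linarith [ht.2]
  · gcongr; linarith
  · gcongr; linarith

end ScaledBound

theorem continuousOn_lerp {s₁ : ℝ} :
    ContinuousOn (fun p : ℝ × ℝ => lerp p.1 p.2) (Ioo 0 s₁ ×ˢ Ioo 0 1) := by
  unfold lerp; fun_prop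

theorem continuousOn_lerp_rpow {s₁ k : ℝ} :
    ContinuousOn (fun p : ℝ × ℝ => lerp p.1 p.2 ^ k) (Ioo 0 s₁ ×ˢ Ioo 0 1) :=
  continuousOn_lerp.rpow_const fun _ hp => Or.inl (lerp_pos hp.1.1 hp.2).ne'

theorem continuousOn_relLevel {b s₁ : ℝ} :
    ContinuousOn (fun p : ℝ × ℝ => relLevel b p.1 p.2) (Ioo 0 s₁ ×ˢ Ioo 0 1) := by
  unfold relLevel
  refine ContinuousOn.rpow_const (continuous_fst.continuousOn.div continuousOn_lerp
    fun p hp => (lerp_pos hp.1.1 hp.2).ne') fun p hp => Or.inl ?_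
  exact (div_pos hp.1.1 (lerp_pos hp.1.1 hp.2)).ne'

theorem hasDerivAt_lerp (s t : ℝ) : HasDerivAt (fun s => lerp s t) t s := by
  unfold lerp
  have := (((hasDerivAt_id s).const_sub 1).mul_const t).const_sub 1
  simpa using this

/-- The proportion `s t / lerp s t` is controlled by the relative level. -/
theorem mul_div_lerp_le {b s₁ s t : ℝ} (hb1 : b < 1) (hs : s ∈ Ioo 0 s₁) (h1 : 1 < s₁)
    (ht : t ∈ Ioo (0 : ℝ) 1) : s * t / lerp s t ≤ s₁ ^ (1 - b) * relLevel b s t := by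
  have hη := lerp_pos hs.1 ht
  have hs0 := hs.1
  have h2 : 0 < s / lerp s t := by positivity
  have h3 : s / lerp s t = (s / lerp s t) ^ (1 - b) * relLevel b s t := by
    unfold relLevel
    rw [← Real.rpow_add h2]
    simp
  calc s * t / lerp s t ≤ s * 1 / lerp s t := by gcongr; exact ht.2.le
    _ = s / lerp s t := by rw [mul_one]
    _ = (s / lerp s t) ^ (1 - b) * relLevel b s t := h3
    _ ≤ s₁ ^ (1 - b) * relLevel b s t := by
      gcongr
      · unfold relLevel; positivity
      · exact (div_lerp_lt hs h1 ht).le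

/-- Each s-derivative of the power multiplies it by a constant times p/s with p = st/η, where η is
the interpolation. Since p ≤ 1 and p is controlled by the relative level (`mul_div_lerp_le`), both
derivatives have the required gain. -/
theorem scaledBound_lerp_rpow {b s₁ k : ℝ} (hb : 0 < b) (hb1 : b < 1) (h1 : 1 < s₁) :
    ScaledBound b s₁ k (fun s t => lerp s t ^ k) (fun s t => t * k * lerp s t ^ (k - 1))
      (fun s t => t * k * (t * (k - 1) * lerp s t ^ (k - 1 - 1))) where
  cont := continuousOn_lerp_rpow
  cont₁ := (continuous_snd.continuousOn.mul continuousOn_const).mul continuousOn_lerp_rpow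
  cont₂ := (continuous_snd.continuousOn.mul continuousOn_const).mul
    ((continuous_snd.continuousOn.mul continuousOn_const).mul continuousOn_lerp_rpow)
  deriv₁ s hs t ht := (hasDerivAt_lerp s t).rpow_const (Or.inl (lerp_pos hs.1 ht).ne')
  deriv₂ s hs t ht :=
    ((hasDerivAt_lerp s t).rpow_const (Or.inl (lerp_pos hs.1 ht).ne')).const_mul _
  bound := by
    refine ⟨1 + |k| * s₁ ^ (1 - b) + |k| * |k - 1| * s₁ ^ (1 - b), by positivity,
      fun s hs t ht => ?_⟩
    have hη := lerp_pos hs.1 ht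
    have hs0 := hs.1
    have ht0 := ht.1
    have hw := mul_div_lerp_le hb1 hs h1 ht
    have w0 : 0 < relLevel b s t := by unfold relLevel; positivity
    have hs10 : (0 : ℝ) < s₁ ^ (1 - b) := by positivity
    have hp1 : s * t / lerp s t ≤ 1 := by
      rw [div_le_one hη]; exact mul_le_lerp ht
    have hp0 : 0 ≤ s * t / lerp s t := by positivity
    set p := s * t / lerp s t with hp
    have e1 : t * k * lerp s t ^ (k - 1) = k * lerp s t ^ k * (p / s) := by
      rw [Real.rpow_sub_one hη.ne', hp]; field_simp
    have e2 : t * k * (t * (k - 1) * lerp s t ^ (k - 1 - 1)) =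
        k * (k - 1) * lerp s t ^ k * (p * p / s ^ 2) := by
      rw [Real.rpow_sub_one hη.ne', Real.rpow_sub_one hη.ne', hp]; field_simp
    rw [e1, e2]
    have hx : 0 < lerp s t ^ k := by positivity
    set x := lerp s t ^ k
    set w := relLevel b s t
    refine ⟨?_, ?_, ?_⟩
    · rw [abs_of_pos hx]
      have : 0 ≤ |k| * s₁ ^ (1 - b) + |k| * |k - 1| * s₁ ^ (1 - b) := by positivity
      nlinarith
    · rw [abs_mul, abs_mul, abs_of_pos hx, abs_of_nonneg (by positivity : 0 ≤ p / s)]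
      calc |k| * x * (p / s) ≤ |k| * x * (s₁ ^ (1 - b) * w / s) := by gcongr
        _ = (|k| * s₁ ^ (1 - b)) * x * (w / s) := by ring
        _ ≤ _ := by
          gcongr
          have : 0 ≤ |k| * |k - 1| * s₁ ^ (1 - b) := by positivity
          linarith
    · rw [abs_mul, abs_mul, abs_mul, abs_of_pos hx, abs_of_nonneg (by positivity : 0 ≤ p * p / s ^ 2)]
      calc |k| * |k - 1| * x * (p * p / s ^ 2)
          ≤ |k| * |k - 1| * x * (1 * (s₁ ^ (1 - b) * w) / s ^ 2) := by gcongr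
        _ = (|k| * |k - 1| * s₁ ^ (1 - b)) * x * (w / s ^ 2) := by ring
        _ ≤ _ := by
          gcongr
          have : 0 ≤ |k| * s₁ ^ (1 - b) := by positivity
          linarith

/-- The logarithmic derivative in `s` is b(1-t)/(sη), where η is the interpolation, and (1-t)/η ≤ 1.
Hence differentiation costs only 1/s and keeps the factor w itself. -/
theorem scaledBound_relLevel {b s₁ : ℝ} (hb : 0 < b) (hb1 : b < 1) (h1 : 1 < s₁) :
    ScaledBound b s₁ 0 (relLevel b)
      (fun s t => relLevel b s t * (b * (1 - t) / (s * lerp s t)))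
      (fun s t => relLevel b s t * (b * (1 - t) / (s * lerp s t)) * (b * (1 - t) / (s * lerp s t)) +
        relLevel b s t * (-(b * (1 - t) * (lerp s t + s * t)) / (s * lerp s t) ^ 2)) := by
  have hne : ∀ p ∈ Ioo 0 s₁ ×ˢ Ioo (0 : ℝ) 1, p.1 * lerp p.1 p.2 ≠ 0 := fun p hp =>
    (mul_pos hp.1.1 (lerp_pos hp.1.1 hp.2)).ne'
  have cq : ContinuousOn (fun p : ℝ × ℝ => b * (1 - p.2) / (p.1 * lerp p.1 p.2))
      (Ioo 0 s₁ ×ˢ Ioo 0 1) :=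
    ContinuousOn.div (by fun_prop) (continuous_fst.continuousOn.mul continuousOn_lerp) hne
  have cr : ContinuousOn (fun p : ℝ × ℝ => -(b * (1 - p.2) * (lerp p.1 p.2 + p.1 * p.2)) /
      (p.1 * lerp p.1 p.2) ^ 2) (Ioo 0 s₁ ×ˢ Ioo 0 1) := by
    refine ContinuousOn.div (ContinuousOn.neg (ContinuousOn.mul (by fun_prop)
      (continuousOn_lerp.add (by fun_prop))))
      ((continuous_fst.continuousOn.mul continuousOn_lerp).pow 2) fun p hp => pow_ne_zero 2 (hne p hp)
  have d1 : ∀ s ∈ Ioo 0 s₁, ∀ t ∈ Ioo (0 : ℝ) 1, HasDerivAt (fun s => relLevel b s t)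
      (relLevel b s t * (b * (1 - t) / (s * lerp s t))) s := by
    intro s hs t ht
    have hη := lerp_pos hs.1 ht
    have hs0 := hs.1
    have h2 : 0 < s / lerp s t := by positivity
    have := ((hasDerivAt_id s).div (hasDerivAt_lerp s t) hη.ne').rpow_const (p := b)
      (Or.inl h2.ne')
    unfold relLevel
    convert! this using 1
    simp only [Pi.div_apply, id]
    rw [Real.rpow_sub_one h2.ne']
    field_simp
    unfold lerp
    ring
  refine ⟨continuousOn_relLevel, continuousOn_relLevel.mul cq,
    ((continuousOn_relLevel.mul cq).mul cq).add (continuousOn_relLevel.mul cr), d1, ?_, ?_⟩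
  · intro s hs t ht
    have hη := lerp_pos hs.1 ht
    have hs0 := hs.1
    refine (d1 s hs t ht).mul ?_
    have := ((hasDerivAt_id s).mul (hasDerivAt_lerp s t)).inv (mul_pos hs0 hη).ne' |>.const_mul
      (b * (1 - t))
    convert! this using 1
    simp only [Pi.mul_apply, id]
    field_simp
  · refine ⟨s₁ ^ b + 3, by positivity, fun s hs t ht => ?_⟩
    have hη := lerp_pos hs.1 ht
    have hs0 := hs.1
    have ht1 : 0 < 1 - t := by linarith [ht.2]
    obtain ⟨w0, w1⟩ := relLevel_mem hb hs h1 ht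
    have hM : (0 : ℝ) < s₁ ^ b := by positivity
    simp only [Real.rpow_zero, mul_one]
    set w := relLevel b s t
    set M := s₁ ^ b
    have hq1 : (1 - t) / lerp s t ≤ 1 := by
      rw [div_le_one hη]; exact one_sub_le_lerp hs0 ht
    have hq0 : 0 ≤ (1 - t) / lerp s t := by positivity
    have hr1 : s * t / lerp s t ≤ 1 := by
      rw [div_le_one hη]; exact mul_le_lerp ht
    have hr0 : 0 ≤ s * t / lerp s t := div_nonneg (mul_nonneg hs0.le ht.1.le) hη.le
    have e1 : b * (1 - t) / (s * lerp s t) = b * ((1 - t) / lerp s t) / s := by field_simp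
    have e2 : b * (1 - t) * (lerp s t + s * t) / (s * lerp s t) ^ 2 =
        b * ((1 - t) / lerp s t) * (1 + s * t / lerp s t) / s ^ 2 := by field_simp
    have e3 : -(b * (1 - t) * (lerp s t + s * t)) / (s * lerp s t) ^ 2 =
        -(b * ((1 - t) / lerp s t) * (1 + s * t / lerp s t) / s ^ 2) := by rw [← e2]; ring
    rw [e1, e3]
    set q := (1 - t) / lerp s t
    set r := s * t / lerp s t
    have hbq : b * q ≤ 1 := by nlinarith
    have hbq0 : 0 ≤ b * q := by positivity
    refine ⟨?_, ?_, ?_⟩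
    · rw [abs_of_pos w0]; linarith
    · rw [abs_of_nonneg (by positivity)]
      calc w * (b * q / s) ≤ w * (1 / s) := by gcongr
        _ = 1 * (w / s) := by ring
        _ ≤ _ := by gcongr; linarith
    · refine (abs_add_le _ _).trans ?_
      have i1 : |w * (b * q / s) * (b * q / s)| ≤ 1 * (w / s ^ 2) := by
        rw [abs_of_nonneg (by positivity)]
        calc _ = (b * q) * (b * q) * (w / s ^ 2) := by field_simp
          _ ≤ 1 * (w / s ^ 2) := by gcongr; nlinarith
      have i2 : |w * -(b * q * (1 + r) / s ^ 2)| ≤ 2 * (w / s ^ 2) := by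
        rw [mul_neg, abs_neg, abs_of_nonneg (by positivity)]
        calc _ = (b * q) * (1 + r) * (w / s ^ 2) := by field_simp
          _ ≤ 2 * (w / s ^ 2) := by gcongr; nlinarith
      calc _ ≤ 1 * (w / s ^ 2) + 2 * (w / s ^ 2) := add_le_add i1 i2
        _ = 3 * (w / s ^ 2) := by ring
        _ ≤ _ := by gcongr; linarith

/-- The allowed singularity C/w of Θ'' is compensated by the square of the inner derivative, which
is at most (w/s)²: the product is C w/s², exactly the permitted size. -/
theorem IsProfile.scaledBound {Θ : ℝ → ℝ} {b s₁ : ℝ} (hΘ : IsProfile (s₁ ^ b) Θ) (hb : 0 < b)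
    (hb1 : b < 1) (h1 : 1 < s₁) :
    ∃ F₁ F₂, ScaledBound b s₁ 0 (fun s t => Θ (relLevel b s t)) F₁ F₂ := by
  refine ⟨_, _, (scaledBound_relLevel hb hb1 h1).comp
    (fun s hs t ht => hΘ.analyticAt _ (relLevel_mem hb hs h1 ht)) rfl ?_⟩
  obtain ⟨C, hC⟩ := hΘ.bound
  have hC0 : 0 ≤ C := (abs_nonneg _).trans (hC _ (relLevel_mem (s := 1) (t := 1 / 2) hb
    ⟨one_pos, h1⟩ h1 (by norm_num))).1
  refine ⟨C, hC0, fun s hs t ht => ?_⟩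
  have hw := relLevel_mem hb hs h1 ht
  obtain ⟨c0, c1, c2⟩ := hC _ hw
  refine ⟨c0, c1, ?_⟩
  have hη := lerp_pos hs.1 ht
  have hs0 := hs.1
  have ht1 : 0 < 1 - t := by linarith [ht.2]
  have w0 := hw.1
  have hq1 : (1 - t) / lerp s t ≤ 1 := by
    rw [div_le_one hη]; exact one_sub_le_lerp hs0 ht
  have hbq : b * ((1 - t) / lerp s t) ≤ 1 := by
    have : 0 ≤ (1 - t) / lerp s t := by positivity
    nlinarith
  have e1 : b * (1 - t) / (s * lerp s t) = b * ((1 - t) / lerp s t) / s := by field_simp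
  rw [e1]
  calc _ ≤ C / relLevel b s t * (relLevel b s t * (1 / s)) ^ 2 := by gcongr
    _ = C * (relLevel b s t / s ^ 2) := by field_simp

/-! ### Parameter integrals with the weight t^(-1/2). -/

theorem integrableOn_rpow_Ioo {c : ℝ} (hc : -1 < c) :
    IntegrableOn (fun t : ℝ => t ^ c) (Ioo 0 1) := by
  have := (intervalIntegral.intervalIntegrable_rpow' (a := 0) (b := 1) hc)
  rw [intervalIntegrable_iff_integrableOn_Ioo_of_le zero_le_one] at this
  exact this

theorem integrableOn_one_sub_rpow_Ioo {c : ℝ} (hc : -1 < c) :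
    IntegrableOn (fun t : ℝ => (1 - t) ^ c) (Ioo 0 1) := by
  have := (intervalIntegral.intervalIntegrable_rpow' (a := 1) (b := 0) hc).comp_sub_left 1
  simp only [sub_self, sub_zero] at this
  rw [intervalIntegrable_iff_integrableOn_Ioo_of_le zero_le_one] at this
  exact this

section

variable {s₁ : ℝ} {A A' : ℝ → ℝ → ℝ}

theorem aestronglyMeasurable_weighted
    (hA : ContinuousOn (fun p : ℝ × ℝ => A p.1 p.2) (Ioo 0 s₁ ×ˢ Ioo 0 1)) {s : ℝ}
    (hs : s ∈ Ioo 0 s₁) :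
    AEStronglyMeasurable (fun t : ℝ => t ^ (-1 / 2 : ℝ) * A s t) (volume.restrict (Ioo 0 1)) := by
  have h1 : ContinuousOn (fun t : ℝ => A s t) (Ioo 0 1) :=
    hA.comp (f := fun t : ℝ => (s, t)) (by fun_prop) fun t ht => ⟨hs, ht⟩
  have h2 : ContinuousOn (fun t : ℝ => t ^ (-1 / 2 : ℝ)) (Ioo 0 1) :=
    continuousOn_id.rpow_const fun t ht => Or.inl ht.1.ne'
  exact (h2.mul h1).aestronglyMeasurable measurableSet_Ioo

/-- Bounded on a neighbourhood of each parameter, uniformly in the variable. -/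
def LocallyUniformlyBounded (s₁ : ℝ) (A : ℝ → ℝ → ℝ) : Prop :=
  ∀ s₀ ∈ Ioo 0 s₁, ∃ C, ∀ᶠ s in 𝓝 s₀, ∀ t ∈ Ioo (0 : ℝ) 1, |A s t| ≤ C

theorem integrableOn_weighted
    (hA : ContinuousOn (fun p : ℝ × ℝ => A p.1 p.2) (Ioo 0 s₁ ×ˢ Ioo 0 1))
    (hb : LocallyUniformlyBounded s₁ A) {s : ℝ} (hs : s ∈ Ioo 0 s₁) :
    IntegrableOn (fun t : ℝ => t ^ (-1 / 2 : ℝ) * A s t) (Ioo 0 1) := by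
  obtain ⟨C, hC⟩ := hb s hs
  refine Integrable.mono' ((integrableOn_rpow_Ioo (c := -1 / 2) (by norm_num)).mul_const C)
    (aestronglyMeasurable_weighted hA hs) ?_
  filter_upwards [ae_restrict_mem measurableSet_Ioo] with t ht
  rw [norm_mul, Real.norm_eq_abs, Real.norm_eq_abs, abs_of_pos (Real.rpow_pos_of_pos ht.1 _)]
  have := Real.rpow_pos_of_pos ht.1 (-1 / 2)
  gcongr
  exact hC.self_of_nhds t ht

theorem hasDerivAt_weighted_integral
    (hA : ContinuousOn (fun p : ℝ × ℝ => A p.1 p.2) (Ioo 0 s₁ ×ˢ Ioo 0 1))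
    (hA' : ContinuousOn (fun p : ℝ × ℝ => A' p.1 p.2) (Ioo 0 s₁ ×ˢ Ioo 0 1))
    (hb : LocallyUniformlyBounded s₁ A) (hb' : LocallyUniformlyBounded s₁ A')
    (hd : ∀ s ∈ Ioo 0 s₁, ∀ t ∈ Ioo (0 : ℝ) 1, HasDerivAt (fun s => A s t) (A' s t) s) {s : ℝ}
    (hs : s ∈ Ioo 0 s₁) :
    HasDerivAt (fun s => ∫ t in Ioo 0 1, t ^ (-1 / 2 : ℝ) * A s t)
      (∫ t in Ioo 0 1, t ^ (-1 / 2 : ℝ) * A' s t) s := by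
  obtain ⟨C, hC⟩ := hb' s hs
  have hU : {x | (∀ t ∈ Ioo (0 : ℝ) 1, |A' x t| ≤ C) ∧ x ∈ Ioo 0 s₁} ∈ 𝓝 s :=
    hC.and (Ioo_mem_nhds hs.1 hs.2)
  refine (hasDerivAt_integral_of_dominated_loc_of_deriv_le
    (F := fun s t => t ^ (-1 / 2 : ℝ) * A s t) (F' := fun s t => t ^ (-1 / 2 : ℝ) * A' s t)
    (bound := fun t : ℝ => t ^ (-1 / 2 : ℝ) * C) hU ?_
    (integrableOn_weighted hA hb hs) (aestronglyMeasurable_weighted hA' hs) ?_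
    ((integrableOn_rpow_Ioo (by norm_num)).mul_const C) ?_).2
  · filter_upwards [Ioo_mem_nhds hs.1 hs.2] with x hx using aestronglyMeasurable_weighted hA hx
  · filter_upwards [ae_restrict_mem measurableSet_Ioo] with t ht x hx
    rw [norm_mul, Real.norm_eq_abs, Real.norm_eq_abs, abs_of_pos (Real.rpow_pos_of_pos ht.1 _)]
    have := Real.rpow_pos_of_pos ht.1 (-1 / 2)
    gcongr
    exact hx.1 t ht
  · filter_upwards [ae_restrict_mem measurableSet_Ioo] with t ht x hx
    exact (hd x hx.2 t ht).const_mul _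

theorem continuousOn_weighted_integral
    (hA : ContinuousOn (fun p : ℝ × ℝ => A p.1 p.2) (Ioo 0 s₁ ×ˢ Ioo 0 1))
    (hb : LocallyUniformlyBounded s₁ A) :
    ContinuousOn (fun s => ∫ t in Ioo 0 1, t ^ (-1 / 2 : ℝ) * A s t) (Ioo 0 s₁) := by
  intro s hs
  refine ContinuousAt.continuousWithinAt ?_
  obtain ⟨C, hC⟩ := hb s hs
  refine continuousAt_of_dominated (bound := fun t : ℝ => t ^ (-1 / 2 : ℝ) * C) ?_ ?_
    ((integrableOn_rpow_Ioo (by norm_num)).mul_const C) ?_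
  · filter_upwards [Ioo_mem_nhds hs.1 hs.2] with x hx using aestronglyMeasurable_weighted hA hx
  · filter_upwards [hC] with x hx
    filter_upwards [ae_restrict_mem measurableSet_Ioo] with t ht
    rw [norm_mul, Real.norm_eq_abs, Real.norm_eq_abs, abs_of_pos (Real.rpow_pos_of_pos ht.1 _)]
    have := Real.rpow_pos_of_pos ht.1 (-1 / 2)
    gcongr
    exact hx t ht
  · filter_upwards [ae_restrict_mem measurableSet_Ioo] with t ht
    have h1 : ContinuousAt (fun p : ℝ × ℝ => A p.1 p.2) (s, t) :=
      hA.continuousAt ((isOpen_Ioo.prod isOpen_Ioo).mem_nhds ⟨hs, ht⟩)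
    exact continuousAt_const.mul (h1.comp (f := fun x : ℝ => (x, t)) (by fun_prop))

end

/-- The two singularities sit at opposite ends: on each half of the interval one of the factors is
at most 2. -/
theorem rpow_neg_half_mul_one_sub_rpow_le {b t : ℝ} (hb : 0 < b) (hb1 : b < 1)
    (ht : t ∈ Ioo (0 : ℝ) 1) :
    t ^ (-1 / 2 : ℝ) * (1 - t) ^ (-b) ≤ 2 * (t ^ (-1 / 2 : ℝ) + (1 - t) ^ (-b)) := by
  have ht0 := ht.1
  have ht1 : 0 < 1 - t := by linarith [ht.2]
  have p1 : 0 < t ^ (-1 / 2 : ℝ) := by positivity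
  have p2 : 0 < (1 - t) ^ (-b) := by positivity
  rcases le_total t (1 / 2) with h | h
  · have : (1 - t) ^ (-b) ≤ 2 := by
      calc (1 - t) ^ (-b) ≤ (1 / 2 : ℝ) ^ (-b) :=
            Real.rpow_le_rpow_of_nonpos (by norm_num) (by linarith) (by linarith)
        _ = 2 ^ b := by rw [Real.rpow_neg (by norm_num), ← Real.inv_rpow (by norm_num)]; norm_num
        _ ≤ 2 ^ (1 : ℝ) := Real.rpow_le_rpow_of_exponent_le (by norm_num) hb1.le
        _ = 2 := by norm_num
    nlinarith
  · have : t ^ (-1 / 2 : ℝ) ≤ 2 := by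
      calc t ^ (-1 / 2 : ℝ) ≤ (1 / 2 : ℝ) ^ (-1 / 2 : ℝ) :=
            Real.rpow_le_rpow_of_nonpos (by norm_num) h (by norm_num)
        _ = 2 ^ (1 / 2 : ℝ) := by
          rw [neg_div, Real.rpow_neg (by norm_num), ← Real.inv_rpow (by norm_num)]; norm_num
        _ ≤ 2 ^ (1 : ℝ) := Real.rpow_le_rpow_of_exponent_le (by norm_num) (by norm_num)
        _ = 2 := by norm_num
    nlinarith

/-- For t ≥ 1/2 the interpolation 1 - t + st is at least (1 + s - t)/2, whose powers integrate
explicitly; for t ≤ 1/2 it is at least 1/2, so only t^(-1/2) matters. -/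
theorem rpow_neg_half_mul_lerp_rpow_le {b s t : ℝ} (hb : 0 < b) (hb1 : b < 1) (hs : 0 < s)
    (ht : t ∈ Ioo (0 : ℝ) 1) :
    t ^ (-1 / 2 : ℝ) * lerp s t ^ (-(2 * b)) ≤
      8 * (t ^ (-1 / 2 : ℝ) + (1 + s - t) ^ (-(2 * b))) := by
  have ht0 := ht.1
  have ht1 : 0 < 1 - t := by linarith [ht.2]
  have hη := lerp_pos hs ht
  have hs2 : 0 < 1 + s - t := by linarith
  have p1 : 0 < t ^ (-1 / 2 : ℝ) := by positivity
  have p2 : 0 < lerp s t ^ (-(2 * b)) := by positivity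
  have p3 : 0 < (1 + s - t) ^ (-(2 * b)) := by positivity
  have two : (1 / 2 : ℝ) ^ (-(2 * b)) ≤ 4 := by
    calc (1 / 2 : ℝ) ^ (-(2 * b)) = 2 ^ (2 * b) := by
          rw [Real.rpow_neg (by norm_num), ← Real.inv_rpow (by norm_num)]; norm_num
      _ ≤ 2 ^ (2 : ℝ) := Real.rpow_le_rpow_of_exponent_le (by norm_num) (by linarith)
      _ = 4 := by norm_num
  rcases le_total t (1 / 2) with h | h
  · have : lerp s t ^ (-(2 * b)) ≤ 4 :=
      (Real.rpow_le_rpow_of_nonpos (by norm_num)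
        (by linarith [one_sub_le_lerp hs ht] : (1 / 2 : ℝ) ≤ lerp s t) (by linarith)).trans two
    nlinarith
  · have h1 : t ^ (-1 / 2 : ℝ) ≤ 2 := by
      calc t ^ (-1 / 2 : ℝ) ≤ (1 / 2 : ℝ) ^ (-1 / 2 : ℝ) :=
            Real.rpow_le_rpow_of_nonpos (by norm_num) h (by norm_num)
        _ = 2 ^ (1 / 2 : ℝ) := by
          rw [neg_div, Real.rpow_neg (by norm_num), ← Real.inv_rpow (by norm_num)]; norm_num
        _ ≤ 2 ^ (1 : ℝ) := Real.rpow_le_rpow_of_exponent_le (by norm_num) (by norm_num)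
        _ = 2 := by norm_num
    have h2 : 1 / 2 * (1 + s - t) ≤ lerp s t := by unfold lerp; nlinarith
    have h3 : lerp s t ^ (-(2 * b)) ≤ 4 * (1 + s - t) ^ (-(2 * b)) := by
      calc lerp s t ^ (-(2 * b)) ≤ (1 / 2 * (1 + s - t)) ^ (-(2 * b)) :=
            Real.rpow_le_rpow_of_nonpos (by positivity) h2 (by linarith)
        _ = (1 / 2) ^ (-(2 * b)) * (1 + s - t) ^ (-(2 * b)) :=
            Real.mul_rpow (by norm_num) hs2.le
        _ ≤ _ := by gcongr
    nlinarith

/-- The primitive is explicit. Because 2b > 1, the end t = 1 gives the main term s^(1-2b)/(2b-1) and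
the other end contributes with a favourable sign. -/
theorem setIntegral_shift_rpow_le {b s : ℝ} (hb : 1 / 2 < b) (hs : 0 < s) :
    IntegrableOn (fun t : ℝ => (1 + s - t) ^ (-(2 * b))) (Ioo 0 1) ∧
    ∫ t in Ioo (0 : ℝ) 1, (1 + s - t) ^ (-(2 * b)) ≤ s ^ (1 - 2 * b) / (2 * b - 1) := by
  have hc : ContinuousOn (fun t : ℝ => (1 + s - t) ^ (-(2 * b))) (Icc 0 1) :=
    ContinuousOn.rpow_const (by fun_prop) fun t ht => Or.inl (by linarith [ht.2] : 0 < 1 + s - t).ne'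
  refine ⟨(hc.integrableOn_Icc).mono_set Ioo_subset_Icc_self, ?_⟩
  rw [← integral_Ioc_eq_integral_Ioo, ← intervalIntegral.integral_of_le zero_le_one,
    intervalIntegral.integral_comp_sub_left (fun x : ℝ => x ^ (-(2 * b))) (1 + s), integral_rpow]
  · have h1 : 0 < (1 + s - 0) ^ (-(2 * b) + 1) := by
      apply Real.rpow_pos_of_pos; linarith
    rw [← neg_div_neg_eq, show -(-(2 * b) + 1) = 2 * b - 1 by ring, show 1 + s - 1 = s by ring,
      show 1 - 2 * b = -(2 * b) + 1 by ring]
    have h2 : 0 < 2 * b - 1 := by linarith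
    gcongr
    linarith
  · right
    refine ⟨by linarith, ?_⟩
    rw [uIcc_of_le (by linarith)]
    intro h
    linarith [h.1]

/-- Singularities occur only as `s` tends to 0: for s > s₀/2 the interpolation is at least min(s₀/2,
1). This supplies the domination for differentiating under the integral. -/
theorem ScaledBound.locallyUniformlyBounded {b s₁ : ℝ} {F F₁ F₂ : ℝ → ℝ → ℝ} (hb : 0 < b)
    (h1 : 1 < s₁) (hF : ScaledBound b s₁ (-b) F F₁ F₂) :
    LocallyUniformlyBounded s₁ F ∧ LocallyUniformlyBounded s₁ F₁ ∧
      LocallyUniformlyBounded s₁ F₂ := by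
  obtain ⟨C, hC0, hC⟩ := hF.bound
  have key : ∀ s₀ ∈ Ioo 0 s₁, ∃ D, 0 ≤ D ∧ ∀ᶠ s in 𝓝 s₀, ∀ t ∈ Ioo (0 : ℝ) 1, |F s t| ≤ D ∧
      |F₁ s t| ≤ D ∧ |F₂ s t| ≤ D := by
    intro s₀ hs₀
    have hs0 := hs₀.1
    set e := min (s₀ / 2) 1
    have he : 0 < e := lt_min (by linarith) one_pos
    have heb : 0 < e ^ (-b) := by positivity
    refine ⟨C * e ^ (-b) * (1 + s₁ ^ b / (s₀ / 2) + s₁ ^ b / (s₀ / 2) ^ 2), by positivity, ?_⟩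
    filter_upwards [Ioo_mem_nhds (half_lt_self hs0) hs₀.2] with s hs t ht
    have hs' : s ∈ Ioo 0 s₁ := ⟨by linarith [hs.1], hs.2⟩
    have hsp := hs'.1
    obtain ⟨f0, f1, f2⟩ := hC s hs' t ht
    obtain ⟨w0, w1⟩ := relLevel_mem hb hs' h1 ht
    have hη := lerp_pos hs'.1 ht
    have hle : lerp s t ^ (-b) ≤ e ^ (-b) := by
      refine Real.rpow_le_rpow_of_nonpos he ?_ (by linarith)
      exact (min_le_min_right 1 hs.1.le).trans (min_le_lerp ht)
    have q0 : 0 < s₁ ^ b / (s₀ / 2) := by positivity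
    have q1 : 0 < s₁ ^ b / (s₀ / 2) ^ 2 := by positivity
    have hss : s₀ / 2 ≤ s := hs.1.le
    refine ⟨f0.trans ?_, f1.trans ?_, f2.trans ?_⟩
    · calc C * lerp s t ^ (-b) ≤ C * e ^ (-b) * 1 := by rw [mul_one]; gcongr
        _ ≤ _ := by gcongr; linarith
    · calc _ ≤ C * e ^ (-b) * (s₁ ^ b / (s₀ / 2)) := by gcongr
        _ ≤ _ := by gcongr; linarith
    · calc _ ≤ C * e ^ (-b) * (s₁ ^ b / (s₀ / 2) ^ 2) := by gcongr
        _ ≤ _ := by gcongr; linarith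
  refine ⟨fun s hs => ?_, fun s hs => ?_, fun s hs => ?_⟩ <;> obtain ⟨D, -, hD⟩ := key s hs
  · exact ⟨D, hD.mono fun x hx t ht => (hx t ht).1⟩
  · exact ⟨D, hD.mono fun x hx t ht => (hx t ht).2.1⟩
  · exact ⟨D, hD.mono fun x hx t ht => (hx t ht).2.2⟩

/-- The integrand itself is dominated by t^(-1/2) (1-t)^(-b), integrable as b < 1. For the
derivatives, η^(-b) times the relative level is s^b η^(-2b); integrating gives O(s^(1-2b)), which
needs b > 1/2, and the powers of `s` add up to -b and -b - 1. -/
theorem ScaledBound.integral {b s₁ : ℝ} {F F₁ F₂ : ℝ → ℝ → ℝ} (hb : 1 / 2 < b) (hb1 : b < 1)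
    (h1 : 1 < s₁) (hF : ScaledBound b s₁ (-b) F F₁ F₂) :
    (∀ s ∈ Ioo 0 s₁, IntegrableOn (fun t : ℝ => t ^ (-1 / 2 : ℝ) * F s t) (Ioo 0 1)) ∧
    ∃ I₁ I₂ : ℝ → ℝ, (∀ s ∈ Ioo 0 s₁,
      HasDerivAt (fun s => ∫ t in Ioo 0 1, t ^ (-1 / 2 : ℝ) * F s t) (I₁ s) s) ∧
      (∀ s ∈ Ioo 0 s₁, HasDerivAt I₁ (I₂ s) s) ∧ ContinuousOn I₂ (Ioo 0 s₁) ∧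
      ∃ C, ∀ s ∈ Ioo 0 s₁, |∫ t in Ioo 0 1, t ^ (-1 / 2 : ℝ) * F s t| ≤ C ∧
        |I₁ s| ≤ C * s ^ (-b) ∧ |I₂ s| ≤ C * s ^ (-b - 1) := by
  have hb0 : 0 < b := by linarith
  obtain ⟨u0, u1, u2⟩ := hF.locallyUniformlyBounded hb0 h1
  refine ⟨fun s hs => integrableOn_weighted hF.cont u0 hs,
    fun s => ∫ t in Ioo 0 1, t ^ (-1 / 2 : ℝ) * F₁ s t,
    fun s => ∫ t in Ioo 0 1, t ^ (-1 / 2 : ℝ) * F₂ s t,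
    fun s hs => hasDerivAt_weighted_integral hF.cont hF.cont₁ u0 u1 hF.deriv₁ hs,
    fun s hs => hasDerivAt_weighted_integral hF.cont₁ hF.cont₂ u1 u2 hF.deriv₂ hs,
    continuousOn_weighted_integral hF.cont₂ u2, ?_⟩
  obtain ⟨C, hC0, hC⟩ := hF.bound
  have i1 := integrableOn_rpow_Ioo (c := -1 / 2) (by norm_num)
  have i2 := integrableOn_one_sub_rpow_Ioo (c := -b) (by linarith)
  set K₁ := ∫ t in Ioo (0 : ℝ) 1, 2 * (t ^ (-1 / 2 : ℝ) + (1 - t) ^ (-b)) with hK₁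
  set K₀ := ∫ t in Ioo (0 : ℝ) 1, t ^ (-1 / 2 : ℝ) with hK₀
  have hK₁0 : 0 ≤ K₁ := setIntegral_nonneg measurableSet_Ioo fun t ht => by
    have ht0 := ht.1
    have : 0 < 1 - t := by linarith [ht.2]
    positivity
  have hK₀0 : 0 ≤ K₀ := setIntegral_nonneg measurableSet_Ioo fun t ht => by
    have ht0 := ht.1
    positivity
  -- The constant K₀ is not small relative to s^(1-2b) by itself; it is absorbed through 1 ≤
  -- s₁^(2b-1) s^(1-2b), valid for s < s₁.
  set K₂ := 8 * (K₀ * s₁ ^ (2 * b - 1) + 1 / (2 * b - 1)) with hK₂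
  have h2b : 0 < 2 * b - 1 := by linarith
  have hK₂0 : 0 ≤ K₂ := by positivity
  have hJ : ∀ s ∈ Ioo 0 s₁, IntegrableOn (fun t : ℝ => 8 * (t ^ (-1 / 2 : ℝ) +
      (1 + s - t) ^ (-(2 * b)))) (Ioo 0 1) ∧ ∫ t in Ioo (0 : ℝ) 1, 8 * (t ^ (-1 / 2 : ℝ) +
      (1 + s - t) ^ (-(2 * b))) ≤ K₂ * s ^ (1 - 2 * b) := by
    intro s hs
    obtain ⟨j1, j2⟩ := setIntegral_shift_rpow_le hb hs.1
    refine ⟨(i1.add j1).const_mul 8, ?_⟩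
    rw [integral_const_mul, integral_add i1 j1]
    have hs0 := hs.1
    have e1 : 1 ≤ s₁ ^ (2 * b - 1) * s ^ (1 - 2 * b) := by
      have : s ^ (1 - 2 * b) = (s ^ (2 * b - 1))⁻¹ := by
        rw [← Real.rpow_neg hs0.le]; ring_nf
      rw [this, ← div_eq_mul_inv, one_le_div (by positivity)]
      exact Real.rpow_le_rpow hs0.le hs.2.le h2b.le
    have e2 : K₀ * 1 ≤ K₀ * (s₁ ^ (2 * b - 1) * s ^ (1 - 2 * b)) := by gcongr
    rw [hK₂]
    calc _ ≤ 8 * (K₀ * (s₁ ^ (2 * b - 1) * s ^ (1 - 2 * b)) + s ^ (1 - 2 * b) / (2 * b - 1)) := by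
          gcongr; linarith
      _ = _ := by ring
  refine ⟨max (C * K₁) (C * K₂), fun s hs => ⟨?_, ?_, ?_⟩⟩
  · refine le_max_of_le_left ?_
    rw [← Real.norm_eq_abs]
    refine (norm_integral_le_of_norm_le (g := fun t => C * (2 * (t ^ (-1 / 2 : ℝ) + (1 - t) ^ (-b))))
      (((i1.add i2).const_mul 2).const_mul C) ?_).trans_eq (integral_const_mul _ _)
    filter_upwards [ae_restrict_mem measurableSet_Ioo] with t ht
    have ht0 := ht.1
    have hx : 0 < t ^ (-1 / 2 : ℝ) := by positivity
    rw [norm_mul, Real.norm_eq_abs, Real.norm_eq_abs, abs_of_pos hx]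
    have hle : lerp s t ^ (-b) ≤ (1 - t) ^ (-b) :=
      Real.rpow_le_rpow_of_nonpos (by linarith [ht.2]) (one_sub_le_lerp hs.1 ht) (by linarith)
    calc _ ≤ t ^ (-1 / 2 : ℝ) * (C * (1 - t) ^ (-b)) := by
          gcongr; exact (hC s hs t ht).1.trans (by gcongr)
      _ = C * (t ^ (-1 / 2 : ℝ) * (1 - t) ^ (-b)) := by ring
      _ ≤ _ := mul_le_mul_of_nonneg_left (rpow_neg_half_mul_one_sub_rpow_le hb0 hb1 ht) hC0
  all_goals
    have hs0 := hs.1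
    have hrel : ∀ t ∈ Ioo (0 : ℝ) 1, lerp s t ^ (-b) * relLevel b s t =
        s ^ b * lerp s t ^ (-(2 * b)) := by
      intro t ht
      have hη := lerp_pos hs0 ht
      unfold relLevel
      rw [Real.div_rpow hs0.le hη.le, Real.rpow_neg hη.le, Real.rpow_neg hη.le, two_mul,
        Real.rpow_add hη]
      field_simp
    obtain ⟨j1, j2⟩ := hJ s hs
  · have e0 : C * K₂ * s ^ (-b) = C * s ^ (b - 1) * (K₂ * s ^ (1 - 2 * b)) := by
      have : s ^ (-b) = s ^ (b - 1) * s ^ (1 - 2 * b) := by rw [← Real.rpow_add hs0]; ring_nf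
      rw [this]; ring
    calc |∫ t in Ioo 0 1, t ^ (-1 / 2 : ℝ) * F₁ s t| ≤ C * s ^ (b - 1) *
          ∫ t in Ioo (0 : ℝ) 1, 8 * (t ^ (-1 / 2 : ℝ) + (1 + s - t) ^ (-(2 * b))) := by
          rw [← Real.norm_eq_abs, ← integral_const_mul]
          refine norm_integral_le_of_norm_le (j1.const_mul _) ?_
          filter_upwards [ae_restrict_mem measurableSet_Ioo] with t ht
          have ht0 := ht.1
          have hx : 0 < t ^ (-1 / 2 : ℝ) := by positivity
          rw [norm_mul, Real.norm_eq_abs, Real.norm_eq_abs, abs_of_pos hx]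
          calc _ ≤ t ^ (-1 / 2 : ℝ) * (C * lerp s t ^ (-b) * (relLevel b s t / s)) := by
                gcongr; exact (hC s hs t ht).2.1
            _ = t ^ (-1 / 2 : ℝ) * (C * (lerp s t ^ (-b) * relLevel b s t) / s) := by ring
            _ = C * s ^ (b - 1) * (t ^ (-1 / 2 : ℝ) * lerp s t ^ (-(2 * b))) := by
                rw [hrel t ht, Real.rpow_sub_one hs0.ne']; ring
            _ ≤ _ := mul_le_mul_of_nonneg_left (rpow_neg_half_mul_lerp_rpow_le hb0 hb1 hs0 ht)
                (by positivity)
      _ ≤ C * s ^ (b - 1) * (K₂ * s ^ (1 - 2 * b)) := by gcongr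
      _ = C * K₂ * s ^ (-b) := e0.symm
      _ ≤ _ := by gcongr; exact le_max_right _ _
  · have e0 : C * K₂ * s ^ (-b - 1) = C * s ^ (b - 1 - 1) * (K₂ * s ^ (1 - 2 * b)) := by
      have : s ^ (-b - 1) = s ^ (b - 1 - 1) * s ^ (1 - 2 * b) := by
        rw [← Real.rpow_add hs0]; ring_nf
      rw [this]; ring
    calc |∫ t in Ioo 0 1, t ^ (-1 / 2 : ℝ) * F₂ s t| ≤ C * s ^ (b - 1 - 1) *
          ∫ t in Ioo (0 : ℝ) 1, 8 * (t ^ (-1 / 2 : ℝ) + (1 + s - t) ^ (-(2 * b))) := by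
          rw [← Real.norm_eq_abs, ← integral_const_mul]
          refine norm_integral_le_of_norm_le (j1.const_mul _) ?_
          filter_upwards [ae_restrict_mem measurableSet_Ioo] with t ht
          have ht0 := ht.1
          have hx : 0 < t ^ (-1 / 2 : ℝ) := by positivity
          rw [norm_mul, Real.norm_eq_abs, Real.norm_eq_abs, abs_of_pos hx]
          calc _ ≤ t ^ (-1 / 2 : ℝ) * (C * lerp s t ^ (-b) * (relLevel b s t / s ^ 2)) := by
                gcongr; exact (hC s hs t ht).2.2
            _ = t ^ (-1 / 2 : ℝ) * (C * (lerp s t ^ (-b) * relLevel b s t) / s ^ 2) := by ring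
            _ = C * s ^ (b - 1 - 1) * (t ^ (-1 / 2 : ℝ) * lerp s t ^ (-(2 * b))) := by
                rw [hrel t ht, Real.rpow_sub_one hs0.ne', Real.rpow_sub_one hs0.ne']
                field_simp
            _ ≤ _ := mul_le_mul_of_nonneg_left (rpow_neg_half_mul_lerp_rpow_le hb0 hb1 hs0 ht)
                (by positivity)
      _ ≤ C * s ^ (b - 1 - 1) * (K₂ * s ^ (1 - 2 * b)) := by gcongr
      _ = C * K₂ * s ^ (-b - 1) := e0.symm
      _ ≤ _ := by gcongr; exact le_max_right _ _

/-! ### The traversal-time integral as a function of the rescaled level. -/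

/-- The integrand, without the factor `t ^ (-1/2)`, of the traversal time as a function of the
rescaled level `s`; here `φ` inverts `ratioFun` and `P` is the quotient
`(1 - φ ^ 2) / (1 - ξ ^ (1 / b))`. -/
noncomputable def periodKernel (b : ℝ) (φ P : ℝ → ℝ) (s t : ℝ) : ℝ :=
  lerp s t ^ (-b) * (deriv φ (relLevel b s t) *
    (t + (1 - t) * P (relLevel b s t)) ^ (-1 / 2 : ℝ))

/-- The traversal time as a function of the rescaled level `s`. -/
noncomputable def periodIntegral (b : ℝ) (φ P : ℝ → ℝ) (s : ℝ) : ℝ :=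
  ∫ t in Ioo 0 1, t ^ (-1 / 2 : ℝ) * periodKernel b φ P s t

/-- Inverse of `ratioFun` together with the data entering the traversal time. -/
structure RatioInverse (α : ℝ) (φ P : ℝ → ℝ) : Prop where
  contDiffAt : ∀ ξ ∈ Ioo (0 : ℝ) 1, ContDiffAt ℝ ω φ ξ
  mem : ∀ ξ ∈ Ioo (0 : ℝ) 1, φ ξ ∈ Ioo (0 : ℝ) 1
  right_inv : ∀ ξ ∈ Ioo (0 : ℝ) 1, ratioFun α (φ ξ) = ξ
  left_inv : ∀ z ∈ Ioo (0 : ℝ) 1, φ (ratioFun α z) = z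
  ratioFun_mem : ∀ z ∈ Ioo (0 : ℝ) 1, ratioFun α z ∈ Ioo (0 : ℝ) 1
  deriv_pos : ∀ ξ ∈ Ioo (0 : ℝ) 1, 0 < deriv φ ξ
  deriv_eq : ∀ ξ ∈ Ioo (0 : ℝ) 1, deriv φ ξ = (deriv (ratioFun α) (φ ξ))⁻¹
  quot_pos : ∀ ξ ∈ Ioo (0 : ℝ) 1, 0 < P ξ
  quot_eq : ∀ ξ ∈ Ioo (0 : ℝ) 1, 1 - φ ξ ^ 2 = P ξ * (1 - ξ ^ (1 / (1 - α / 2)))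

/-- Regularity of the traversal time as a function of the rescaled level. -/
theorem exists_ratioInverse {α : ℝ} (h0 : 0 < α) (h1 : α < 1) :
    ∃ φ P : ℝ → ℝ, RatioInverse α φ P ∧ ∃ s₁ > 1, ∃ I₁ I₂ : ℝ → ℝ,
      (∀ s ∈ Ioo 0 s₁, IntegrableOn (fun t : ℝ => t ^ (-1 / 2 : ℝ) *
        periodKernel (1 - α / 2) φ P s t) (Ioo 0 1)) ∧
      (∀ s ∈ Ioo 0 s₁, 0 < periodIntegral (1 - α / 2) φ P s) ∧
      (∀ s ∈ Ioo 0 s₁, HasDerivAt (periodIntegral (1 - α / 2) φ P) (I₁ s) s) ∧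
      (∀ s ∈ Ioo 0 s₁, HasDerivAt I₁ (I₂ s) s) ∧ ContinuousOn I₂ (Ioo 0 s₁) ∧
      ∃ C, ∀ s ∈ Ioo 0 s₁, |periodIntegral (1 - α / 2) φ P s| ≤ C ∧
        |I₁ s| ≤ C * s ^ (-(1 - α / 2)) ∧ |I₂ s| ≤ C * s ^ (-(1 - α / 2) - 1) := by
  obtain ⟨φ, ω₀, ω₁, hω₀, hω₁, hφ, hφz, hφr, hφd, hφ0, hφ1⟩ := exists_ratioInv h0 h1
  set b := 1 - α / 2 with hb
  have hb0 : 1 / 2 < b := by rw [hb]; linarith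
  have hb1 : b < 1 := by rw [hb]; linarith
  have hbp : 0 < b := by linarith
  -- M lies strictly between 1 and the end ω₁ of the domain of the analytic inverse, and s₁ =
  -- M^(1/b) is chosen so that s < s₁ keeps the relative level below M. Thus s₁ > 1 while φ stays
  -- analytic on [0, M].
  set k := 1 / b with hk
  have hk1 : 1 ≤ k := by rw [hk, le_div_iff₀ hbp]; linarith
  set M := (1 + ω₁) / 2 with hM
  have hM1 : 1 < M := by rw [hM]; linarith
  have hMω : M < ω₁ := by rw [hM]; linarith
  set s₁ := M ^ k with hs₁
  have hs₁1 : 1 < s₁ := Real.one_lt_rpow hM1 (by linarith)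
  have hs₁b : s₁ ^ b = M := by
    rw [hs₁, ← Real.rpow_mul (by linarith), hk, one_div_mul_cancel hbp.ne', Real.rpow_one]
  have hsub : Icc 0 M ⊆ Ioo ω₀ ω₁ := fun x hx => ⟨by linarith [hx.1], by linarith [hx.2]⟩
  have hmono : StrictMonoOn φ (Icc 0 M) := strictMonoOn_of_deriv_pos (convex_Icc _ _)
    (fun x hx => (hφ x (hsub hx)).continuousAt.continuousWithinAt)
    fun x hx => (hφd x (hsub (interior_subset hx))).1
  set φ₂ : ℝ → ℝ := fun x => φ x ^ 2 with hφ₂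
  have hφ₂c : ∀ x ∈ Ioo ω₀ ω₁, ContDiffAt ℝ ω φ₂ x := fun x hx => (hφ x hx).pow 2
  have m1 : (1 : ℝ) ∈ Ioo ω₀ ω₁ := hsub ⟨zero_le_one, hM1.le⟩
  -- Both 1 - φ(ξ)² and 1 - ξ^k vanish to first order at ξ = 1. Their quotient P is the quotient of
  -- the divided differences N and E at 1, hence has no singularity there.
  set N := dslope φ₂ 1 with hN
  set E := dslope (fun x : ℝ => x ^ k) 1 with hE
  set P : ℝ → ℝ := fun x => N x * (E x)⁻¹ with hP
  have hNa : ∀ x ∈ Icc 0 M, AnalyticAt ℝ N x := fun x hx =>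
    (contDiffAt_dslope (hφ₂c 1 m1) (hφ₂c x (hsub hx))).analyticAt
  have hNpos : ∀ x ∈ Icc 0 M, 0 < N x := by
    intro x hx
    have hx0 : 0 ≤ φ x := by
      rw [← hφ0]; exact hmono.monotoneOn ⟨le_rfl, by linarith⟩ hx hx.1
    refine dslope_pos ?_ (fun h => ?_) (fun h => ?_)
    · have h3 : HasDerivAt φ (deriv φ 1) 1 := ((hφ 1 m1).differentiableAt (by simp)).hasDerivAt
      have h4 : HasDerivAt φ₂ _ 1 := h3.pow 2
      have : deriv φ₂ 1 = 2 * φ 1 ^ 1 * deriv φ 1 := by simpa using h4.deriv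
      rw [this, hφ1]
      have := (hφd 1 m1).1
      linarith
    · have : φ x < 1 := by
        rw [← hφ1]; exact hmono hx ⟨zero_le_one, hM1.le⟩ h
      simp only [hφ₂, hφ1]
      nlinarith
    · have : 1 < φ x := by
        rw [← hφ1]; exact hmono ⟨zero_le_one, hM1.le⟩ hx h
      simp only [hφ₂, hφ1]
      nlinarith
  obtain ⟨n₀, hn₀, hn₀le⟩ : ∃ n₀ > 0, ∀ x ∈ Icc 0 M, n₀ ≤ N x := by
    obtain ⟨x, hx, hmin⟩ := isCompact_Icc.exists_isMinOn (nonempty_Icc.2 (by linarith : (0 : ℝ) ≤ M))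
      (f := N) fun x hx => (hNa x hx).continuousAt.continuousWithinAt
    exact ⟨N x, hNpos x hx, fun y hy => hmin hy⟩
  have hEone : ∀ x, 0 < x → 1 ≤ E x := fun x hx => one_le_dslope_rpow hk1 hx
  have hPpos : ∀ x ∈ Ioo 0 M, 0 < P x := fun x hx =>
    mul_pos (hNpos x (Ioo_subset_Icc_self hx)) (inv_pos.2 (by linarith [hEone x hx.1]))
  have sub1 : Ioo (0 : ℝ) 1 ⊆ Icc 0 M := fun x hx => ⟨hx.1.le, by linarith [hx.2]⟩
  have hRI : RatioInverse α φ P := by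
    refine ⟨fun ξ hξ => hφ ξ (hsub (sub1 hξ)), fun ξ hξ => ⟨?_, ?_⟩,
      fun ξ hξ => hφr ξ (hsub (sub1 hξ)), fun z hz => (hφz z hz).1, fun z hz => (hφz z hz).2,
      fun ξ hξ => (hφd ξ (hsub (sub1 hξ))).1, fun ξ hξ => (hφd ξ (hsub (sub1 hξ))).2,
      fun ξ hξ => hPpos ξ ⟨hξ.1, by linarith [hξ.2]⟩, fun ξ hξ => ?_⟩
    · rw [← hφ0]; exact hmono ⟨le_rfl, by linarith⟩ (sub1 hξ) hξ.1
    · rw [← hφ1]; exact hmono (sub1 hξ) ⟨zero_le_one, hM1.le⟩ hξ.2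
    · have e1 : (ξ - 1) * N ξ = φ ξ ^ 2 - 1 := by
        have := sub_smul_dslope φ₂ 1 ξ
        simpa [hφ₂, hφ1] using this
      have e2 : (ξ - 1) * E ξ = ξ ^ k - 1 := by
        have := sub_smul_dslope (fun x : ℝ => x ^ k) 1 ξ
        simpa using this
      have h3 := hEone ξ hξ.1
      have h4 : E ξ ≠ 0 := by linarith
      have : 1 - φ ξ ^ 2 = P ξ * (1 - ξ ^ k) := by
        rw [← neg_sub, ← e1, ← neg_sub (ξ ^ k) 1, ← e2]
        simp only [hP]
        field_simp
      exact this
  have hφ'prof : IsProfile (s₁ ^ b) (deriv φ) := by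
    rw [hs₁b]
    exact IsProfile.of_analyticAt_Icc fun x hx => (hφ x (hsub hx)).analyticAt.deriv
  have hNprof : IsProfile (s₁ ^ b) N := by
    rw [hs₁b]
    exact IsProfile.of_analyticAt_Icc hNa
  have hEprof : IsProfile (s₁ ^ b) E := isProfile_dslope_rpow hk1
  have hrel : ∀ s ∈ Ioo 0 s₁, ∀ t ∈ Ioo (0 : ℝ) 1, relLevel b s t ∈ Ioo 0 M := fun s hs t ht => by
    rw [← hs₁b]; exact relLevel_mem hbp hs hs₁1 ht
  obtain ⟨_, _, bφ⟩ := hφ'prof.scaledBound hbp hb1 hs₁1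
  obtain ⟨_, _, bN⟩ := hNprof.scaledBound hbp hb1 hs₁1
  obtain ⟨_, _, bE⟩ := hEprof.scaledBound hbp hb1 hs₁1
  obtain ⟨CE, hCE⟩ : ∃ CE, ∀ x ∈ Ioo 0 M, |E x| ≤ CE := by
    obtain ⟨C, hC⟩ := hEprof.bound
    rw [hs₁b] at hC
    exact ⟨C, fun x hx => (hC x hx).1⟩
  have hCE1 : 1 ≤ CE := by
    have h3 : (1 : ℝ) ∈ Ioo 0 M := ⟨one_pos, hM1⟩
    exact (hEone 1 one_pos).trans ((le_abs_self _).trans (hCE 1 h3))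
  have hinv : ∀ x, 1 ≤ x → AnalyticAt ℝ (fun y : ℝ => y⁻¹) x := fun x hx =>
    analyticAt_inv (by linarith)
  have bEi := bE.comp_of_bounded hbp hs₁1 (Θ := fun x => x⁻¹)
    (fun s hs t ht => hinv _ (hEone _ (hrel s hs t ht).1)) rfl (by
      obtain ⟨C, hC0, hC⟩ := exists_bound_of_analyticAt (Θ := fun x : ℝ => x⁻¹) (a := 1) (c := CE)
        fun x hx => hinv x hx.1
      exact ⟨C, hC0, fun s hs t ht => hC _ ⟨hEone _ (hrel s hs t ht).1,
        (le_abs_self _).trans (hCE _ (hrel s hs t ht))⟩⟩)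
  have bP := bN.mul hbp hs₁1 bEi
  rw [add_zero] at bP
  have bB := bP.lerp_one
  obtain ⟨CB, hCB0, hCB⟩ := bB.bound
  -- The number t + (1-t)P is a convex combination of 1 and P, and P ≥ n₀/CE. So it stays in a
  -- compact subinterval of (0, ∞), where the power -1/2 is analytic with bounded derivatives.
  set c₀ := min 1 (n₀ * CE⁻¹) with hc₀
  have hc₀p : 0 < c₀ := lt_min one_pos (by positivity)
  have hBlow : ∀ s ∈ Ioo 0 s₁, ∀ t ∈ Ioo (0 : ℝ) 1,
      c₀ ≤ t + (1 - t) * P (relLevel b s t) := by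
    intro s hs t ht
    have hw := hrel s hs t ht
    have h3 : n₀ * CE⁻¹ ≤ P (relLevel b s t) := by
      have h5 := hEone _ hw.1
      have h6 := (le_abs_self _).trans (hCE _ hw)
      simp only [hP]
      gcongr
      · exact (hNpos _ (Ioo_subset_Icc_self hw)).le
      · exact hn₀le _ (Ioo_subset_Icc_self hw)
    have h5 : c₀ ≤ 1 := min_le_left _ _
    have h6 : c₀ ≤ P (relLevel b s t) := (min_le_right _ _).trans h3
    nlinarith [ht.1, ht.2]
  have hBup : ∀ s ∈ Ioo 0 s₁, ∀ t ∈ Ioo (0 : ℝ) 1,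
      t + (1 - t) * P (relLevel b s t) ≤ CB := by
    intro s hs t ht
    have := (hCB s hs t ht).1
    simp only [Real.rpow_zero, mul_one] at this
    exact (le_abs_self _).trans this
  have bBh := bB.comp_of_bounded hbp hs₁1 (Θ := fun x => x ^ (-1 / 2 : ℝ))
    (fun s hs t ht => analyticAt_rpow_const (hc₀p.trans_le (hBlow s hs t ht))) rfl (by
      obtain ⟨C, hC0, hC⟩ := exists_bound_of_analyticAt (Θ := fun x : ℝ => x ^ (-1 / 2 : ℝ))
        (a := c₀) (c := CB) fun x hx => analyticAt_rpow_const (hc₀p.trans_le hx.1)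
      exact ⟨C, hC0, fun s hs t ht => hC _ ⟨hBlow s hs t ht, hBup s hs t ht⟩⟩)
  -- Assembles the kernel: η^(-b) has exponent -b, φ' and the inverse square root have exponent 0.
  have bfin := (scaledBound_lerp_rpow (k := -b) hbp hb1 hs₁1).mul hbp hs₁1 (bφ.mul hbp hs₁1 bBh)
  rw [add_zero, add_zero] at bfin
  obtain ⟨hint, I₁, I₂, hI₁, hI₂, hI₂c, hIb⟩ := bfin.integral hb0 hb1 hs₁1
  refine ⟨φ, P, hRI, s₁, hs₁1, I₁, I₂, hint, fun s hs => ?_, hI₁, hI₂, hI₂c, hIb⟩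
  have hpos : ∀ t ∈ Ioo (0 : ℝ) 1, 0 < t ^ (-1 / 2 : ℝ) * periodKernel b φ P s t := by
    intro t ht
    have h3 := hBlow s hs t ht
    have h5 := (hφd _ (hsub (Ioo_subset_Icc_self (hrel s hs t ht)))).1
    have h6 := lerp_pos hs.1 ht
    have h7 := ht.1
    have h8 : 0 < t + (1 - t) * P (relLevel b s t) := by linarith
    unfold periodKernel
    positivity
  unfold periodIntegral
  rw [setIntegral_pos_iff_support_of_nonneg_ae]
  · refine lt_of_lt_of_le (by simp : 0 < volume (Ioo (0 : ℝ) 1)) (measure_mono fun t ht => ?_)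
    exact ⟨(hpos t ht).ne', ht⟩
  · filter_upwards [ae_restrict_mem measurableSet_Ioo] with t ht using (hpos t ht).le
  · exact hint s hs

/-! ### The stream function along rays, and its gradient. -/

/-- `sin (π xᵢ)`. -/
noncomputable def sinPi (x : Plane) (i : Fin 2) : ℝ := Real.sin (Real.pi * x i)

theorem sinPi_pos {x : Plane} (hx : x ∈ Q) (i : Fin 2) : 0 < sinPi x i :=
  Real.sin_pos_of_pos_of_lt_pi (mul_pos Real.pi_pos (hx i).1)
    (by nlinarith [Real.pi_pos, (hx i).2])

theorem sinPi_le_one (x : Plane) (i : Fin 2) : sinPi x i ≤ 1 := Real.sin_le_one _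

theorem isOpen_Q : IsOpen Q := by
  have : Q = ⋂ i, (fun x : Plane => x i) ⁻¹' Ioo 0 1 := by
    ext x; simp [Q]
  rw [this]
  exact isOpen_iInter_of_finite fun i => isOpen_Ioo.preimage (by fun_prop)

theorem contDiff_sinPi {n : WithTop ℕ∞} (i : Fin 2) : ContDiff ℝ n fun x : Plane => sinPi x i := by
  unfold sinPi
  fun_prop

theorem psi_eq (α : ℝ) (x : Plane) :
    psi α x = 2 ^ α * (sinPi x 0 * sinPi x 1) / (sinPi x 0 + sinPi x 1) ^ α := rfl

theorem contDiffAt_psi {α : ℝ} {n : WithTop ℕ∞} {x : Plane} (hx : x ∈ Q) :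
    ContDiffAt ℝ n (psi α) x := by
  have h0 := sinPi_pos hx 0
  have h1 := sinPi_pos hx 1
  have c0 := (contDiff_sinPi (n := n) 0).contDiffAt (x := x)
  have c1 := (contDiff_sinPi (n := n) 1).contDiffAt (x := x)
  have : psi α = fun x => 2 ^ α * (sinPi x 0 * sinPi x 1) / (sinPi x 0 + sinPi x 1) ^ α := rfl
  rw [this]
  refine (contDiffAt_const.mul (c0.mul c1)).div ((c0.add c1).rpow_const_of_ne ?_) ?_ <;> positivity

/-- The stream function along rays in the coordinates `sin (π x)`, `sin (π y)`. -/
theorem psi_eq_ray {α : ℝ} {x : Plane} (h0 : 0 < sinPi x 0) (h1 : 0 < sinPi x 1) :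
    psi α x = (sinPi x 0 ^ 2) ^ (1 - α / 2) * ratioFun α (sinPi x 1 / sinPi x 0) := by
  rw [psi_eq, ratioFun]
  set u := sinPi x 0
  set v := sinPi x 1
  have e1 : 2 / (1 + v / u) = 2 * u / (u + v) := by field_simp
  have e2 : (u ^ 2) ^ (1 - α / 2) = u ^ 2 / u ^ α := by
    rw [← Real.rpow_natCast, ← Real.rpow_mul h0.le]
    have : ((2 : ℕ) : ℝ) * (1 - α / 2) = (2 : ℕ) - α := by push_cast; ring
    rw [this, Real.rpow_sub h0]
  rw [e1, e2, Real.div_rpow (by positivity) (by positivity), Real.mul_rpow two_pos.le h0.le]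
  have : 0 < u ^ α := by positivity
  have : 0 < (u + v) ^ α := by positivity
  field_simp

/-- Only the vertical derivative is needed explicitly: by tangency, speed divided by |∇psi| equals
|x'| divided by |∂_y psi|. -/
theorem hasDerivAt_psi_vertical {α : ℝ} {x : Plane} (hx : x ∈ Q) :
    fderiv ℝ (psi α) x (EuclideanSpace.single 1 1) =
      (sinPi x 0 ^ 2) ^ (1 - α / 2) * (deriv (ratioFun α) (sinPi x 1 / sinPi x 0) *
        (Real.pi * Real.cos (Real.pi * x 1) / sinPi x 0)) := by
  have hd : HasFDerivAt (psi α) (fderiv ℝ (psi α) x) x :=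
    ((contDiffAt_psi (n := 1) hx).differentiableAt (by simp)).hasFDerivAt
  have h1 : HasDerivAt (fun t : ℝ => x + t • EuclideanSpace.single (1 : Fin 2) (1 : ℝ))
      (EuclideanSpace.single (1 : Fin 2) (1 : ℝ) : Plane) 0 := by
    simpa using ((hasDerivAt_id (0 : ℝ)).smul_const
      (EuclideanSpace.single (1 : Fin 2) (1 : ℝ) : Plane)).const_add x
  have h2 : HasDerivAt (fun t : ℝ => psi α (x + t • EuclideanSpace.single (1 : Fin 2) (1 : ℝ)))
      (fderiv ℝ (psi α) x (EuclideanSpace.single 1 1)) 0 := by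
    have hd' : HasFDerivAt (psi α) (fderiv ℝ (psi α) x)
        (x + (0 : ℝ) • EuclideanSpace.single (1 : Fin 2) (1 : ℝ)) := by simpa using hd
    exact hd'.comp_hasDerivAt (0 : ℝ) h1
  have hu := sinPi_pos hx 0
  have hv := sinPi_pos hx 1
  have hz : -1 < sinPi x 1 / sinPi x 0 := by
    have : 0 < sinPi x 1 / sinPi x 0 := by positivity
    linarith
  have h3 : HasDerivAt (fun t : ℝ => (sinPi x 0 ^ 2) ^ (1 - α / 2) *
      ratioFun α (Real.sin (Real.pi * (x 1 + t)) / sinPi x 0))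
      ((sinPi x 0 ^ 2) ^ (1 - α / 2) * (deriv (ratioFun α) (sinPi x 1 / sinPi x 0) *
        (Real.pi * Real.cos (Real.pi * x 1) / sinPi x 0))) 0 := by
    have h4 : HasDerivAt (fun t : ℝ => Real.sin (Real.pi * (x 1 + t)) / sinPi x 0)
        (Real.pi * Real.cos (Real.pi * x 1) / sinPi x 0) 0 := by
      have := ((((hasDerivAt_id (0 : ℝ)).const_add (x 1)).const_mul Real.pi).sin).div_const
        (sinPi x 0)
      convert! this using 1
      simp only [id, add_zero, mul_one]
      ring
    have h5 : HasDerivAt (ratioFun α) (deriv (ratioFun α) (sinPi x 1 / sinPi x 0))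
        (Real.sin (Real.pi * (x 1 + 0)) / sinPi x 0) := by
      simpa [sinPi] using ((contDiffAt_ratioFun (n := 1) hz).differentiableAt (by simp)).hasDerivAt
    exact (h5.comp (0 : ℝ) h4).const_mul _
  refine h2.unique (h3.congr_of_eventuallyEq ?_)
  have hev : ∀ᶠ t : ℝ in 𝓝 0, x + t • EuclideanSpace.single (1 : Fin 2) (1 : ℝ) ∈ Q := by
    refine h1.continuousAt.eventually_mem (isOpen_Q.mem_nhds (by simpa using hx))
  filter_upwards [hev] with t ht
  rw [psi_eq_ray (sinPi_pos ht 0) (sinPi_pos ht 1)]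
  simp [sinPi]

theorem norm_gradient (f : Plane → ℝ) (x : Plane) : ‖gradient f x‖ = ‖fderiv ℝ f x‖ := by
  unfold gradient
  simp

theorem norm_gradient_sq (f : Plane → ℝ) (x : Plane) :
    ‖gradient f x‖ ^ 2 = fderiv ℝ f x (EuclideanSpace.single 0 1) ^ 2 +
      fderiv ℝ f x (EuclideanSpace.single 1 1) ^ 2 := by
  have h : ∀ i, gradient f x i = fderiv ℝ f x (EuclideanSpace.single i 1) := by
    intro i
    have h1 : inner ℝ (gradient f x) (EuclideanSpace.single i (1 : ℝ)) =
        fderiv ℝ f x (EuclideanSpace.single i 1) := by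
      unfold gradient
      exact InnerProductSpace.toDual_symm_apply
    rw [← h1, EuclideanSpace.inner_single_right]
    simp
  rw [EuclideanSpace.norm_sq_eq, Fin.sum_univ_two, h, h, Real.norm_eq_abs, Real.norm_eq_abs, sq_abs,
    sq_abs]

/-- By Mazur–Ulam a surjective isometry is affine; its linear part is an isometry and so preserves
the operator norm of the differential. -/
theorem norm_gradient_comp_isometryEquiv {f : Plane → ℝ} (R : Plane ≃ᵢ Plane) {x : Plane}
    (hd : DifferentiableAt ℝ f (R x)) :
    ‖gradient (fun y => f (R y)) x‖ = ‖gradient f (R x)‖ := by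
  set L := R.toRealAffineIsometryEquiv.linearIsometryEquiv with hL
  have hR : HasFDerivAt R (L : Plane →L[ℝ] Plane) x := by
    have h1 : (R : Plane → Plane) = fun y => L y + R 0 := by
      ext1 y
      have := R.toRealAffineIsometryEquiv.map_vadd 0 y
      simpa [hL] using this
    rw [h1]
    exact (L.toContinuousLinearEquiv.hasFDerivAt (x := x)).add_const _
  have hc : HasFDerivAt (fun y => f (R y)) _ x := hd.hasFDerivAt.comp x hR
  rw [norm_gradient, norm_gradient, hc.fderiv]
  exact ContinuousLinearMap.opNorm_comp_linearIsometryEquiv _ _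

theorem measurable_inv_norm_gradient (f : Plane → ℝ) :
    Measurable fun x => (ENNReal.ofReal ‖gradient f x‖)⁻¹ := by
  simp_rw [norm_gradient]
  exact ((measurable_fderiv ℝ f).norm.ennreal_ofReal).inv

/-- Halving an integral by a reflection. -/
theorem setLIntegral_eq_two_mul {X : Type*} [EMetricSpace X] [MeasurableSpace X] [BorelSpace X]
    (R : X ≃ᵢ X) {A H N : Set X} {f : X → ℝ≥0∞} (hA : MeasurableSet A) (hH : MeasurableSet H)
    (hRA : R ⁻¹' A = A) (hf : ∀ x ∈ A, f (R x) = f x) (hdisj : ∀ x ∈ A, x ∈ H → R x ∉ H)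
    (hcov : ∀ x ∈ A, x ∈ H ∨ R x ∈ H ∨ x ∈ N) (hN : Measure.hausdorffMeasure 1 (A ∩ N) = 0) :
    ∫⁻ x in A, f x ∂(Measure.hausdorffMeasure 1) =
      2 * ∫⁻ x in A ∩ H, f x ∂(Measure.hausdorffMeasure 1) := by
  set μ : Measure X := Measure.hausdorffMeasure 1
  have hmp : MeasurePreserving R μ μ := R.measurePreserving_hausdorffMeasure 1
  have hRm : Measurable R := R.continuous.measurable
  have h1 : A =ᵐ[μ] (A ∩ H ∪ A ∩ R ⁻¹' H : Set X) := by
    refine (ae_eq_set).2 ⟨measure_mono_null (fun x hx => ?_) hN, ?_⟩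
    · refine ⟨hx.1, ?_⟩
      rcases hcov x hx.1 with h | h | h
      · exact absurd (Or.inl ⟨hx.1, h⟩) hx.2
      · exact absurd (Or.inr ⟨hx.1, h⟩) hx.2
      · exact h
    · rw [← inter_union_distrib_left, sdiff_eq_empty.2 inter_subset_left, measure_empty]
  have h2 : Disjoint (A ∩ H) (A ∩ R ⁻¹' H) := by
    rw [disjoint_left]
    exact fun x hx hx' => hdisj x hx.1 hx.2 hx'.2
  have h3 : A ∩ R ⁻¹' H = R ⁻¹' (A ∩ H) := by rw [preimage_inter, hRA]
  rw [setLIntegral_congr h1, lintegral_union (hA.inter (hRm hH)) h2, two_mul]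
  congr 1
  rw [← hmp.setLIntegral_comp_preimage_emb R.toHomeomorph.measurableEmbedding f (A ∩ H), ← h3]
  refine setLIntegral_congr_fun (hA.inter (hRm hH)) fun x hx => (hf x hx.1).symm

/-! ### Parametrization of a level set in the fundamental triangle. -/

/-- The part of a level set below the diagonal in the lower left quarter, parametrized by the
square of `sin (π x)`. -/
noncomputable def levelCurve (b : ℝ) (φ : ℝ → ℝ) (s t : ℝ) : Plane :=
  !₂[Real.arcsin (√(lerp s t)) / Real.pi,
    Real.arcsin (φ (relLevel b s t) * √(lerp s t)) / Real.pi]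

/-- The triangle `y < x < 1/2`. -/
def triangle : Set Plane := {x | x 1 < x 0 ∧ x 0 < 1 / 2}

theorem lerp_mem {s t : ℝ} (hs : s ∈ Ioo (0 : ℝ) 1) (ht : t ∈ Ioo (0 : ℝ) 1) :
    lerp s t ∈ Ioo s 1 := by
  unfold lerp
  constructor <;> nlinarith [hs.1, hs.2, ht.1, ht.2, mul_pos (sub_pos.2 hs.2) ht.1,
    mul_pos (sub_pos.2 hs.2) (sub_pos.2 ht.2)]

theorem relLevel_mem_unit {b s t : ℝ} (hb : 0 < b) (hs : s ∈ Ioo (0 : ℝ) 1)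
    (ht : t ∈ Ioo (0 : ℝ) 1) : relLevel b s t ∈ Ioo (0 : ℝ) 1 := by
  have h := lerp_mem hs ht
  have h0 := hs.1
  have hη : 0 < lerp s t := lerp_pos hs.1 ht
  unfold relLevel
  exact ⟨by positivity, Real.rpow_lt_one (by positivity) ((div_lt_one hη).2 h.1) hb⟩

theorem sin_pi_mul_arcsin_div {u : ℝ} (h0 : -1 ≤ u) (h1 : u ≤ 1) :
    Real.sin (Real.pi * (Real.arcsin u / Real.pi)) = u := by
  rw [mul_div_cancel₀ _ Real.pi_ne_zero, Real.sin_arcsin h0 h1]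

theorem arcsin_sin_pi_mul {x : ℝ} (h0 : 0 ≤ x) (h1 : x ≤ 1 / 2) :
    Real.arcsin (Real.sin (Real.pi * x)) / Real.pi = x := by
  rw [Real.arcsin_sin (by nlinarith [Real.pi_pos]) (by nlinarith [Real.pi_pos]),
    mul_div_cancel_left₀ _ Real.pi_ne_zero]

section

variable {α : ℝ} {φ P : ℝ → ℝ} {s t : ℝ}

/-- The last identity is the crucial one. Since ξ^(1/b) = s/η, the defining property of P gives 1 -
φ²η = (1 - η) + P(η - s), and both 1 - η and η - s contain the factor 1 - s. This is cos²(πy) along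
the curve. -/
theorem RatioInverse.curve_facts (hφ : RatioInverse α φ P) (h0 : 0 < α) (h1 : α < 1)
    (hs : s ∈ Ioo (0 : ℝ) 1) (ht : t ∈ Ioo (0 : ℝ) 1) :
    0 < √(lerp s t) ∧ √(lerp s t) < 1 ∧ 0 < φ (relLevel (1 - α / 2) s t) * √(lerp s t) ∧
      φ (relLevel (1 - α / 2) s t) * √(lerp s t) < √(lerp s t) ∧
      1 - (φ (relLevel (1 - α / 2) s t) * √(lerp s t)) ^ 2 =
        (1 - s) * (t + (1 - t) * P (relLevel (1 - α / 2) s t)) := by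
  have hb : 0 < 1 - α / 2 := by linarith
  have hη := lerp_mem hs ht
  have hηp := lerp_pos hs.1 ht
  have hw := relLevel_mem_unit hb hs ht
  have hz := hφ.mem _ hw
  have hu : 0 < √(lerp s t) := Real.sqrt_pos.2 hηp
  refine ⟨hu, ?_, mul_pos hz.1 hu, by nlinarith [hz.2], ?_⟩
  · rw [Real.sqrt_lt' one_pos]; simpa using hη.2
  · have e1 := hφ.quot_eq _ hw
    have e2 : relLevel (1 - α / 2) s t ^ (1 / (1 - α / 2)) = s / lerp s t := by
      unfold relLevel
      rw [← Real.rpow_mul (div_nonneg hs.1.le hηp.le), mul_one_div_cancel hb.ne', Real.rpow_one]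
    rw [e2] at e1
    rw [mul_pow, Real.sq_sqrt hηp.le]
    have e3 : φ (relLevel (1 - α / 2) s t) ^ 2 =
        1 - P (relLevel (1 - α / 2) s t) * (1 - s / lerp s t) := by linarith
    rw [e3]
    field_simp
    unfold lerp
    ring

theorem RatioInverse.levelCurve_image (hφ : RatioInverse α φ P) (h0 : 0 < α) (h1 : α < 1)
    (hs : s ∈ Ioo (0 : ℝ) 1) :
    levelCurve (1 - α / 2) φ s '' Ioo 0 1 =
      levelSet (psi α) (s ^ (1 - α / 2)) ∩ triangle := by
  have hb : 0 < 1 - α / 2 := by linarith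
  have hπ := Real.pi_pos
  ext x
  constructor
  · rintro ⟨t, ht, rfl⟩
    obtain ⟨hu0, hu1, hv0, hv1, -⟩ := hφ.curve_facts h0 h1 hs ht
    have hw := relLevel_mem_unit hb hs ht
    have hηp := lerp_pos hs.1 ht
    set u := √(lerp s t) with hu
    set v := φ (relLevel (1 - α / 2) s t) * u with hv
    have c0 : levelCurve (1 - α / 2) φ s t 0 = Real.arcsin u / Real.pi := rfl
    have c1 : levelCurve (1 - α / 2) φ s t 1 = Real.arcsin v / Real.pi := rfl
    have s0 : sinPi (levelCurve (1 - α / 2) φ s t) 0 = u := by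
      unfold sinPi; rw [c0, sin_pi_mul_arcsin_div (by linarith) hu1.le]
    have s1 : sinPi (levelCurve (1 - α / 2) φ s t) 1 = v := by
      unfold sinPi; rw [c1, sin_pi_mul_arcsin_div (by linarith) (by linarith)]
    have a0 : Real.arcsin u < Real.pi / 2 := Real.arcsin_lt_pi_div_two.2 hu1
    have a1 : Real.arcsin v < Real.arcsin u :=
      Real.arcsin_lt_arcsin (by linarith) hv1 hu1.le
    have a2 : 0 < Real.arcsin v := Real.arcsin_pos.2 hv0
    refine ⟨⟨fun i => ?_, ?_⟩, ?_, ?_⟩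
    · fin_cases i
      · change levelCurve (1 - α / 2) φ s t 0 ∈ Ioo 0 1
        rw [c0]
        exact ⟨div_pos (by linarith) hπ, (div_lt_one hπ).2 (by linarith)⟩
      · change levelCurve (1 - α / 2) φ s t 1 ∈ Ioo 0 1
        rw [c1]
        exact ⟨div_pos (by linarith) hπ, (div_lt_one hπ).2 (by linarith)⟩
    · rw [psi_eq_ray (by rw [s0]; exact hu0) (by rw [s1]; exact hv0), s0, s1]
      have e1 : v / u = φ (relLevel (1 - α / 2) s t) := by rw [hv]; field_simp
      rw [e1, hφ.right_inv _ hw, hu, Real.sq_sqrt hηp.le]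
      unfold relLevel
      rw [← Real.mul_rpow hηp.le (div_nonneg hs.1.le hηp.le), mul_div_cancel₀ _ hηp.ne']
    · rw [c0, c1]; gcongr
    · rw [c0, div_lt_div_iff₀ hπ two_pos]; linarith
  · rintro ⟨⟨hxQ, hxr⟩, hx1, hx2⟩
    have hu := sinPi_pos hxQ 0
    have hv := sinPi_pos hxQ 1
    have hx0 := (hxQ 0).1
    have hx3 := (hxQ 1).1
    have mono : StrictMonoOn (fun y : ℝ => Real.sin (Real.pi * y)) (Icc 0 (1 / 2)) := by
      intro y hy z hz hyz
      refine Real.strictMonoOn_sin ⟨?_, ?_⟩ ⟨?_, ?_⟩ (by gcongr)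
      · nlinarith [hy.1]
      · nlinarith [hy.2]
      · nlinarith [hz.1]
      · nlinarith [hz.2]
    have hvu : sinPi x 1 < sinPi x 0 :=
      mono ⟨hx3.le, by linarith⟩ ⟨hx0.le, hx2.le⟩ hx1
    have hu1 : sinPi x 0 < 1 := by
      have := mono ⟨hx0.le, hx2.le⟩ ⟨by norm_num, le_rfl⟩ hx2
      have e : Real.sin (Real.pi * (1 / 2)) = 1 := by rw [mul_one_div, Real.sin_pi_div_two]
      simp only [e] at this
      exact this
    have hz : sinPi x 1 / sinPi x 0 ∈ Ioo (0 : ℝ) 1 := ⟨by positivity, (div_lt_one hu).2 hvu⟩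
    have hfz := hφ.ratioFun_mem _ hz
    rw [psi_eq_ray hu hv] at hxr
    set u := sinPi x 0 with hudef
    set v := sinPi x 1 with hvdef
    set ξ := ratioFun α (v / u) with hξ
    -- Solving the level equation s^b = (u²)^b ξ for `s`. Together with ξ < 1 it gives s < u² < 1,
    -- so that u² is attained by the interpolation for the parameter t = (1 - u²)/(1 - s) in (0, 1).
    have hse : s = u ^ 2 * ξ ^ (1 / (1 - α / 2)) := by
      have e := congrArg (fun y => y ^ (1 / (1 - α / 2))) hxr
      rw [Real.mul_rpow (by positivity) hfz.1.le, ← Real.rpow_mul (by positivity),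
        ← Real.rpow_mul hs.1.le, mul_one_div_cancel hb.ne', Real.rpow_one, Real.rpow_one] at e
      exact e.symm
    have hξ1 : ξ ^ (1 / (1 - α / 2)) < 1 := Real.rpow_lt_one hfz.1.le hfz.2 (by positivity)
    have hsu : s < u ^ 2 := by
      rw [hse]; have : 0 < u ^ 2 := by positivity
      nlinarith
    have hu2 : u ^ 2 < 1 := by nlinarith
    have hs1 : 0 < 1 - s := by linarith [hs.2]
    refine ⟨(1 - u ^ 2) / (1 - s), ⟨div_pos (by linarith) hs1, (div_lt_one hs1).2 (by linarith)⟩, ?_⟩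
    have hl : lerp s ((1 - u ^ 2) / (1 - s)) = u ^ 2 := by
      unfold lerp; field_simp; ring
    have hrel : relLevel (1 - α / 2) s ((1 - u ^ 2) / (1 - s)) = ξ := by
      unfold relLevel
      rw [hl, hse, mul_div_cancel_left₀ _ (by positivity), ← Real.rpow_mul hfz.1.le,
        one_div_mul_cancel hb.ne', Real.rpow_one]
    have hsq : √(u ^ 2) = u := Real.sqrt_sq hu.le
    unfold levelCurve
    rw [hl, hrel, hsq, hξ, hφ.left_inv _ hz, div_mul_cancel₀ _ hu.ne']
    ext i
    fin_cases i
    · exact arcsin_sin_pi_mul hx0.le hx2.le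
    · exact arcsin_sin_pi_mul hx3.le (by linarith)

theorem levelCurve_injOn {b : ℝ} (hs : s ∈ Ioo (0 : ℝ) 1) :
    InjOn (levelCurve b φ s) (Ioo 0 1) := by
  intro t ht t' ht' h
  have e : Real.arcsin (√(lerp s t)) / Real.pi = Real.arcsin (√(lerp s t')) / Real.pi :=
    congrArg (fun x : Plane => x 0) h
  rw [div_left_inj' Real.pi_ne_zero] at e
  have hη := lerp_mem hs ht
  have hη' := lerp_mem hs ht'
  have p : ∀ {y}, y ∈ Ioo s 1 → √y ∈ Icc (-1 : ℝ) 1 := fun {y} hy =>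
    ⟨by linarith [Real.sqrt_nonneg y], Real.sqrt_le_one.2 hy.2.le⟩
  have e2 := Real.injOn_arcsin (p hη) (p hη') e
  rw [Real.sqrt_inj (by linarith [hη.1, hs.1]) (by linarith [hη'.1, hs.1])] at e2
  unfold lerp at e2
  have : 1 - s ≠ 0 := by linarith [hs.2]
  exact mul_left_cancel₀ this (by linarith)

theorem RatioInverse.contDiffAt_levelCurve (hφ : RatioInverse α φ P) (h0 : 0 < α) (h1 : α < 1)
    (hs : s ∈ Ioo (0 : ℝ) 1) (ht : t ∈ Ioo (0 : ℝ) 1) :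
    ContDiffAt ℝ 1 (levelCurve (1 - α / 2) φ s) t := by
  have hb : 0 < 1 - α / 2 := by linarith
  obtain ⟨hu0, hu1, hv0, hv1, -⟩ := hφ.curve_facts h0 h1 hs ht
  have hw := relLevel_mem_unit hb hs ht
  have hηp := lerp_pos hs.1 ht
  have cl : ContDiffAt ℝ 1 (fun t => lerp s t) t := by unfold lerp; fun_prop
  have cs : ContDiffAt ℝ 1 (fun t => √(lerp s t)) t := cl.sqrt hηp.ne'
  have cr : ContDiffAt ℝ 1 (fun t => relLevel (1 - α / 2) s t) t := by
    unfold relLevel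
    exact (contDiffAt_const.div cl hηp.ne').rpow_const_of_ne (div_pos hs.1 hηp).ne'
  have cφ : ContDiffAt ℝ 1 (fun t => φ (relLevel (1 - α / 2) s t)) t :=
    ((hφ.contDiffAt _ hw).of_le le_top).comp t cr
  rw [contDiffAt_euclidean]
  intro i
  fin_cases i
  · exact ((Real.contDiffAt_arcsin (by linarith) (by linarith)).comp t cs).div_const _
  · exact ContDiffAt.div_const (ContDiffAt.comp t (f := fun t => φ (relLevel (1 - α / 2) s t) *
      √(lerp s t)) (Real.contDiffAt_arcsin (by linarith) (by linarith)) (cφ.mul cs)) _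

/-- The velocity is orthogonal to the gradient, so the ratio of their norms is the ratio of the
horizontal velocity to the vertical derivative of psi. Each contains one square root of 1 - s, and
after cancellation an integrand regular at s = 1 remains. -/
theorem RatioInverse.speed_mul_inv_gradient (hφ : RatioInverse α φ P) (h0 : 0 < α) (h1 : α < 1)
    (hs : s ∈ Ioo (0 : ℝ) 1) (ht : t ∈ Ioo (0 : ℝ) 1) :
    ENNReal.ofReal ‖deriv (levelCurve (1 - α / 2) φ s) t‖ *
        (ENNReal.ofReal ‖gradient (psi α) (levelCurve (1 - α / 2) φ s t)‖)⁻¹ =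
      ENNReal.ofReal (1 / (2 * Real.pi ^ 2) *
        (t ^ (-1 / 2 : ℝ) * periodKernel (1 - α / 2) φ P s t)) := by
  have hb : 0 < 1 - α / 2 := by linarith
  obtain ⟨hu0, hu1, hv0, hv1, hv2⟩ := hφ.curve_facts h0 h1 hs ht
  have hw := relLevel_mem_unit hb hs ht
  have hηp := lerp_pos hs.1 ht
  have hη := lerp_mem hs ht
  have hπ := Real.pi_pos
  have ht0 := ht.1
  have hs1 : 0 < 1 - s := by linarith [hs.2]
  have hPp := hφ.quot_pos _ hw
  have hB : 0 < t + (1 - t) * P (relLevel (1 - α / 2) s t) := by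
    have : 0 < 1 - t := by linarith [ht.2]
    positivity
  set c := levelCurve (1 - α / 2) φ s with hc
  have hmem : c t ∈ levelSet (psi α) (s ^ (1 - α / 2)) :=
    ((hφ.levelCurve_image h0 h1 hs).subset (mem_image_of_mem _ ht)).1
  have hQ : c t ∈ Q := hmem.1
  have hcd : HasDerivAt c (deriv c t) t :=
    ((hφ.contDiffAt_levelCurve h0 h1 hs ht).differentiableAt (by simp)).hasDerivAt
  have hproj : ∀ i, HasDerivAt (fun t => c t i) (deriv c t i) t := fun i =>
    (EuclideanSpace.proj (𝕜 := ℝ) i).hasFDerivAt.comp_hasDerivAt t hcd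
  -- the first component of the velocity
  have hd0 : deriv c t 0 = -((1 - s) / (2 * √(lerp s t)) / √(1 - lerp s t) / Real.pi) := by
    have hl : HasDerivAt (fun t => lerp s t) (-(1 - s)) t := by
      unfold lerp
      simpa using ((hasDerivAt_id t).const_mul (1 - s)).const_sub 1
    have h3 : HasDerivAt (fun t => c t 0) (1 / √(1 - √(lerp s t) ^ 2) *
        (-(1 - s) / (2 * √(lerp s t))) / Real.pi) t :=
      ((Real.hasDerivAt_arcsin (by linarith) (by linarith)).comp t (hl.sqrt hηp.ne')).div_const _
    rw [(hproj 0).unique h3, Real.sq_sqrt hηp.le]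
    ring
  -- tangency to the level set
  set D₀ := fderiv ℝ (psi α) (c t) (EuclideanSpace.single 0 1) with hD₀
  set D₁ := fderiv ℝ (psi α) (c t) (EuclideanSpace.single 1 1) with hD₁
  have htan : D₀ * deriv c t 0 + D₁ * deriv c t 1 = 0 := by
    have h3 : HasDerivAt (fun t => psi α (c t)) (fderiv ℝ (psi α) (c t) (deriv c t)) t :=
      ((contDiffAt_psi (n := 1) hQ).differentiableAt (by simp)).hasFDerivAt.comp_hasDerivAt t hcd
    have h4 : HasDerivAt (fun t => psi α (c t)) 0 t := by
      refine (hasDerivAt_const t (s ^ (1 - α / 2))).congr_of_eventuallyEq ?_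
      filter_upwards [Ioo_mem_nhds ht.1 ht.2] with t' ht'
      exact (((hφ.levelCurve_image h0 h1 hs).subset (mem_image_of_mem _ ht')).1).2
    have h5 := h3.unique h4
    have h6 : deriv c t = deriv c t 0 • EuclideanSpace.single (0 : Fin 2) (1 : ℝ) +
        deriv c t 1 • EuclideanSpace.single (1 : Fin 2) (1 : ℝ) := by
      ext i; fin_cases i <;> simp
    rw [h6, map_add, map_smul, map_smul, smul_eq_mul, smul_eq_mul] at h5
    linarith
  have s0 : sinPi (c t) 0 = √(lerp s t) := sin_pi_mul_arcsin_div (by linarith) hu1.le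
  have s1 : sinPi (c t) 1 = φ (relLevel (1 - α / 2) s t) * √(lerp s t) :=
    sin_pi_mul_arcsin_div (by linarith) (by linarith)
  have hcos : Real.cos (Real.pi * c t 1) =
      √((1 - s) * (t + (1 - t) * P (relLevel (1 - α / 2) s t))) := by
    have : Real.pi * c t 1 = Real.arcsin (φ (relLevel (1 - α / 2) s t) * √(lerp s t)) :=
      mul_div_cancel₀ _ Real.pi_ne_zero
    rw [this, Real.cos_arcsin, hv2]
  have hz : φ (relLevel (1 - α / 2) s t) * √(lerp s t) / √(lerp s t) =
      φ (relLevel (1 - α / 2) s t) := mul_div_cancel_right₀ _ hu0.ne'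
  have hdφ := hφ.deriv_pos _ hw
  have hD₁e : D₁ = lerp s t ^ (1 - α / 2) * ((deriv φ (relLevel (1 - α / 2) s t))⁻¹ *
      (Real.pi * √((1 - s) * (t + (1 - t) * P (relLevel (1 - α / 2) s t))) / √(lerp s t))) := by
    rw [hD₁, hasDerivAt_psi_vertical hQ, s0, s1, hz, hcos, Real.sq_sqrt hηp.le,
      hφ.deriv_eq _ hw, inv_inv]
  have hD₁p : 0 < D₁ := by
    rw [hD₁e]
    have : 0 < √((1 - s) * (t + (1 - t) * P (relLevel (1 - α / 2) s t))) :=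
      Real.sqrt_pos.2 (mul_pos hs1 hB)
    positivity
  have hgr := norm_gradient_sq (psi α) (c t)
  have hgp : 0 < ‖gradient (psi α) (c t)‖ := by
    refine lt_of_le_of_ne (norm_nonneg _) fun h => ?_
    rw [← h] at hgr
    have := pow_pos hD₁p 2
    have := sq_nonneg D₀
    rw [← hD₀, ← hD₁] at hgr
    nlinarith
  -- The horizontal velocity is negative, as u decreases with `t`. After squaring, the claim is the
  -- tangency relation D₀x' = -D₁y'.
  have hspeed : ‖deriv c t‖ * D₁ = -deriv c t 0 * ‖gradient (psi α) (c t)‖ := by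
    have hneg : 0 ≤ -deriv c t 0 := by rw [hd0, neg_neg]; positivity
    refine (sq_eq_sq₀ (by positivity) (by positivity)).1 ?_
    rw [mul_pow, mul_pow, hgr, EuclideanSpace.norm_sq_eq, Fin.sum_univ_two, Real.norm_eq_abs,
      Real.norm_eq_abs, sq_abs, sq_abs, ← hD₀, ← hD₁]
    have : D₁ * deriv c t 1 = -(D₀ * deriv c t 0) := by linarith
    linear_combination (D₁ * deriv c t 1 - D₀ * deriv c t 0) * this
  rw [← ENNReal.ofReal_inv_of_pos hgp, ← ENNReal.ofReal_mul (norm_nonneg _)]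
  congr 1
  have hfrac : ‖deriv c t‖ * ‖gradient (psi α) (c t)‖⁻¹ = -deriv c t 0 / D₁ := by
    field_simp
    linarith
  rw [hfrac, hd0, neg_neg, hD₁e]
  have hl1 : 1 - lerp s t = (1 - s) * t := by unfold lerp; ring
  rw [hl1, Real.sqrt_mul hs1.le, Real.sqrt_mul hs1.le]
  unfold periodKernel
  rw [Real.rpow_neg hηp.le, neg_div, Real.rpow_neg ht0.le, Real.rpow_neg hB.le,
    ← Real.sqrt_eq_rpow, ← Real.sqrt_eq_rpow]
  have q1 : √(1 - s) * √(1 - s) = 1 - s := Real.mul_self_sqrt hs1.le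
  have q2 : 0 < √(1 - s) := Real.sqrt_pos.2 hs1
  have q3 : 0 < √t := Real.sqrt_pos.2 ht0
  have q4 : 0 < √(t + (1 - t) * P (relLevel (1 - α / 2) s t)) := Real.sqrt_pos.2 hB
  -- The numerator 1 - s coming from the velocity is split into two square roots, one cancelling
  -- against √(1 - η), the other against cos(πy).
  nth_rewrite 1 [← q1]
  field_simp

theorem RatioInverse.setLIntegral_triangle (hφ : RatioInverse α φ P) (h0 : 0 < α) (h1 : α < 1)
    (hs : s ∈ Ioo (0 : ℝ) 1) (hint : IntegrableOn (fun t : ℝ => t ^ (-1 / 2 : ℝ) *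
        periodKernel (1 - α / 2) φ P s t) (Ioo 0 1)) :
    ∫⁻ x in levelSet (psi α) (s ^ (1 - α / 2)) ∩ triangle,
        (ENNReal.ofReal ‖gradient (psi α) x‖)⁻¹ ∂(Measure.hausdorffMeasure 1) =
      ENNReal.ofReal (1 / (2 * Real.pi ^ 2) * periodIntegral (1 - α / 2) φ P s) := by
  have hb : 0 < 1 - α / 2 := by linarith
  have hcd : ContDiffOn ℝ 1 (levelCurve (1 - α / 2) φ s) (Ioo 0 1) := fun t ht =>
    (hφ.contDiffAt_levelCurve h0 h1 hs ht).contDiffWithinAt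
  rw [← hφ.levelCurve_image h0 h1 hs, lintegral_image_hausdorffMeasure_one
    (c' := deriv (levelCurve (1 - α / 2) φ s))
    (fun t ht => (hφ.contDiffAt_levelCurve h0 h1 hs ht).hasStrictDerivAt (by simp))
    (hcd.continuousOn_deriv_of_isOpen isOpen_Ioo le_rfl) (levelCurve_injOn hs)
    (measurable_inv_norm_gradient _)]
  rw [setLIntegral_congr_fun measurableSet_Ioo fun t ht => hφ.speed_mul_inv_gradient h0 h1 hs ht]
  unfold periodIntegral
  rw [← integral_const_mul, ofReal_integral_eq_lintegral_ofReal (hint.const_mul _)]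
  filter_upwards [ae_restrict_mem measurableSet_Ioo] with t ht
  have hw := relLevel_mem_unit hb hs ht
  have h3 := hφ.quot_pos _ hw
  have h4 := hφ.deriv_pos _ hw
  have h5 := lerp_pos hs.1 ht
  have h6 := ht.1
  have h7 : 0 < 1 - t := by linarith [ht.2]
  unfold periodKernel
  simp only [Pi.zero_apply]
  positivity

end

/-! ### Symmetries of the square and reduction to one triangle. -/

theorem isometry_of_coord {f : Plane → Plane}
    (h : ∀ x y, (f x 0 - f y 0) ^ 2 + (f x 1 - f y 1) ^ 2 = (x 0 - y 0) ^ 2 + (x 1 - y 1) ^ 2) :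
    Isometry f := by
  refine Isometry.of_dist_eq fun x y => ?_
  simp only [EuclideanSpace.dist_eq, Fin.sum_univ_two, Real.dist_eq, sq_abs, h]

/-- The reflection `x ↦ 1 - x`. -/
def flipX : Plane ≃ᵢ Plane where
  toEquiv := Function.Involutive.toPerm (fun x => !₂[1 - x 0, x 1]) fun x => by
    ext i; fin_cases i <;> simp
  isometry_toFun := isometry_of_coord fun x y => by
    change (1 - x 0 - (1 - y 0)) ^ 2 + (x 1 - y 1) ^ 2 = _; ring

/-- The reflection `y ↦ 1 - y`. -/
def flipY : Plane ≃ᵢ Plane where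
  toEquiv := Function.Involutive.toPerm (fun x => !₂[x 0, 1 - x 1]) fun x => by
    ext i; fin_cases i <;> simp
  isometry_toFun := isometry_of_coord fun x y => by
    change (x 0 - y 0) ^ 2 + (1 - x 1 - (1 - y 1)) ^ 2 = _; ring

/-- The reflection in the diagonal. -/
def swapXY : Plane ≃ᵢ Plane where
  toEquiv := Function.Involutive.toPerm (fun x => !₂[x 1, x 0]) fun x => by
    ext i; fin_cases i <;> simp
  isometry_toFun := isometry_of_coord fun x y => by
    change (x 1 - y 1) ^ 2 + (x 0 - y 0) ^ 2 = _; ring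

@[simp] theorem flipX_zero (x : Plane) : flipX x 0 = 1 - x 0 := rfl
@[simp] theorem flipX_one (x : Plane) : flipX x 1 = x 1 := rfl
@[simp] theorem flipY_zero (x : Plane) : flipY x 0 = x 0 := rfl
@[simp] theorem flipY_one (x : Plane) : flipY x 1 = 1 - x 1 := rfl
@[simp] theorem swapXY_zero (x : Plane) : swapXY x 0 = x 1 := rfl
@[simp] theorem swapXY_one (x : Plane) : swapXY x 1 = x 0 := rfl

theorem sin_pi_mul_one_sub (a : ℝ) : Real.sin (Real.pi * (1 - a)) = Real.sin (Real.pi * a) := by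
  rw [mul_sub, mul_one, Real.sin_pi_sub]

theorem psi_flipX (α : ℝ) (x : Plane) : psi α (flipX x) = psi α x := by
  simp [psi, sin_pi_mul_one_sub]

theorem psi_flipY (α : ℝ) (x : Plane) : psi α (flipY x) = psi α x := by
  simp [psi, sin_pi_mul_one_sub]

theorem psi_swapXY (α : ℝ) (x : Plane) : psi α (swapXY x) = psi α x := by
  simp [psi, mul_comm, add_comm]

theorem mem_Q_iff {x : Plane} : x ∈ Q ↔ x 0 ∈ Ioo (0 : ℝ) 1 ∧ x 1 ∈ Ioo (0 : ℝ) 1 := by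
  simp [Q, Fin.forall_fin_two]

theorem flipX_mem_Q {x : Plane} : flipX x ∈ Q ↔ x ∈ Q := by
  simp only [mem_Q_iff, flipX_zero, flipX_one, mem_Ioo]
  constructor <;> rintro ⟨⟨_, _⟩, _, _⟩ <;> refine ⟨⟨?_, ?_⟩, ?_, ?_⟩ <;> linarith

theorem flipY_mem_Q {x : Plane} : flipY x ∈ Q ↔ x ∈ Q := by
  simp only [mem_Q_iff, flipY_zero, flipY_one, mem_Ioo]
  constructor <;> rintro ⟨⟨_, _⟩, _, _⟩ <;> refine ⟨⟨?_, ?_⟩, ?_, ?_⟩ <;> linarith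

theorem swapXY_mem_Q {x : Plane} : swapXY x ∈ Q ↔ x ∈ Q := by
  simp only [mem_Q_iff, swapXY_zero, swapXY_one]
  exact and_comm

theorem norm_gradient_psi_comp {α : ℝ} (R : Plane ≃ᵢ Plane) (hψ : ∀ x, psi α (R x) = psi α x)
    {x : Plane} (hx : R x ∈ Q) : ‖gradient (psi α) (R x)‖ = ‖gradient (psi α) x‖ := by
  rw [← norm_gradient_comp_isometryEquiv R
    ((contDiffAt_psi (n := 1) hx).differentiableAt (by simp))]
  simp_rw [hψ]

theorem strictMonoOn_ratioFun {α : ℝ} (h0 : 0 < α) (h1 : α < 1) :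
    StrictMonoOn (ratioFun α) (Ioi 0) := by
  refine strictMonoOn_of_deriv_pos (convex_Ioi 0) (fun x hx => ?_) fun x hx => ?_
  · exact (contDiffAt_ratioFun (n := 0) (by linarith [mem_Ioi.1 hx])).continuousAt.continuousWithinAt
  · rw [interior_Ioi] at hx
    exact deriv_ratioFun_pos h0 h1 (by linarith [mem_Ioi.1 hx])

/-- For fixed u > 0 the stream function is strictly increasing in v, because R is. Hence level sets
meet the axes of symmetry in finitely many points, which carry no arc length. -/
theorem sinPi_one_eq_of_psi_eq {α : ℝ} (h0 : 0 < α) (h1 : α < 1) {x y : Plane} (hx : x ∈ Q)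
    (hy : y ∈ Q) (hψ : psi α x = psi α y) (h : sinPi x 0 = sinPi y 0) : sinPi x 1 = sinPi y 1 := by
  have hu := sinPi_pos hy 0
  have a := sinPi_pos hx 1
  have b := sinPi_pos hy 1
  rw [psi_eq_ray (sinPi_pos hx 0) a, psi_eq_ray hu b, h] at hψ
  have h2 := mul_left_cancel₀ (by positivity) hψ
  have h3 := (strictMonoOn_ratioFun h0 h1).injOn (mem_Ioi.2 (by positivity))
    (mem_Ioi.2 (by positivity)) h2
  rwa [div_left_inj' hu.ne'] at h3

theorem sinPi_swapXY_zero (x : Plane) : sinPi (swapXY x) 0 = sinPi x 1 := by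
  unfold sinPi; rw [swapXY_zero]

theorem sinPi_swapXY_one (x : Plane) : sinPi (swapXY x) 1 = sinPi x 0 := by
  unfold sinPi; rw [swapXY_one]

theorem sinPi_zero_eq_of_psi_eq {α : ℝ} (h0 : 0 < α) (h1 : α < 1) {x y : Plane} (hx : x ∈ Q)
    (hy : y ∈ Q) (hψ : psi α x = psi α y) (h : sinPi x 1 = sinPi y 1) : sinPi x 0 = sinPi y 0 := by
  have h2 := sinPi_one_eq_of_psi_eq h0 h1 (swapXY_mem_Q.2 hx) (swapXY_mem_Q.2 hy)
    (by rw [psi_swapXY, psi_swapXY, hψ]) (by rw [sinPi_swapXY_zero, sinPi_swapXY_zero, h])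
  rwa [sinPi_swapXY_one, sinPi_swapXY_one] at h2

theorem injOn_sin_pi_lower : InjOn (fun a : ℝ => Real.sin (Real.pi * a)) (Icc 0 (1 / 2)) := by
  intro a ha b hb h
  have := Real.pi_pos
  have h2 := Real.injOn_sin ⟨by nlinarith [ha.1], by nlinarith [ha.2]⟩
    ⟨by nlinarith [hb.1], by nlinarith [hb.2]⟩ h
  exact mul_left_cancel₀ this.ne' h2

theorem injOn_sin_pi_upper : InjOn (fun a : ℝ => Real.sin (Real.pi * a)) (Icc (1 / 2) 1) := by
  intro a ha b hb h
  have h2 : 1 - a = 1 - b := injOn_sin_pi_lower ⟨by linarith [ha.2], by linarith [ha.1]⟩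
    ⟨by linarith [hb.2], by linarith [hb.1]⟩
    (by simpa only [sin_pi_mul_one_sub] using h)
  linarith

theorem psi_diagonal {α : ℝ} {x : Plane} (hx : x ∈ Q) (h : x 0 = x 1) :
    psi α x = (sinPi x 0 ^ 2) ^ (1 - α / 2) := by
  have hu := sinPi_pos hx 0
  have e : sinPi x 1 = sinPi x 0 := by unfold sinPi; rw [h]
  rw [psi_eq_ray hu (sinPi_pos hx 1), e, div_self hu.ne', ratioFun_one, mul_one]

theorem plane_ext {x y : Plane} (h0 : x 0 = y 0) (h1 : x 1 = y 1) : x = y := by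
  ext i; fin_cases i
  · exact h0
  · exact h1

theorem measurable_psi (α : ℝ) : Measurable (psi α) := by
  unfold psi; fun_prop

theorem measurableSet_levelSet_psi (α r : ℝ) : MeasurableSet (levelSet (psi α) r) :=
  isOpen_Q.measurableSet.inter (measurable_psi α (measurableSet_singleton r))

theorem hausdorffMeasure_subsingleton {s : Set Plane} (hs : s.Subsingleton) :
    Measure.hausdorffMeasure 1 s = 0 := by
  have := Measure.nullSingletonClass_hausdorff Plane (d := 1) one_pos
  exact hs.measure_zero _

theorem measurableSet_lt_half (i : Fin 2) : MeasurableSet {x : Plane | x i < 1 / 2} :=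
  measurableSet_lt (by fun_prop) measurable_const

/-- The traversal time of a level set is eight times the contribution of a fundamental triangle. -/
theorem period_psi_eq {α r : ℝ} (h0 : 0 < α) (h1 : α < 1) :
    period (psi α) r = 8 * ∫⁻ x in levelSet (psi α) r ∩ triangle,
        (ENNReal.ofReal ‖gradient (psi α) x‖)⁻¹ ∂(Measure.hausdorffMeasure 1) := by
  set A₀ := levelSet (psi α) r with hA₀
  set A₁ := A₀ ∩ {x | x 0 < 1 / 2} with hA₁
  set A₂ := A₁ ∩ {x | x 1 < 1 / 2} with hA₂
  have m0 : MeasurableSet A₀ := measurableSet_levelSet_psi α r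
  have m1 : MeasurableSet A₁ := m0.inter (measurableSet_lt_half 0)
  have m2 : MeasurableSet A₂ := m1.inter (measurableSet_lt_half 1)
  have grad : ∀ (R : Plane ≃ᵢ Plane), (∀ x, psi α (R x) = psi α x) → (∀ x, R x ∈ Q ↔ x ∈ Q) →
      ∀ x ∈ A₀, (ENNReal.ofReal ‖gradient (psi α) (R x)‖)⁻¹ =
        (ENNReal.ofReal ‖gradient (psi α) x‖)⁻¹ := fun R hR hQ x hx => by
    rw [norm_gradient_psi_comp R hR ((hQ x).2 hx.1)]
  have inv : ∀ (R : Plane ≃ᵢ Plane), (∀ x, psi α (R x) = psi α x) → (∀ x, R x ∈ Q ↔ x ∈ Q) →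
      R ⁻¹' A₀ = A₀ := fun R hR hQ => by
    ext x; simp only [hA₀, levelSet, mem_preimage, mem_ofPred_eq, hR, hQ]
  -- first reflection
  have n0 : Measure.hausdorffMeasure 1 (A₀ ∩ {x | x 0 = 1 / 2}) = 0 := by
    have hsplit : A₀ ∩ {x | x 0 = 1 / 2} ⊆ (A₀ ∩ {x | x 0 = 1 / 2} ∩ {x | x 1 ≤ 1 / 2}) ∪
        (A₀ ∩ {x | x 0 = 1 / 2} ∩ {x | 1 / 2 ≤ x 1}) := fun x hx => by
      rcases le_total (x 1) (1 / 2) with h | h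
      · exact Or.inl ⟨hx, h⟩
      · exact Or.inr ⟨hx, h⟩
    have key : ∀ x ∈ A₀ ∩ {x | x 0 = 1 / 2}, ∀ y ∈ A₀ ∩ {x | x 0 = 1 / 2},
        sinPi x 1 = sinPi y 1 := by
      rintro x ⟨⟨hx, hxr⟩, hx2⟩ y ⟨⟨hy, hyr⟩, hy2⟩
      refine sinPi_one_eq_of_psi_eq h0 h1 hx hy (hxr.trans hyr.symm) ?_
      rw [mem_ofPred_eq] at hx2 hy2
      unfold sinPi; rw [hx2, hy2]
    refine measure_mono_null hsplit (measure_union_null ?_ ?_) <;>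
      refine hausdorffMeasure_subsingleton ?_ <;> rintro x ⟨hx, hx3⟩ y ⟨hy, hy3⟩ <;>
      refine plane_ext (hx.2.trans hy.2.symm) ?_
    · exact injOn_sin_pi_lower ⟨(hx.1.1 1).1.le, hx3⟩ ⟨(hy.1.1 1).1.le, hy3⟩ (key x hx y hy)
    · exact injOn_sin_pi_upper ⟨hx3, (hx.1.1 1).2.le⟩ ⟨hy3, (hy.1.1 1).2.le⟩ (key x hx y hy)
  have e0 := setLIntegral_eq_two_mul flipX (f := fun x => (ENNReal.ofReal ‖gradient (psi α) x‖)⁻¹)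
    m0 (measurableSet_lt_half 0) (inv flipX (psi_flipX α) fun _ => flipX_mem_Q)
    (grad flipX (psi_flipX α) fun _ => flipX_mem_Q)
    (fun x _ hx => by simp only [mem_ofPred_eq, flipX_zero] at hx ⊢; linarith)
    (fun x _ => by
      simp only [mem_ofPred_eq, flipX_zero]
      rcases lt_trichotomy (x 0) (1 / 2) with h | h | h
      · exact Or.inl h
      · exact Or.inr (Or.inr h)
      · exact Or.inr (Or.inl (by linarith))) n0
  -- second reflection
  have n1 : Measure.hausdorffMeasure 1 (A₁ ∩ {x | x 1 = 1 / 2}) = 0 := by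
    refine hausdorffMeasure_subsingleton ?_
    rintro x ⟨⟨⟨hx, hxr⟩, hx2⟩, hx3⟩ y ⟨⟨⟨hy, hyr⟩, hy2⟩, hy3⟩
    rw [mem_ofPred_eq] at hx2 hx3 hy2 hy3
    refine plane_ext ?_ (hx3.trans hy3.symm)
    refine injOn_sin_pi_lower ⟨(hx 0).1.le, hx2.le⟩ ⟨(hy 0).1.le, hy2.le⟩ ?_
    refine sinPi_zero_eq_of_psi_eq h0 h1 hx hy (hxr.trans hyr.symm) ?_
    unfold sinPi; rw [hx3, hy3]
  have e1 := setLIntegral_eq_two_mul flipY (f := fun x => (ENNReal.ofReal ‖gradient (psi α) x‖)⁻¹)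
    m1 (measurableSet_lt_half 1)
    (by rw [hA₁, preimage_inter, inv flipY (psi_flipY α) fun _ => flipY_mem_Q]; rfl)
    (fun x hx => grad flipY (psi_flipY α) (fun _ => flipY_mem_Q) x hx.1)
    (fun x _ hx => by simp only [mem_ofPred_eq, flipY_one] at hx ⊢; linarith)
    (fun x _ => by
      simp only [mem_ofPred_eq, flipY_one]
      rcases lt_trichotomy (x 1) (1 / 2) with h | h | h
      · exact Or.inl h
      · exact Or.inr (Or.inr h)
      · exact Or.inr (Or.inl (by linarith))) n1
  -- third reflection
  have n2 : Measure.hausdorffMeasure 1 (A₂ ∩ {x | x 0 = x 1}) = 0 := by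
    refine hausdorffMeasure_subsingleton ?_
    rintro x ⟨⟨⟨⟨hx, hxr⟩, hx2⟩, -⟩, hx4⟩ y ⟨⟨⟨⟨hy, hyr⟩, hy2⟩, -⟩, hy4⟩
    rw [mem_ofPred_eq] at hx2 hx4 hy2 hy4
    have h3 : x 0 = y 0 := by
      refine injOn_sin_pi_lower ⟨(hx 0).1.le, hx2.le⟩ ⟨(hy 0).1.le, hy2.le⟩ ?_
      have h5 := hxr.trans hyr.symm
      rw [psi_diagonal hx hx4, psi_diagonal hy hy4] at h5
      have hu := sinPi_pos hx 0
      have hv := sinPi_pos hy 0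
      rw [Real.rpow_left_inj (by positivity) (by positivity) (by linarith)] at h5
      exact (sq_eq_sq₀ hu.le hv.le).1 h5
    exact plane_ext h3 (by rw [← hx4, ← hy4, h3])
  have e2 := setLIntegral_eq_two_mul swapXY (H := {x | x 1 < x 0})
    (f := fun x => (ENNReal.ofReal ‖gradient (psi α) x‖)⁻¹)
    m2 (measurableSet_lt (by fun_prop) (by fun_prop))
    (by
      rw [hA₂, hA₁, preimage_inter, preimage_inter, inv swapXY (psi_swapXY α) fun _ => swapXY_mem_Q]
      ext x
      simp only [mem_inter_iff, mem_preimage, mem_ofPred_eq, swapXY_zero, swapXY_one]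
      tauto)
    (fun x hx => grad swapXY (psi_swapXY α) (fun _ => swapXY_mem_Q) x hx.1.1)
    (fun x _ hx => by simp only [mem_ofPred_eq, swapXY_zero, swapXY_one] at hx ⊢; linarith)
    (fun x _ => by
      simp only [mem_ofPred_eq, swapXY_zero, swapXY_one]
      rcases lt_trichotomy (x 1) (x 0) with h | h | h
      · exact Or.inl h
      · exact Or.inr (Or.inr h.symm)
      · exact Or.inr (Or.inl h)) n2
  have hset : A₂ ∩ {x | x 1 < x 0} = A₀ ∩ triangle := by
    ext x
    simp only [hA₂, hA₁, triangle, mem_inter_iff, mem_ofPred_eq]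
    constructor
    · rintro ⟨⟨⟨a, b⟩, c⟩, d⟩; exact ⟨a, d, b⟩
    · rintro ⟨a, d, b⟩; exact ⟨⟨⟨a, b⟩, d.trans b⟩, d⟩
  rw [hset] at e2
  unfold period
  rw [e0, e1, e2, ← mul_assoc, ← mul_assoc]
  norm_num

/-! ### The traversal time as a function of the level. -/

/-- `T` extends the traversal time of `psi α` to a `C²` function on `(0, r₁)`, with the stated
bounds near `0`. -/
structure PeriodProfile (α r₁ C : ℝ) (T T₁ T₂ : ℝ → ℝ) : Prop where
  one_lt : 1 < r₁
  nonneg : 0 ≤ C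
  period_eq : ∀ r ∈ Ioo (0 : ℝ) 1, period (psi α) r = ENNReal.ofReal (T r)
  pos : ∀ r ∈ Ioo 0 r₁, 0 < T r
  hasDerivAt : ∀ r ∈ Ioo 0 r₁, HasDerivAt T (T₁ r) r
  hasDerivAt₁ : ∀ r ∈ Ioo 0 r₁, HasDerivAt T₁ (T₂ r) r
  continuousOn₂ : ContinuousOn T₂ (Ioo 0 r₁)
  le : ∀ r ∈ Ioo 0 r₁, T r ≤ C
  le₁ : ∀ r ∈ Ioo 0 r₁, |T₁ r| ≤ C * r ^ (-((2 - 2 * α) / (2 - α)))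
  le₂ : ∀ r ∈ Ioo 0 r₁, |T₂ r| ≤ C * r ^ (-((2 - 2 * α) / (2 - α)) - 1)

/-- Substitute s = r^(1/b) in the integral formula. With k = 1/b the bounds s^(-b) and s^(-b-1)
become r^(-1) and r^(-1-k), and the chain rule contributes powers of r^(k-1). The prefactor 4/π² is
eight triangles times 1/(2π²). -/
theorem exists_periodProfile {α : ℝ} (h0 : 0 < α) (h1 : α < 1) :
    ∃ r₁ C T T₁ T₂, PeriodProfile α r₁ C T T₁ T₂ := by
  obtain ⟨φ, P, hRI, s₁, hs₁, I₁, I₂, hint, hpos, hI, hI₁, hI₂, C, hC⟩ := exists_ratioInverse h0 h1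
  set I := periodIntegral (1 - α / 2) φ P with hIdef
  set b := 1 - α / 2 with hb
  have hb0 : 0 < b := by rw [hb]; linarith
  set k := 1 / b with hk
  have hbk : b * k = 1 := by rw [hk]; field_simp
  have hk0 : 0 < k := by positivity
  -- The exponent arises as (-1) + (k - 1), with k = 2/(2-α).
  have hκ : -((2 - 2 * α) / (2 - α)) = k - 2 := by
    have : 2 - α ≠ 0 := by linarith
    rw [hk, hb]; field_simp; ring
  have hC0 : 0 ≤ C := (abs_nonneg _).trans (hC 1 ⟨one_pos, hs₁⟩).1
  set c : ℝ := 4 / Real.pi ^ 2 with hc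
  have hc0 : 0 < c := by have := Real.pi_pos; positivity
  have hmem : ∀ r ∈ Ioo 0 (s₁ ^ b), r ^ k ∈ Ioo 0 s₁ := fun r hr => by
    refine ⟨Real.rpow_pos_of_pos hr.1 _, ?_⟩
    have := Real.rpow_lt_rpow hr.1.le hr.2 hk0
    rwa [← Real.rpow_mul (by linarith), hbk, Real.rpow_one] at this
  have hpow : ∀ r : ℝ, 0 < r → ∀ l : ℝ, HasDerivAt (fun x : ℝ => x ^ l) (l * r ^ (l - 1)) r :=
    fun r hr l => Real.hasDerivAt_rpow_const (Or.inl hr.ne')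
  set A := c * C * k with hA
  set B := c * C * (k * k + |k * (k - 1)|) with hB
  have hA0 : 0 ≤ A := by positivity
  have hB0 : 0 ≤ B := by positivity
  have hle1 : ∀ r ∈ Ioo 0 (s₁ ^ b), |I₁ (r ^ k)| ≤ C * r ^ (-1 : ℝ) := fun r hr => by
    have := (hC _ (hmem r hr)).2.1
    rwa [← Real.rpow_mul hr.1.le, show k * -b = -1 by linarith] at this
  have hle2 : ∀ r ∈ Ioo 0 (s₁ ^ b), |I₂ (r ^ k)| ≤ C * r ^ (-1 - k) := fun r hr => by
    have := (hC _ (hmem r hr)).2.2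
    rwa [← Real.rpow_mul hr.1.le, show k * (-b - 1) = -1 - k by linarith] at this
  refine ⟨s₁ ^ b, c * C + A + B, fun r => c * I (r ^ k),
    fun r => c * (I₁ (r ^ k) * (k * r ^ (k - 1))),
    fun r => c * (I₂ (r ^ k) * (k * r ^ (k - 1)) * (k * r ^ (k - 1)) +
      I₁ (r ^ k) * (k * ((k - 1) * r ^ (k - 1 - 1)))), ?_⟩
  refine ⟨Real.one_lt_rpow hs₁ hb0, by positivity, fun r hr => ?_, fun r hr => ?_, fun r hr => ?_,
    fun r hr => ?_, ?_, fun r hr => ?_, fun r hr => ?_, fun r hr => ?_⟩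
  · have hs : r ^ k ∈ Ioo (0 : ℝ) 1 :=
      ⟨Real.rpow_pos_of_pos hr.1 _, Real.rpow_lt_one hr.1.le hr.2 hk0⟩
    have e : (r ^ k) ^ b = r := by
      rw [← Real.rpow_mul hr.1.le, mul_comm, hbk, Real.rpow_one]
    have := hRI.setLIntegral_triangle h0 h1 hs (hint _ ⟨hs.1, hs.2.trans hs₁⟩)
    rw [e] at this
    rw [period_psi_eq h0 h1, this, ← hIdef, show (8 : ℝ≥0∞) = ENNReal.ofReal 8 by norm_num,
      ← ENNReal.ofReal_mul (by norm_num), hc]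
    congr 1; ring
  · exact mul_pos hc0 (hpos _ (hmem r hr))
  · exact ((hI _ (hmem r hr)).comp r (hpow r hr.1 k)).const_mul c
  · exact (((hI₁ _ (hmem r hr)).comp r (hpow r hr.1 k)).mul
      ((hpow r hr.1 (k - 1)).const_mul k)).const_mul c
  · have hcont : ∀ l : ℝ, ContinuousOn (fun r : ℝ => r ^ l) (Ioo 0 (s₁ ^ b)) := fun l =>
      continuousOn_id.rpow_const fun r hr => Or.inl (ne_of_gt hr.1)
    have c2 : ContinuousOn (fun r : ℝ => I₂ (r ^ k)) (Ioo 0 (s₁ ^ b)) :=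
      hI₂.comp (hcont k) fun r hr => hmem r hr
    have c1 : ContinuousOn (fun r : ℝ => I₁ (r ^ k)) (Ioo 0 (s₁ ^ b)) :=
      ContinuousOn.comp (t := Ioo 0 s₁)
        (fun s hs => (hI₁ s hs).continuousAt.continuousWithinAt) (hcont k) fun r hr => hmem r hr
    have d1 := continuousOn_const (c := k) |>.mul (hcont (k - 1))
    exact continuousOn_const.mul (((c2.mul d1).mul d1).add (c1.mul
      (continuousOn_const.mul (continuousOn_const.mul (hcont (k - 1 - 1))))))
  · have := (le_abs_self _).trans (hC _ (hmem r hr)).1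
    have : c * I (r ^ k) ≤ c * C := by gcongr
    linarith
  · rw [hκ, abs_mul, abs_mul, abs_mul, abs_of_pos hc0, abs_of_pos hk0,
      abs_of_pos (Real.rpow_pos_of_pos hr.1 _)]
    have h3 := Real.rpow_pos_of_pos hr.1 (k - 1)
    have h5 := Real.rpow_pos_of_pos hr.1 (k - 2)
    calc c * (|I₁ (r ^ k)| * (k * r ^ (k - 1)))
        ≤ c * ((C * r ^ (-1 : ℝ)) * (k * r ^ (k - 1))) := by gcongr; exact hle1 r hr
      _ = A * r ^ (k - 2) := by
          rw [show k - 2 = -1 + (k - 1) by ring, Real.rpow_add hr.1, hA]; ring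
      _ ≤ _ := by gcongr; have : 0 ≤ c * C := by positivity
                  linarith
  · rw [hκ, abs_mul, abs_of_pos hc0]
    have h3 := Real.rpow_pos_of_pos hr.1 (k - 1)
    have h4 := Real.rpow_pos_of_pos hr.1 (k - 1 - 1)
    have h5 := Real.rpow_pos_of_pos hr.1 (k - 2 - 1)
    calc c * |I₂ (r ^ k) * (k * r ^ (k - 1)) * (k * r ^ (k - 1)) +
          I₁ (r ^ k) * (k * ((k - 1) * r ^ (k - 1 - 1)))|
        ≤ c * ((C * r ^ (-1 - k)) * (k * r ^ (k - 1)) * (k * r ^ (k - 1)) +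
          (C * r ^ (-1 : ℝ)) * (|k * (k - 1)| * r ^ (k - 1 - 1))) := by
          gcongr
          refine (abs_add_le _ _).trans (add_le_add ?_ ?_)
          · rw [abs_mul, abs_mul, abs_of_pos (by positivity : 0 < k * r ^ (k - 1))]
            gcongr; exact hle2 r hr
          · rw [abs_mul, ← mul_assoc k, abs_mul (k * (k - 1)), abs_of_pos h4]
            gcongr; exact hle1 r hr
      _ = B * r ^ (k - 2 - 1) := by
          have e1 : r ^ (k - 2 - 1) = r ^ (-1 : ℝ) * r ^ (k - 1 - 1) := by
            rw [← Real.rpow_add hr.1]; congr 1; ring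
          have e2 : r ^ (k - 2 - 1) = r ^ (-1 - k) * r ^ (k - 1) * r ^ (k - 1) := by
            rw [← Real.rpow_add hr.1, ← Real.rpow_add hr.1]; congr 1; ring
          rw [hB]
          linear_combination -(c * C * k * k) * e2 - (c * C * |k * (k - 1)|) * e1
      _ ≤ _ := by gcongr; have : 0 ≤ c * C := by positivity
                  linarith

/-! ### The stream function on the closed square. -/

theorem closure_Q : closure Q = {x : Plane | ∀ i, x i ∈ Icc (0 : ℝ) 1} := by
  have e : Q = (EuclideanSpace.equiv (Fin 2) ℝ).toHomeomorph ⁻¹'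
      (Set.univ.pi fun _ => Ioo (0 : ℝ) 1) := by
    ext x; simp [Q, Set.mem_pi]
  rw [e, ← Homeomorph.preimage_closure, closure_pi_set]
  simp only [closure_Ioo (zero_ne_one (α := ℝ))]
  ext x
  exact ⟨fun h i => h i (mem_univ i), fun h i _ => h i⟩

theorem sinPi_nonneg {x : Plane} (hx : x ∈ closure Q) (i : Fin 2) : 0 ≤ sinPi x i := by
  rw [closure_Q] at hx
  have := Real.pi_pos
  exact Real.sin_nonneg_of_nonneg_of_le_pi (by have := (hx i).1; positivity)
    (by nlinarith [(hx i).2])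

theorem psi_nonneg {α : ℝ} {x : Plane} (hx : x ∈ closure Q) : 0 ≤ psi α x := by
  have h0 := sinPi_nonneg hx 0
  have h1 := sinPi_nonneg hx 1
  rw [psi_eq]; positivity

/-- By the arithmetic-geometric mean inequality psi ≤ ((u+v)/2)^(2-α), and the base is at most 1
while the exponent exceeds 1. This gives both psi ≤ 1 and continuity at the corners, where the
quotient is 0/0. -/
theorem psi_le_mean {α : ℝ} (hα : 0 < α) (hα1 : α < 1) {x : Plane} (hx : x ∈ closure Q) :
    psi α x ≤ (sinPi x 0 + sinPi x 1) / 2 := by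
  have h0 := sinPi_nonneg hx 0
  have h1 := sinPi_nonneg hx 1
  have l0 := sinPi_le_one x 0
  have l1 := sinPi_le_one x 1
  rw [psi_eq]
  rcases (add_nonneg h0 h1).eq_or_lt with h | h
  · have e0 : sinPi x 0 = 0 := by linarith
    rw [e0]; simp; positivity
  · rw [div_le_iff₀ (by positivity)]
    set u := sinPi x 0
    set v := sinPi x 1
    have e : (u + v) ^ α = 2 ^ α * ((u + v) / 2) ^ α := by
      rw [← Real.mul_rpow (by norm_num) (by positivity)]; congr 1; ring
    have h3 : (u + v) / 2 ≤ ((u + v) / 2) ^ α := by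
      conv_lhs => rw [← Real.rpow_one ((u + v) / 2)]
      exact Real.rpow_le_rpow_of_exponent_ge (by positivity) (by linarith) hα1.le
    have h5 : (0 : ℝ) < 2 ^ α := by positivity
    have h6 : u * v ≤ (u + v) / 2 * ((u + v) / 2) ^ α := by nlinarith [sq_nonneg (u - v)]
    rw [e]
    calc 2 ^ α * (u * v) ≤ 2 ^ α * ((u + v) / 2 * ((u + v) / 2) ^ α) := by gcongr
      _ = _ := by ring

theorem psi_pos {α : ℝ} {x : Plane} (hx : x ∈ Q) : 0 < psi α x := by
  have h0 := sinPi_pos hx 0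
  have h1 := sinPi_pos hx 1
  rw [psi_eq]; positivity

theorem psi_le_one {α : ℝ} (hα : 0 < α) (hα1 : α < 1) {x : Plane} (hx : x ∈ closure Q) :
    psi α x ≤ 1 :=
  (psi_le_mean hα hα1 hx).trans (by linarith [sinPi_le_one x 0, sinPi_le_one x 1])

theorem psi_frontier {α : ℝ} {x : Plane} (hx : x ∈ frontier Q) : psi α x = 0 := by
  rw [isOpen_Q.frontier_eq, closure_Q] at hx
  obtain ⟨h, hn⟩ := hx
  have : ∃ i, sinPi x i = 0 := by
    by_contra! hne
    refine hn fun i => ⟨(h i).1.lt_of_ne fun h0 => hne i ?_, (h i).2.lt_of_ne fun h1 => hne i ?_⟩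
    · unfold sinPi; rw [← h0]; simp
    · unfold sinPi; rw [h1]; simp
  obtain ⟨i, hi⟩ := this
  rw [psi_eq]
  fin_cases i
  · simp at hi; simp [hi]
  · simp at hi; simp [hi]

theorem continuousOn_psi {α : ℝ} (hα : 0 < α) (hα1 : α < 1) : ContinuousOn (psi α) (closure Q) := by
  intro x hx
  have c : ∀ i, Continuous fun x : Plane => sinPi x i := fun i =>
    (contDiff_sinPi (n := 0) i).continuous
  have h0 := sinPi_nonneg hx 0
  have h1 := sinPi_nonneg hx 1
  rcases (add_nonneg h0 h1).eq_or_lt with h | h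
  · have e : psi α x = 0 := le_antisymm ((psi_le_mean hα hα1 hx).trans (by linarith)) (psi_nonneg hx)
    have ht : Tendsto (fun y : Plane => (sinPi y 0 + sinPi y 1) / 2) (𝓝[closure Q] x) (𝓝 0) := by
      have h3 : Continuous fun y : Plane => (sinPi y 0 + sinPi y 1) / 2 :=
        ((c 0).add (c 1)).div_const 2
      have h5 := (h3.tendsto x).mono_left (nhdsWithin_le_nhds (s := closure Q))
      rwa [← h, zero_div] at h5
    rw [ContinuousWithinAt, e]
    refine squeeze_zero' ?_ ?_ ht
    · filter_upwards [self_mem_nhdsWithin] with y hy using psi_nonneg hy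
    · filter_upwards [self_mem_nhdsWithin] with y hy using psi_le_mean hα hα1 hy
  · refine ContinuousAt.continuousWithinAt ?_
    have := c 0
    have := c 1
    refine ContinuousAt.div (by fun_prop) ?_ (Real.rpow_pos_of_pos h _).ne'
    exact ContinuousAt.rpow_const (f := fun y : Plane => sinPi y 0 + sinPi y 1)
      (by fun_prop) (Or.inl h.ne')

/-! ### Reparametrization by the primitive: level sets, positivity, unit traversal time. -/

section
variable {α r₁ C : ℝ} {T T₁ T₂ : ℝ → ℝ}

/-- The primitive of the traversal time. -/
noncomputable def primitive (T : ℝ → ℝ) (r : ℝ) : ℝ := ∫ t in (0 : ℝ)..r, T t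

namespace PeriodProfile

theorem continuousOn (h : PeriodProfile α r₁ C T T₁ T₂) : ContinuousOn T (Ioo 0 r₁) :=
  fun r hr => (h.hasDerivAt r hr).continuousAt.continuousWithinAt

theorem integrableOn (h : PeriodProfile α r₁ C T T₁ T₂) : IntegrableOn T (Ioo 0 r₁) := by
  have hm := h.continuousOn.aestronglyMeasurable measurableSet_Ioo (μ := volume)
  refine Integrable.of_bound hm C ?_
  filter_upwards [ae_restrict_mem measurableSet_Ioo] with r hr
  rw [Real.norm_of_nonneg (h.pos r hr).le]
  exact h.le r hr

theorem intervalIntegrable (h : PeriodProfile α r₁ C T T₁ T₂) {r : ℝ} (hr : r ∈ Ico 0 r₁) :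
    IntervalIntegrable T volume 0 r := by
  rw [intervalIntegrable_iff_integrableOn_Ioc_of_le hr.1]
  exact h.integrableOn.mono_set fun t ht => ⟨ht.1, ht.2.trans_lt hr.2⟩

theorem hasDerivAt_primitive (h : PeriodProfile α r₁ C T T₁ T₂) {r : ℝ} (hr : r ∈ Ioo 0 r₁) :
    HasDerivAt (primitive T) (T r) r :=
  intervalIntegral.integral_hasDerivAt_right (h.intervalIntegrable ⟨hr.1.le, hr.2⟩)
    (h.continuousOn.stronglyMeasurableAtFilter isOpen_Ioo r hr)
    (h.continuousOn.continuousAt (isOpen_Ioo.mem_nhds hr))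

theorem continuousOn_primitive (h : PeriodProfile α r₁ C T T₁ T₂) :
    ContinuousOn (primitive T) (Icc 0 1) := by
  have := intervalIntegral.continuousOn_primitive_interval (μ := volume) (f := T) (a := 0) (b := 1) ?_
  · rwa [uIcc_of_le zero_le_one] at this
  · rw [uIcc_of_le zero_le_one, integrableOn_Icc_iff_integrableOn_Ioc]
    exact h.integrableOn.mono_set fun t ht => ⟨ht.1, ht.2.trans_lt h.one_lt⟩

theorem strictMonoOn_primitive (h : PeriodProfile α r₁ C T T₁ T₂) :
    StrictMonoOn (primitive T) (Icc 0 1) := by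
  refine strictMonoOn_of_deriv_pos (convex_Icc _ _) h.continuousOn_primitive fun r hr => ?_
  rw [interior_Icc] at hr
  have hr' : r ∈ Ioo 0 r₁ := ⟨hr.1, hr.2.trans h.one_lt⟩
  rw [(h.hasDerivAt_primitive hr').deriv]
  exact h.pos r hr'

theorem primitive_zero : primitive T 0 = 0 := intervalIntegral.integral_same

theorem lintegral_period (h : PeriodProfile α r₁ C T T₁ T₂) {r : ℝ} (hr : r ∈ Icc (0 : ℝ) 1) :
    ∫⁻ t in Ioo 0 r, period (psi α) t = ENNReal.ofReal (primitive T r) := by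
  have hsub : Ioo 0 r ⊆ Ioo 0 r₁ := Ioo_subset_Ioo_right (hr.2.trans h.one_lt.le)
  rw [primitive, intervalIntegral.integral_of_le hr.1, integral_Ioc_eq_integral_Ioo,
    ofReal_integral_eq_lintegral_ofReal (h.integrableOn.mono_set hsub)]
  · exact setLIntegral_congr_fun measurableSet_Ioo fun t ht =>
      h.period_eq t ⟨ht.1, ht.2.trans_le hr.2⟩
  · filter_upwards [ae_restrict_mem measurableSet_Ioo] with t ht using (h.pos t (hsub ht)).le

theorem primitive_nonneg (h : PeriodProfile α r₁ C T T₁ T₂) {r : ℝ} (hr : r ∈ Icc (0 : ℝ) 1) :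
    0 ≤ primitive T r := by
  rw [← primitive_zero (T := T)]
  exact h.strictMonoOn_primitive.monotoneOn ⟨le_rfl, zero_le_one⟩ hr hr.1

theorem psi_mem (h0 : 0 < α) (h1 : α < 1) {x : Plane} (hx : x ∈ closure Q) :
    psi α x ∈ Icc (0 : ℝ) 1 := ⟨psi_nonneg hx, psi_le_one h0 h1 hx⟩

theorem psiRe_eq (h : PeriodProfile α r₁ C T T₁ T₂) (h0 : 0 < α) (h1 : α < 1) {x : Plane}
    (hx : x ∈ closure Q) : psiRe α x = primitive T (psi α x) := by
  rw [psiRe, h.lintegral_period (psi_mem h0 h1 hx), ENNReal.toReal_ofReal]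
  exact h.primitive_nonneg (psi_mem h0 h1 hx)

/-- The primitive of the positive traversal time is strictly increasing on [0, 1], which contains
all values of `psi α`, so composing with it only relabels the levels. -/
theorem levelSet_psiRe (h : PeriodProfile α r₁ C T T₁ T₂) (h0 : 0 < α) (h1 : α < 1) {r : ℝ}
    (hr : r ∈ Icc (0 : ℝ) 1) : levelSet (psiRe α) (primitive T r) = levelSet (psi α) r := by
  ext x
  refine and_congr_right fun hx => ?_
  rw [h.psiRe_eq h0 h1 (subset_closure hx)]
  exact h.strictMonoOn_primitive.injOn.eq_iff (psi_mem h0 h1 (subset_closure hx)) hr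

theorem range_levelSet_psiRe (h : PeriodProfile α r₁ C T T₁ T₂) (h0 : 0 < α) (h1 : α < 1) :
    range (levelSet (psiRe α)) = range (levelSet (psi α)) := by
  refine Subset.antisymm ?_ ?_
  · rintro _ ⟨r, rfl⟩
    rcases (levelSet (psiRe α) r).eq_empty_or_nonempty with he | ⟨x, hx, rfl⟩
    -- An empty level set must also be realized; the value 2 is not attained since `psi α` is at
    -- most 1.
    · refine ⟨2, ?_⟩
      rw [he, eq_empty_iff_forall_notMem]
      rintro x ⟨hx, h2⟩
      linarith [psi_le_one h0 h1 (subset_closure hx)]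
    · rw [h.psiRe_eq h0 h1 (subset_closure hx),
        h.levelSet_psiRe h0 h1 (psi_mem h0 h1 (subset_closure hx))]
      exact mem_range_self _
  · rintro _ ⟨r, rfl⟩
    rcases (levelSet (psi α) r).eq_empty_or_nonempty with he | ⟨x, hx, rfl⟩
    · refine ⟨-1, ?_⟩
      rw [he, eq_empty_iff_forall_notMem]
      rintro x ⟨hx, h2⟩
      have : 0 ≤ psiRe α x := ENNReal.toReal_nonneg
      linarith
    · exact ⟨_, h.levelSet_psiRe h0 h1 (psi_mem h0 h1 (subset_closure hx))⟩

theorem psiRe_pos (h : PeriodProfile α r₁ C T T₁ T₂) (h0 : 0 < α) (h1 : α < 1) {x : Plane}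
    (hx : x ∈ Q) : 0 < psiRe α x := by
  rw [h.psiRe_eq h0 h1 (subset_closure hx), ← primitive_zero (T := T)]
  exact h.strictMonoOn_primitive ⟨le_rfl, zero_le_one⟩ (psi_mem h0 h1 (subset_closure hx))
    (psi_pos hx)

theorem continuousOn_psiRe (h : PeriodProfile α r₁ C T T₁ T₂) (h0 : 0 < α) (h1 : α < 1) :
    ContinuousOn (psiRe α) (closure Q) :=
  (h.continuousOn_primitive.comp (continuousOn_psi h0 h1) fun _ hx => psi_mem h0 h1 hx).congr
    fun _ hx => h.psiRe_eq h0 h1 hx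

theorem psiRe_frontier (h : PeriodProfile α r₁ C T T₁ T₂) (h0 : 0 < α) (h1 : α < 1) {x : Plane}
    (hx : x ∈ frontier Q) : psiRe α x = 0 := by
  rw [h.psiRe_eq h0 h1 (frontier_subset_closure hx), psi_frontier hx, primitive_zero]

theorem lintegral_period_ne_top (h : PeriodProfile α r₁ C T T₁ T₂) :
    ∫⁻ r in Ioo (0 : ℝ) 1, period (psi α) r ≠ ⊤ := by
  rw [h.lintegral_period ⟨zero_le_one, le_rfl⟩]
  exact ENNReal.ofReal_ne_top

theorem psi_mem_Ioo (h : PeriodProfile α r₁ C T T₁ T₂) (h0 : 0 < α) (h1 : α < 1) {x : Plane}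
    (hx : x ∈ Q) : psi α x ∈ Ioo 0 r₁ :=
  ⟨psi_pos hx, (psi_le_one h0 h1 (subset_closure hx)).trans_lt h.one_lt⟩

theorem hasFDerivAt_psiRe (h : PeriodProfile α r₁ C T T₁ T₂) (h0 : 0 < α) (h1 : α < 1) {x : Plane}
    (hx : x ∈ Q) : HasFDerivAt (psiRe α) (T (psi α x) • fderiv ℝ (psi α) x) x := by
  have h3 := (h.hasDerivAt_primitive (h.psi_mem_Ioo h0 h1 hx)).comp_hasFDerivAt x
    ((contDiffAt_psi (α := α) (n := 1) hx).differentiableAt (by simp)).hasFDerivAt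
  refine h3.congr_of_eventuallyEq ?_
  filter_upwards [isOpen_Q.mem_nhds hx] with y hy using h.psiRe_eq h0 h1 (subset_closure hy)

/-- A level below the supremum is the primitive at a unique ρ in (0, 1). On {psi = ρ} the gradient
is T(ρ) times that of psi, a constant factor, so the traversal time T(ρ) is divided by T(ρ). -/
theorem period_psiRe (h : PeriodProfile α r₁ C T T₁ T₂) (h0 : 0 < α) (h1 : α < 1) {r : ℝ}
    (hr : 0 < r) (hr1 : ENNReal.ofReal r < eLpNorm (psiRe α) ⊤ (volume.restrict Q)) :
    period (psiRe α) r = 1 := by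
  have hle : eLpNorm (psiRe α) ⊤ (volume.restrict Q) ≤ ENNReal.ofReal (primitive T 1) := by
    rw [eLpNorm_exponent_top]
    refine eLpNormEssSup_le_of_ae_bound ?_
    filter_upwards [ae_restrict_mem isOpen_Q.measurableSet] with x hx
    have hx' := subset_closure hx
    rw [Real.norm_of_nonneg (h.psiRe_pos h0 h1 hx).le, h.psiRe_eq h0 h1 hx']
    exact h.strictMonoOn_primitive.monotoneOn (psi_mem h0 h1 hx') ⟨zero_le_one, le_rfl⟩
      (psi_le_one h0 h1 hx')
  have hr2 : r < primitive T 1 := (ENNReal.ofReal_lt_ofReal_iff_of_nonneg hr.le).1 (hr1.trans_le hle)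
  obtain ⟨ρ, hρ, rfl⟩ := intermediate_value_Ioo zero_le_one h.continuousOn_primitive
    ⟨by rwa [primitive_zero], hr2⟩
  have hρ' : ρ ∈ Ioo 0 r₁ := ⟨hρ.1, hρ.2.trans h.one_lt⟩
  have hT := h.pos ρ hρ'
  have hT0 : ENNReal.ofReal (T ρ) ≠ 0 := by simpa using hT
  rw [period, h.levelSet_psiRe h0 h1 (Ioo_subset_Icc_self hρ)]
  have : ∫⁻ x in levelSet (psi α) ρ, (ENNReal.ofReal ‖gradient (psiRe α) x‖)⁻¹
        ∂(Measure.hausdorffMeasure 1) =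
      ∫⁻ x in levelSet (psi α) ρ, (ENNReal.ofReal (T ρ))⁻¹ * (ENNReal.ofReal ‖gradient (psi α) x‖)⁻¹
        ∂(Measure.hausdorffMeasure 1) := by
    refine setLIntegral_congr_fun (measurableSet_levelSet_psi α ρ) fun x hx => ?_
    rw [norm_gradient, (h.hasFDerivAt_psiRe h0 h1 hx.1).fderiv, hx.2, norm_smul,
      Real.norm_of_nonneg hT.le, ENNReal.ofReal_mul hT.le,
      ENNReal.mul_inv (Or.inl hT0) (Or.inl ENNReal.ofReal_ne_top), norm_gradient]
  rw [this, lintegral_const_mul' _ _ (ENNReal.inv_ne_top.2 hT0)]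
  change _ * period (psi α) ρ = 1
  rw [h.period_eq ρ hρ, ENNReal.inv_mul_cancel hT0 ENNReal.ofReal_ne_top]

end PeriodProfile

end

/-! ### Pointwise bounds for the derivatives up to order three. -/

theorem isCompact_closure_Q : IsCompact (closure Q) := by
  have e : closure Q = (EuclideanSpace.equiv (Fin 2) ℝ).toHomeomorph ⁻¹'
      (Set.univ.pi fun _ => Icc (0 : ℝ) 1) := by
    rw [closure_Q]; ext x
    exact ⟨fun h i _ => h i, fun h i => h i (mem_univ i)⟩
  rw [e, Homeomorph.isCompact_preimage]
  exact isCompact_univ_pi fun _ => isCompact_Icc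

/-- The stream function in the coordinates `sin (π x)`, `sin (π y)`. -/
noncomputable def psiProfile (α : ℝ) (w : ℝ × ℝ) : ℝ := 2 ^ α * (w.1 * w.2) / (w.1 + w.2) ^ α

theorem psiProfile_smul (α : ℝ) {d : ℝ} (hd : 0 < d) {w : ℝ × ℝ} (hw : 0 < w.1 + w.2) :
    psiProfile α w = d ^ (2 - α) * psiProfile α (d⁻¹ • w) := by
  simp only [psiProfile, Prod.smul_fst, Prod.smul_snd, smul_eq_mul]
  rw [← mul_add, Real.mul_rpow (by positivity) hw.le, Real.inv_rpow hd.le, Real.rpow_sub hd]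
  have : d ^ (2 : ℝ) = d ^ 2 := by norm_cast
  rw [this]
  have := Real.rpow_pos_of_pos hd α
  have := Real.rpow_pos_of_pos hw α
  field_simp

theorem isOpen_add_pos : IsOpen {w : ℝ × ℝ | 0 < w.1 + w.2} :=
  isOpen_lt continuous_const (by fun_prop)

theorem contDiffOn_psiProfile (α : ℝ) (n : WithTop ℕ∞) :
    ContDiffOn ℝ n (psiProfile α) {w : ℝ × ℝ | 0 < w.1 + w.2} := by
  intro w hw
  refine ContDiffAt.contDiffWithinAt ?_
  have hw : 0 < w.1 + w.2 := hw
  have c : ContDiffAt ℝ n (fun w : ℝ × ℝ => (w.1 + w.2) ^ α) w :=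
    ContDiffAt.rpow_const_of_ne (by fun_prop) hw.ne'
  have c2 : ContDiffAt ℝ n (fun w : ℝ × ℝ => 2 ^ α * (w.1 * w.2)) w := by fun_prop
  exact c2.div c (by positivity)

/-- Derivatives of the stream function near the corners of the square. -/
theorem exists_norm_iteratedFDeriv_psi_le (α : ℝ) (N : ℕ) :
    ∃ C, 0 ≤ C ∧ ∀ n ≤ N, ∀ x ∈ Q,
      ‖iteratedFDeriv ℝ n (psi α) x‖ ≤ C * (sinPi x 0 + sinPi x 1) ^ (2 - α - n) := by
  set V : Set (ℝ × ℝ) := {w | 0 < w.1 + w.2} with hV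
  -- By homogeneity in (u, v) it suffices to control derivatives on the compact segment u + v = 1 of
  -- the closed quadrant, where the profile is smooth.
  set K : Set (ℝ × ℝ) := (Icc 0 1 ×ˢ Icc 0 1) ∩ {w | w.1 + w.2 = 1} with hK
  have hKc : IsCompact K := (isCompact_Icc.prod isCompact_Icc).inter_right
    (isClosed_eq (by fun_prop) continuous_const)
  have hKV : K ⊆ V := fun w hw => by
    have : w.1 + w.2 = 1 := hw.2
    change 0 < w.1 + w.2
    linarith
  set W : Plane → ℝ × ℝ := fun x => (sinPi x 0, sinPi x 1) with hW
  have hWc : ∀ n : WithTop ℕ∞, ContDiff ℝ n W := fun n =>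
    (contDiff_sinPi 0).prodMk (contDiff_sinPi 1)
  have b1 : ∀ i : ℕ, ∃ C, ∀ w ∈ K, ‖iteratedFDerivWithin ℝ i (psiProfile α) V w‖ ≤ C := fun i =>
    hKc.exists_bound_of_continuousOn
      (((contDiffOn_psiProfile α i).continuousOn_iteratedFDerivWithin le_rfl
        isOpen_add_pos.uniqueDiffOn).mono hKV)
  have b2 : ∀ i : ℕ, ∃ C, ∀ x ∈ closure Q, ‖iteratedFDeriv ℝ i W x‖ ≤ C := fun i =>
    isCompact_closure_Q.exists_bound_of_continuousOn
      ((hWc i).continuous_iteratedFDeriv le_rfl).continuousOn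
  choose C₁ hC₁ using b1
  choose C₂ hC₂ using b2
  set A := ∑ i ∈ Finset.range (N + 1), |C₁ i| with hA
  set M := 1 + ∑ i ∈ Finset.range (N + 1), |C₂ i| with hM
  have hA0 : 0 ≤ A := Finset.sum_nonneg fun _ _ => abs_nonneg _
  have hM1 : 1 ≤ M := le_add_of_nonneg_right (Finset.sum_nonneg fun _ _ => abs_nonneg _)
  have hAi : ∀ i ≤ N, C₁ i ≤ A := fun i hi => (le_abs_self _).trans
    (Finset.single_le_sum (f := fun i => |C₁ i|) (fun _ _ => abs_nonneg _)
      (Finset.mem_range.2 (by omega)))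
  have hMi : ∀ i ≤ N, C₂ i ≤ M := fun i hi => ((le_abs_self _).trans
    (Finset.single_le_sum (f := fun i => |C₂ i|) (fun _ _ => abs_nonneg _)
      (Finset.mem_range.2 (by omega)))).trans (le_add_of_nonneg_left zero_le_one)
  refine ⟨(N.factorial : ℝ) * A * (2 * M) ^ N, by positivity, fun n hn x hx => ?_⟩
  have hu := sinPi_pos hx 0
  have hv := sinPi_pos hx 1
  set d := sinPi x 0 + sinPi x 1 with hd
  have hd0 : 0 < d := by positivity
  have hd2 : d ≤ 2 := by linarith [sinPi_le_one x 0, sinPi_le_one x 1]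
  have hWV : ∀ y ∈ Q, W y ∈ V := fun y hy => add_pos (sinPi_pos hy 0) (sinPi_pos hy 1)
  -- The scaling factor `d` is frozen at its value at `x`, so it is constant under differentiation,
  -- and the rescaled point at `x` lies in K.
  have hcomp : ∀ y ∈ Q, psi α y = (d ^ (2 - α) • (psiProfile α ∘ (d⁻¹ • W))) y := fun y hy => by
    have := psiProfile_smul α hd0 (hWV y hy)
    exact this
  have hmaps : MapsTo (d⁻¹ • W) Q V := fun y hy => by
    have : 0 < d⁻¹ * (W y).1 + d⁻¹ * (W y).2 := by
      rw [← mul_add]; exact mul_pos (by positivity) (hWV y hy)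
    exact this
  have hWx : (d⁻¹ • W) x ∈ K := by
    refine ⟨⟨?_, ?_⟩, ?_⟩
    · change d⁻¹ * sinPi x 0 ∈ Icc 0 1
      rw [inv_mul_eq_div]
      exact ⟨by positivity, (div_le_one hd0).2 (by linarith)⟩
    · change d⁻¹ * sinPi x 1 ∈ Icc 0 1
      rw [inv_mul_eq_div]
      exact ⟨by positivity, (div_le_one hd0).2 (by linarith)⟩
    · change d⁻¹ * sinPi x 0 + d⁻¹ * sinPi x 1 = 1
      rw [← mul_add, inv_mul_cancel₀ hd0.ne']
  have hQu := isOpen_Q.uniqueDiffOn (𝕜 := ℝ)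
  have cW : ContDiffOn ℝ (n : WithTop ℕ∞) (d⁻¹ • W) Q := ((hWc n).const_smul d⁻¹).contDiffOn
  have key := norm_iteratedFDerivWithin_comp_le (n := n) (contDiffOn_psiProfile α n) cW le_rfl
    isOpen_add_pos.uniqueDiffOn hQu hmaps hx (C := A) (D := 2 * M / d)
    (fun i hi => (hC₁ i _ hWx).trans (hAi i (hi.trans hn))) (fun i hi1 hi => by
      rw [iteratedFDerivWithin_of_isOpen i isOpen_Q hx,
        iteratedFDeriv_const_smul_apply (hWc i).contDiffAt, norm_smul, norm_inv,
        Real.norm_of_nonneg hd0.le]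
      have h3 := (hC₂ i x (subset_closure hx)).trans (hMi i (hi.trans hn))
      -- Since d ≤ 2 and M ≥ 1, the base 2M/d is at least 1, so the single factor 1/d from the
      -- rescaling is dominated by its i-th power, as the estimate for compositions demands.
      have h5 : 1 ≤ 2 * M / d := (one_le_div hd0).2 (by linarith)
      calc d⁻¹ * ‖iteratedFDeriv ℝ i W x‖ ≤ d⁻¹ * M := by gcongr
        _ ≤ 2 * M / d := by rw [div_eq_inv_mul]; gcongr; linarith
        _ ≤ _ := le_self_pow₀ h5 (by omega))
  rw [← iteratedFDerivWithin_of_isOpen n isOpen_Q hx, iteratedFDerivWithin_congr hcomp hx,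
    iteratedFDerivWithin_const_smul_apply
      ((((contDiffOn_psiProfile α n).comp cW hmaps)) x hx) hQu hx, norm_smul,
    Real.norm_of_nonneg (by positivity)]
  have hfac : (n.factorial : ℝ) ≤ N.factorial := by exact_mod_cast Nat.factorial_le hn
  calc d ^ (2 - α) * _ ≤ d ^ (2 - α) * (n.factorial * A * (2 * M / d) ^ n) := by gcongr
    _ = (n.factorial * A * (2 * M) ^ n) * d ^ (2 - α - n) := by
        rw [Real.rpow_sub hd0 _ (n : ℝ), Real.rpow_natCast, div_pow]; field_simp
    _ ≤ _ := by
        gcongr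
        linarith

/-- The product `sin (π x) sin (π y)`, comparable to the distance to the boundary times the
distance to the nearest corner. -/
noncomputable def sinProd (x : Plane) : ℝ := sinPi x 0 * sinPi x 1

theorem sinProd_pos {x : Plane} (hx : x ∈ Q) : 0 < sinProd x :=
  mul_pos (sinPi_pos hx 0) (sinPi_pos hx 1)

theorem sinProd_le_one {x : Plane} (hx : x ∈ Q) : sinProd x ≤ 1 :=
  mul_le_one₀ (sinPi_le_one x 0) (sinPi_pos hx 1).le (sinPi_le_one x 1)

/-- Because (u+v)/2 ≤ 1, the denominator (u+v)^α is at most 2^α. This lower bound converts negative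
powers of the level into powers of the weight. -/
theorem sinProd_le_psi {α : ℝ} (h0 : 0 < α) {x : Plane} (hx : x ∈ Q) : sinProd x ≤ psi α x := by
  have hu := sinPi_pos hx 0
  have hv := sinPi_pos hx 1
  have hu1 := sinPi_le_one x 0
  have hv1 := sinPi_le_one x 1
  rw [psi_eq, le_div_iff₀ (by positivity), mul_comm, sinProd]
  gcongr
  linarith

theorem rpow_add_sinPi_le {a : ℝ} (ha : 0 ≤ a) {x : Plane} (hx : x ∈ Q) :
    (sinPi x 0 + sinPi x 1) ^ (-a) ≤ sinProd x ^ (-(a / 2)) := by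
  have hu := sinPi_pos hx 0
  have hv := sinPi_pos hx 1
  have e : (sinPi x 0 + sinPi x 1) ^ (-a) = ((sinPi x 0 + sinPi x 1) ^ 2) ^ (-(a / 2)) := by
    rw [← Real.rpow_natCast, ← Real.rpow_mul (by positivity)]; congr 1; push_cast; ring
  rw [e]
  refine Real.rpow_le_rpow_of_nonpos (sinProd_pos hx) ?_ (by linarith)
  rw [sinProd]; nlinarith [mul_pos hu hv]

theorem rpow_sinProd_anti {a b : ℝ} (h : a ≤ b) {x : Plane} (hx : x ∈ Q) :
    sinProd x ^ (-a) ≤ sinProd x ^ (-b) :=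
  Real.rpow_le_rpow_of_exponent_ge (sinProd_pos hx) (sinProd_le_one hx) (by linarith)

/-- Leibniz bound for a function whose derivative factors. -/
theorem norm_iteratedFDeriv_succ_le {E : Type*} [NormedAddCommGroup E] [NormedSpace ℝ E]
    {U : Set E} (hU : IsOpen U) {f c g : E → ℝ} {n : ℕ}
    (hf : ∀ y ∈ U, HasFDerivAt f (c y • fderiv ℝ g y) y) (hc : ContDiffOn ℝ n c U)
    (hg : ContDiffOn ℝ (n + 1 : ℕ) g U) {x : E} (hx : x ∈ U) :
    ‖iteratedFDeriv ℝ (n + 1) f x‖ ≤ ∑ i ∈ Finset.range (n + 1),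
      (n.choose i : ℝ) * ‖iteratedFDeriv ℝ i c x‖ * ‖iteratedFDeriv ℝ (n - i + 1) g x‖ := by
  have hg' : ContDiffOn ℝ n (fderiv ℝ g) U := hg.fderiv_of_isOpen hU (by norm_cast)
  have h := norm_iteratedFDerivWithin_smul_le hc hg' hU.uniqueDiffOn hx (n := n) le_rfl
  rw [← norm_iteratedFDeriv_fderiv, ← iteratedFDerivWithin_of_isOpen n hU hx,
    iteratedFDerivWithin_congr (fun y hy => (hf y hy).fderiv) hx]
  refine h.trans (le_of_eq (Finset.sum_congr rfl fun i _ => ?_))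
  rw [iteratedFDerivWithin_of_isOpen _ hU hx, iteratedFDerivWithin_of_isOpen _ hU hx,
    norm_iteratedFDeriv_fderiv]

namespace PeriodProfile
variable {α r₁ C : ℝ} {T T₁ T₂ : ℝ → ℝ}

theorem contDiffOn₁ (h : PeriodProfile α r₁ C T T₁ T₂) : ContDiffOn ℝ 1 T₁ (Ioo 0 r₁) := by
  have := (contDiffOn_succ_iff_deriv_of_isOpen (𝕜 := ℝ) (n := 0) (f := T₁) isOpen_Ioo).2
    ⟨fun r hr => (h.hasDerivAt₁ r hr).differentiableAt.differentiableWithinAt, by simp,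
      contDiffOn_zero.2 (h.continuousOn₂.congr fun r hr => (h.hasDerivAt₁ r hr).deriv)⟩
  simpa using this

theorem contDiffOn_two (h : PeriodProfile α r₁ C T T₁ T₂) : ContDiffOn ℝ 2 T (Ioo 0 r₁) := by
  have := (contDiffOn_succ_iff_deriv_of_isOpen (𝕜 := ℝ) (n := 1) (f := T) isOpen_Ioo).2
    ⟨fun r hr => (h.hasDerivAt r hr).differentiableAt.differentiableWithinAt, by simp,
      h.contDiffOn₁.congr fun r hr => (h.hasDerivAt r hr).deriv⟩
  rwa [one_add_one_eq_two] at this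

theorem contDiffOn_primitive (h : PeriodProfile α r₁ C T T₁ T₂) :
    ContDiffOn ℝ 3 (primitive T) (Ioo 0 r₁) := by
  have := (contDiffOn_succ_iff_deriv_of_isOpen (𝕜 := ℝ) (n := 2) (f := primitive T) isOpen_Ioo).2
    ⟨fun r hr => (h.hasDerivAt_primitive hr).differentiableAt.differentiableWithinAt, by simp,
      h.contDiffOn_two.congr fun r hr => (h.hasDerivAt_primitive hr).deriv⟩
  rwa [show (2 : WithTop ℕ∞) + 1 = 3 by norm_num] at this

theorem mapsTo_psi (h : PeriodProfile α r₁ C T T₁ T₂) (h0 : 0 < α) (h1 : α < 1) :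
    MapsTo (psi α) Q (Ioo 0 r₁) := fun _ hx => h.psi_mem_Ioo h0 h1 hx

theorem _root_.SquareFlow.contDiffOn_psi (α : ℝ) (n : WithTop ℕ∞) : ContDiffOn ℝ n (psi α) Q :=
  fun _ hx => (contDiffAt_psi hx).contDiffWithinAt

theorem contDiffOn_psiRe (h : PeriodProfile α r₁ C T T₁ T₂) (h0 : 0 < α) (h1 : α < 1) :
    ContDiffOn ℝ 3 (psiRe α) Q :=
  (h.contDiffOn_primitive.comp (contDiffOn_psi α 3) (h.mapsTo_psi h0 h1)).congr fun _ hx =>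
    h.psiRe_eq h0 h1 (subset_closure hx)

theorem hasFDerivAt_comp_psi (h : PeriodProfile α r₁ C T T₁ T₂) (h0 : 0 < α) (h1 : α < 1)
    {g g' : ℝ → ℝ} (hg : ∀ r ∈ Ioo 0 r₁, HasDerivAt g (g' r) r) :
    ∀ x ∈ Q, HasFDerivAt (g ∘ psi α) ((g' ∘ psi α) x • fderiv ℝ (psi α) x) x := fun x hx =>
  (hg _ (h.psi_mem_Ioo h0 h1 hx)).comp_hasFDerivAt x
    ((contDiffAt_psi (α := α) (n := 1) hx).differentiableAt (by simp)).hasFDerivAt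

/-- Bounds for the derivatives of the reparametrized stream function up to order three. -/
theorem exists_bound_psiRe (h : PeriodProfile α r₁ C T T₁ T₂) (h0 : 0 < α) (h1 : α < 1) :
    ∃ B, 0 ≤ B ∧ ∀ x ∈ Q, |psiRe α x| ≤ B ∧ ‖iteratedFDeriv ℝ 1 (psiRe α) x‖ ≤ B ∧
      ‖iteratedFDeriv ℝ 2 (psiRe α) x‖ ≤ B * sinProd x ^ (-mexp α) ∧
      ‖iteratedFDeriv ℝ 3 (psiRe α) x‖ ≤ B * sinProd x ^ (-mexp α - 1) := by
  obtain ⟨A, hA0, hA⟩ := exists_norm_iteratedFDeriv_psi_le α 3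
  have hC0 := h.nonneg
  set κ := (2 - 2 * α) / (2 - α) with hκ
  have hκ0 : 0 ≤ κ := div_nonneg (by linarith) (by linarith)
  have hmκ : κ ≤ mexp α := le_max_right _ _
  have hmα : α / 2 ≤ mexp α := le_max_left _ _
  set B := |primitive T 1| + C * (2 * A) + (C * A + C * (2 * A) * (2 * A)) +
    (C * (A) + 2 * (C * (2 * A)) * A + (C * A + C * (2 * A) * (2 * A)) * (2 * A)) with hB
  have hB1 : 0 ≤ C * (2 * A) := by positivity
  have hB2 : 0 ≤ C * A + C * (2 * A) * (2 * A) := by positivity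
  have hB3 : 0 ≤ C * (A) + 2 * (C * (2 * A)) * A +
    (C * A + C * (2 * A) * (2 * A)) * (2 * A) := by positivity
  have hB0 := abs_nonneg (primitive T 1)
  refine ⟨B, by positivity, fun x hx => ?_⟩
  have hS := sinProd_pos hx
  have hS1 := sinProd_le_one hx
  have hd0 : 0 < sinPi x 0 + sinPi x 1 := add_pos (sinPi_pos hx 0) (sinPi_pos hx 1)
  have hd2 : sinPi x 0 + sinPi x 1 ≤ 2 := by linarith [sinPi_le_one x 0, sinPi_le_one x 1]
  have hψ := h.psi_mem_Ioo h0 h1 hx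
  have hx' := subset_closure hx
  have a1 : ‖iteratedFDeriv ℝ 1 (psi α) x‖ ≤ 2 * A := by
    refine (hA 1 (by norm_num) x hx).trans ?_
    rw [mul_comm 2 A]
    gcongr
    calc (sinPi x 0 + sinPi x 1) ^ (2 - α - (1 : ℕ)) ≤ 2 ^ (2 - α - (1 : ℕ)) :=
          Real.rpow_le_rpow hd0.le hd2 (by push_cast; linarith)
      _ ≤ 2 ^ (1 : ℝ) := Real.rpow_le_rpow_of_exponent_le (by norm_num) (by push_cast; linarith)
      _ = 2 := by norm_num
  have a2 : ‖iteratedFDeriv ℝ 2 (psi α) x‖ ≤ A * sinProd x ^ (-(α / 2)) := by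
    refine (hA 2 (by norm_num) x hx).trans ?_
    gcongr
    rw [show 2 - α - ((2 : ℕ) : ℝ) = -α by push_cast; ring]
    exact rpow_add_sinPi_le h0.le hx
  have a3 : ‖iteratedFDeriv ℝ 3 (psi α) x‖ ≤ A * sinProd x ^ (-mexp α - 1) := by
    refine (hA 3 le_rfl x hx).trans ?_
    gcongr
    rw [show 2 - α - ((3 : ℕ) : ℝ) = -(α + 1) by push_cast; ring,
      show -mexp α - 1 = -(mexp α + 1) by ring]
    exact (rpow_add_sinPi_le (by linarith) hx).trans (rpow_sinProd_anti (by linarith) hx)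
  have t0 : |T (psi α x)| ≤ C := by rw [abs_of_pos (h.pos _ hψ)]; exact h.le _ hψ
  have t1 : |T₁ (psi α x)| ≤ C * sinProd x ^ (-κ) := by
    refine (h.le₁ _ hψ).trans ?_
    exact mul_le_mul_of_nonneg_left (Real.rpow_le_rpow_of_nonpos hS (sinProd_le_psi h0 hx)
      (neg_nonpos.2 hκ0)) hC0
  have t2 : |T₂ (psi α x)| ≤ C * sinProd x ^ (-κ - 1) := by
    refine (h.le₂ _ hψ).trans ?_
    exact mul_le_mul_of_nonneg_left (Real.rpow_le_rpow_of_nonpos hS (sinProd_le_psi h0 hx)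
      (show -κ - 1 ≤ 0 by linarith)) hC0
  have cT : ContDiffOn ℝ 2 (T ∘ psi α) Q :=
    h.contDiffOn_two.comp (contDiffOn_psi α 2) (h.mapsTo_psi h0 h1)
  have cT₁ : ContDiffOn ℝ 1 (T₁ ∘ psi α) Q :=
    h.contDiffOn₁.comp (contDiffOn_psi α 1) (h.mapsTo_psi h0 h1)
  have cT₂ : ContDiffOn ℝ 0 (T₂ ∘ psi α) Q := contDiffOn_zero.2
    (h.continuousOn₂.comp (contDiffOn_psi α 0).continuousOn (h.mapsTo_psi h0 h1))
  have hf : ∀ y ∈ Q, HasFDerivAt (psiRe α) ((T ∘ psi α) y • fderiv ℝ (psi α) y) y :=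
    fun y hy => h.hasFDerivAt_psiRe h0 h1 hy
  -- Leibniz estimates at three stages: `d1`–`d3` for the function itself, whose differential is
  -- T(psi) dpsi; `e1`, `e2` for T(psi), with T₁ in place of T; and `f1` for T₁(psi), with T₂.
  have d1 := norm_iteratedFDeriv_succ_le isOpen_Q (n := 0) hf (cT.of_le (by norm_num))
    (contDiffOn_psi α _) hx
  have d2 := norm_iteratedFDeriv_succ_le isOpen_Q (n := 1) hf (cT.of_le (by norm_num))
    (contDiffOn_psi α _) hx
  have d3 := norm_iteratedFDeriv_succ_le isOpen_Q (n := 2) hf (cT.of_le (by norm_num))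
    (contDiffOn_psi α _) hx
  have e1 := norm_iteratedFDeriv_succ_le isOpen_Q (n := 0)
    (h.hasFDerivAt_comp_psi h0 h1 h.hasDerivAt) (cT₁.of_le (by norm_num))
    (contDiffOn_psi α _) hx
  have e2 := norm_iteratedFDeriv_succ_le isOpen_Q (n := 1)
    (h.hasFDerivAt_comp_psi h0 h1 h.hasDerivAt) (cT₁.of_le (by norm_num))
    (contDiffOn_psi α _) hx
  have f1 := norm_iteratedFDeriv_succ_le isOpen_Q (n := 0)
    (h.hasFDerivAt_comp_psi h0 h1 h.hasDerivAt₁) (cT₂.of_le (by norm_num))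
    (contDiffOn_psi α _) hx
  simp only [Finset.sum_range_succ, Finset.sum_range_zero, norm_iteratedFDeriv_zero, zero_add,
    Nat.choose_zero_right, Nat.cast_one, one_mul, Function.comp_apply, Real.norm_eq_abs,
    Nat.choose_self, Nat.sub_zero, Nat.choose_one_right, Nat.reduceAdd,
    Nat.reduceSub, Nat.cast_ofNat] at d1 d2 d3 e1 e2 f1
  have sκ := rpow_sinProd_anti hmκ hx
  have sα := rpow_sinProd_anti hmα hx
  have sm : -mexp α - 1 = -(mexp α + 1) := by ring
  have sκ1 : sinProd x ^ (-κ - 1) ≤ sinProd x ^ (-mexp α - 1) := by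
    rw [sm, show -κ - 1 = -(κ + 1) by ring]; exact rpow_sinProd_anti (by linarith) hx
  have sκα : sinProd x ^ (-κ) * sinProd x ^ (-(α / 2)) ≤ sinProd x ^ (-mexp α - 1) := by
    rw [sm, ← Real.rpow_add hS, show -κ + -(α / 2) = -(κ + α / 2) by ring]
    exact rpow_sinProd_anti (by linarith) hx
  have pos1 : 0 < sinProd x ^ (-mexp α) := by positivity
  have pos2 : 0 < sinProd x ^ (-mexp α - 1) := by positivity
  set s1 := sinProd x ^ (-κ)
  set s2 := sinProd x ^ (-(α / 2))
  set s3 := sinProd x ^ (-κ - 1)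
  set s4 := sinProd x ^ (-mexp α)
  set s5 := sinProd x ^ (-mexp α - 1)
  have ps1 : 0 < s1 := by positivity
  have ps2 : 0 < s2 := by positivity
  have ps3 : 0 < s3 := by positivity
  have E1 : ‖iteratedFDeriv ℝ 1 (T ∘ psi α) x‖ ≤ C * s1 * (2 * A) := e1.trans (by gcongr)
  have F1 : ‖iteratedFDeriv ℝ 1 (T₁ ∘ psi α) x‖ ≤ C * s3 * (2 * A) := f1.trans (by gcongr)
  have E2 : ‖iteratedFDeriv ℝ 2 (T ∘ psi α) x‖ ≤ (C * A + C * (2 * A) * (2 * A)) * s5 :=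
    calc _ ≤ _ := e2
      _ ≤ C * s1 * (A * s2) + C * s3 * (2 * A) * (2 * A) := by gcongr
      _ = C * A * (s1 * s2) + C * (2 * A) * (2 * A) * s3 := by ring
      _ ≤ C * A * s5 + C * (2 * A) * (2 * A) * s5 := by gcongr
      _ = _ := by ring
  refine ⟨?_, ?_, ?_, ?_⟩
  · rw [abs_of_pos (h.psiRe_pos h0 h1 hx), h.psiRe_eq h0 h1 hx']
    have := h.strictMonoOn_primitive.monotoneOn (psi_mem h0 h1 hx') ⟨zero_le_one, le_rfl⟩
      (psi_le_one h0 h1 hx')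
    have := le_abs_self (primitive T 1)
    linarith
  · calc _ ≤ _ := d1
      _ ≤ C * (2 * A) := by gcongr
      _ ≤ B := by linarith
  · calc _ ≤ _ := d2
      _ ≤ C * (A * s2) + C * s1 * (2 * A) * (2 * A) := by gcongr
      _ = C * A * s2 + C * (2 * A) * (2 * A) * s1 := by ring
      _ ≤ C * A * s4 + C * (2 * A) * (2 * A) * s4 := by gcongr
      _ = (C * A + C * (2 * A) * (2 * A)) * s4 := by ring
      _ ≤ B * s4 := by gcongr; linarith
  · calc _ ≤ _ := d3
      _ ≤ C * (A * s5) + 2 * (C * s1 * (2 * A)) * (A * s2) +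
          (C * A + C * (2 * A) * (2 * A)) * s5 * (2 * A) := by gcongr
      _ = C * A * s5 + 2 * (C * (2 * A)) * A * (s1 * s2) +
          (C * A + C * (2 * A) * (2 * A)) * (2 * A) * s5 := by ring
      _ ≤ C * A * s5 + 2 * (C * (2 * A)) * A * s5 +
          (C * A + C * (2 * A) * (2 * A)) * (2 * A) * s5 := by gcongr
      _ = (C * A + 2 * (C * (2 * A)) * A +
          (C * A + C * (2 * A) * (2 * A)) * (2 * A)) * s5 := by ring
      _ ≤ B * s5 := by gcongr; linarith

end PeriodProfile

/-! ### Dominated convergence in L^p and Schur's test. -/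

/-- Dominated convergence in `L^p`. -/
theorem tendsto_eLpNorm_sub_of_dominated {X : Type*} [MeasurableSpace X] {μ : Measure X} {p : ℝ}
    (hp : 0 < p) {u : ℕ → X → ℝ} {f H : X → ℝ} (hu : ∀ n, AEStronglyMeasurable (u n) μ)
    (hH : MemLp H (ENNReal.ofReal p) μ) (hb : ∀ n, ∀ᵐ x ∂μ, |u n x| ≤ H x)
    (hl : ∀ᵐ x ∂μ, Tendsto (fun n => u n x) atTop (𝓝 (f x))) :
    (∀ n, MemLp (u n) (ENNReal.ofReal p) μ) ∧ MemLp f (ENNReal.ofReal p) μ ∧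
      Tendsto (fun n => eLpNorm (u n - f) (ENNReal.ofReal p) μ) atTop (𝓝 0) := by
  have hfm : AEStronglyMeasurable f μ := aestronglyMeasurable_of_tendsto_ae atTop hu hl
  have hfb : ∀ᵐ x ∂μ, |f x| ≤ H x := by
    filter_upwards [ae_all_iff.2 hb, hl] with x hx hlx
    exact le_of_tendsto hlx.abs (Eventually.of_forall hx)
  refine ⟨fun n => hH.mono' (hu n) (hb n), hH.mono' hfm hfb, ?_⟩
  have hp0 : ENNReal.ofReal p ≠ 0 := by simpa using hp
  have hfin : ∫⁻ x, ‖2 * H x‖ₑ ^ p ∂μ ≠ ⊤ := by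
    have h2 := (hH.const_mul 2).2
    rw [eLpNorm_lt_top_iff_lintegral_rpow_enorm_lt_top hp0 ENNReal.ofReal_ne_top,
      ENNReal.toReal_ofReal hp.le] at h2
    exact h2.ne
  have key : Tendsto (fun n => ∫⁻ x, ‖u n x - f x‖ₑ ^ p ∂μ) atTop (𝓝 (∫⁻ _, 0 ∂μ)) := by
    refine tendsto_lintegral_of_dominated_convergence' (fun x => ‖2 * H x‖ₑ ^ p)
      (fun n => ((hu n).sub hfm).enorm.pow_const p) (fun n => ?_) hfin ?_
    · filter_upwards [hb n, hfb] with x h1 h2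
      refine ENNReal.rpow_le_rpow ?_ hp.le
      rw [enorm_le_iff_norm_le, Real.norm_eq_abs, Real.norm_eq_abs]
      calc |u n x - f x| ≤ |u n x| + |f x| := abs_sub _ _
        _ ≤ 2 * H x := by linarith
        _ ≤ _ := le_abs_self _
    · filter_upwards [hl] with x hx
      have h3 : Tendsto (fun n => ‖u n x - f x‖ₑ) atTop (𝓝 0) := by
        have := (hx.sub_const (f x)).enorm
        simpa using this
      have h5 := h3.ennrpow_const p
      rwa [ENNReal.zero_rpow_of_pos hp] at h5
  rw [lintegral_zero] at key
  have h6 := key.ennrpow_const (1 / p)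
  rw [ENNReal.zero_rpow_of_pos (by positivity)] at h6
  refine h6.congr fun n => ?_
  rw [eLpNorm_eq_lintegral_rpow_enorm_toReal hp0 ENNReal.ofReal_ne_top,
    ENNReal.toReal_ofReal hp.le]
  rfl

/-- Jensen's inequality for an unnormalized weight. -/
theorem lintegral_mul_rpow_le {X : Type*} [MeasurableSpace X] {μ : Measure X} {p : ℝ} (hp : 1 ≤ p)
    {k w : X → ℝ≥0∞} (hk : Measurable k) (hw : Measurable w) :
    (∫⁻ y, k y * w y ∂μ) ^ p ≤ (∫⁻ y, k y * w y ^ p ∂μ) * (∫⁻ y, k y ∂μ) ^ (p - 1) := by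
  have hp0 : 0 < p := by linarith
  -- The kernel is taken as a density: the inequality is the comparison of the L¹ and L^p norms of
  -- `w` for the measure k dμ.
  have h := eLpNorm'_le_eLpNorm'_mul_rpow_measure_univ (μ := μ.withDensity k) (f := w) one_pos hp
    hw.aestronglyMeasurable
  simp only [eLpNorm'_eq_lintegral_enorm, enorm_eq_self, ENNReal.rpow_one, div_one] at h
  rw [withDensity_apply _ MeasurableSet.univ, setLIntegral_univ,
    lintegral_withDensity_eq_lintegral_mul _ hk hw,
    lintegral_withDensity_eq_lintegral_mul _ hk (hw.pow_const p)] at h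
  have h2 := ENNReal.rpow_le_rpow h hp0.le
  rw [ENNReal.mul_rpow_of_nonneg _ _ hp0.le, ← ENNReal.rpow_mul, ← ENNReal.rpow_mul,
    one_div_mul_cancel hp0.ne', ENNReal.rpow_one, sub_mul, one_mul, one_div_mul_cancel hp0.ne'] at h2
  exact h2

/-- Schur's test for a kernel with bounded marginals. -/
theorem lintegral_kernel_rpow_le {X : Type*} [MeasurableSpace X] {μ : Measure X} [SFinite μ] {p : ℝ}
    (hp : 1 ≤ p) {k : X → X → ℝ≥0∞} {w : X → ℝ≥0∞} {K : ℝ≥0∞}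
    (hk : Measurable (Function.uncurry k)) (hw : Measurable w)
    (h1 : ∀ᵐ x ∂μ, ∫⁻ y, k x y ∂μ ≤ K) (h2 : ∀ᵐ y ∂μ, ∫⁻ x, k x y ∂μ ≤ K) :
    ∫⁻ x, (∫⁻ y, k x y * w y ∂μ) ^ p ∂μ ≤ K ^ p * ∫⁻ y, w y ^ p ∂μ := by
  have hm : Measurable (Function.uncurry fun x y => k x y * w y ^ p) :=
    hk.mul ((hw.comp measurable_snd).pow_const p)
  have e : K ^ p = K ^ (p - 1) * K := by
    conv_lhs => rw [show p = (p - 1) + 1 by ring]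
    rw [ENNReal.rpow_add_of_nonneg _ _ (by linarith) zero_le_one, ENNReal.rpow_one]
  calc ∫⁻ x, (∫⁻ y, k x y * w y ∂μ) ^ p ∂μ
      ≤ ∫⁻ x, K ^ (p - 1) * (∫⁻ y, k x y * w y ^ p ∂μ) ∂μ := by
        refine lintegral_mono_ae ?_
        filter_upwards [h1] with x hx
        refine (lintegral_mul_rpow_le hp (hk.comp measurable_prodMk_left) hw).trans ?_
        rw [mul_comm]
        exact mul_le_mul' (ENNReal.rpow_le_rpow hx (by linarith)) le_rfl
    _ = K ^ (p - 1) * ∫⁻ x, ∫⁻ y, k x y * w y ^ p ∂μ ∂μ :=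
        lintegral_const_mul _ hm.lintegral_prod_right
    _ = K ^ (p - 1) * ∫⁻ y, (∫⁻ x, k x y ∂μ) * w y ^ p ∂μ := by
        rw [lintegral_lintegral_swap hm.aemeasurable]
        congr 1
        refine lintegral_congr fun y => ?_
        exact lintegral_mul_const _ (hk.comp measurable_prodMk_right)
    _ ≤ K ^ (p - 1) * ∫⁻ y, K * w y ^ p ∂μ := by
        gcongr 1
        refine lintegral_mono_ae ?_
        filter_upwards [h2] with y hy
        gcongr
    _ = _ := by
        rw [lintegral_const_mul _ (hw.pow_const p), e, mul_assoc]

/-! ### Integrability of the weights and of the Riesz kernel. -/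

theorem measurePreserving_coord :
    MeasurePreserving (fun x : Plane => (x 0, x 1)) volume volume :=
  (volume_preserving_finTwoArrow ℝ).comp
    (EuclideanSpace.volume_preserving_symm_measurableEquiv_toLp (Fin 2))

/-- Jordan's inequality bounds sin(πt) below by the distance to the nearer end of the interval. -/
theorem integrableOn_sin_rpow {c : ℝ} (hc0 : 0 ≤ c) (hc : c < 1) :
    IntegrableOn (fun t : ℝ => Real.sin (Real.pi * t) ^ (-c)) (Ioo 0 1) := by
  refine Integrable.mono' ((integrableOn_rpow_Ioo (c := -c) (by linarith)).add
    (integrableOn_one_sub_rpow_Ioo (c := -c) (by linarith))) ?_ ?_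
  · refine Measurable.aestronglyMeasurable ?_
    fun_prop
  · filter_upwards [ae_restrict_mem measurableSet_Ioo] with t ht
    have ht0 := ht.1
    have ht1 : 0 < 1 - t := by linarith [ht.2]
    have hpi := Real.pi_pos
    have hs : 0 < Real.sin (Real.pi * t) :=
      Real.sin_pos_of_pos_of_lt_pi (by positivity) (by nlinarith)
    rw [Real.norm_of_nonneg (by positivity), Pi.add_apply]
    have p1 := Real.rpow_pos_of_pos ht0 (-c)
    have p2 := Real.rpow_pos_of_pos ht1 (-c)
    rcases le_total t (1 / 2) with h | h
    · have : t ≤ Real.sin (Real.pi * t) := by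
        have := Real.mul_le_sin (x := Real.pi * t) (by positivity) (by nlinarith)
        calc t ≤ 2 * t := by linarith
          _ = 2 / Real.pi * (Real.pi * t) := by field_simp
          _ ≤ _ := this
      have := Real.rpow_le_rpow_of_nonpos ht0 this (by linarith : -c ≤ 0)
      linarith
    · have : 1 - t ≤ Real.sin (Real.pi * t) := by
        have := Real.mul_le_sin (x := Real.pi * (1 - t)) (by positivity) (by nlinarith)
        rw [sin_pi_mul_one_sub] at this
        calc 1 - t ≤ 2 * (1 - t) := by linarith
          _ = 2 / Real.pi * (Real.pi * (1 - t)) := by field_simp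
          _ ≤ _ := this
      have := Real.rpow_le_rpow_of_nonpos ht1 this (by linarith : -c ≤ 0)
      linarith

theorem integrableOn_sinProd_rpow {c : ℝ} (hc0 : 0 ≤ c) (hc : c < 1) :
    IntegrableOn (fun x => sinProd x ^ (-c)) Q := by
  have h := (integrableOn_sin_rpow hc0 hc).mul_prod (integrableOn_sin_rpow hc0 hc)
  rw [Measure.prod_restrict] at h
  have emb : MeasurableEmbedding (fun x : Plane => (x 0, x 1)) :=
    ((MeasurableEquiv.toLp 2 (Fin 2 → ℝ)).symm.trans MeasurableEquiv.finTwoArrow).measurableEmbedding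
  have h2 := (measurePreserving_coord.integrableOn_comp_preimage emb).2 h
  have e : (fun x : Plane => (x 0, x 1)) ⁻¹' (Ioo 0 1 ×ˢ Ioo 0 1) = Q := by
    ext x; rw [mem_Q_iff]; rfl
  rw [e] at h2
  refine h2.congr_fun (fun x hx => ?_) isOpen_Q.measurableSet
  exact (Real.mul_rpow (sinPi_pos hx 0).le (sinPi_pos hx 1).le).symm

theorem measurable_sinProd : Measurable sinProd :=
  ((contDiff_sinPi (n := 0) 0).continuous.mul (contDiff_sinPi (n := 0) 1).continuous).measurable

/-- The weight is a product of functions of one variable, each with an integrable singularity of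
order pa < 1 at the ends; this is the source of the condition on `p`. -/
theorem memLp_sinProd_rpow {a p : ℝ} (ha : 0 ≤ a) (hp : 0 < p) (hap : p * a < 1) :
    MemLp (fun x => sinProd x ^ (-a)) (ENNReal.ofReal p) (volume.restrict Q) := by
  have hp0 : ENNReal.ofReal p ≠ 0 := by simpa using hp
  have hm : AEStronglyMeasurable (fun x => sinProd x ^ (-a)) (volume.restrict Q) :=
    (measurable_sinProd.pow_const (-a)).aestronglyMeasurable
  refine (integrable_norm_rpow_iff hm hp0 ENNReal.ofReal_ne_top).1 ?_
  rw [ENNReal.toReal_ofReal hp.le]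
  refine (integrableOn_sinProd_rpow (c := p * a) (by positivity) hap).congr_fun (fun x hx => ?_)
    isOpen_Q.measurableSet
  have := sinProd_pos hx
  simp only
  rw [Real.norm_of_nonneg (by positivity), ← Real.rpow_mul this.le, neg_mul, mul_comm p a]

theorem dist_lt_two {x y : Plane} (hx : x ∈ Q) (hy : y ∈ Q) : dist x y < 2 := by
  rw [EuclideanSpace.dist_eq, Fin.sum_univ_two, Real.sqrt_lt' two_pos, Real.dist_eq, Real.dist_eq,
    sq_abs, sq_abs]
  have := hx 0; have := hx 1; have := hy 0; have := hy 1
  simp only [mem_Ioo] at *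
  nlinarith

/-- The kernel `|x - y|^(e - 2)`. -/
noncomputable def rieszKernel (e : ℝ) (x y : Plane) : ℝ≥0∞ := ENNReal.ofReal (‖x - y‖ ^ (e - 2))

theorem measurable_rieszKernel (e : ℝ) : Measurable (Function.uncurry (rieszKernel e)) := by
  unfold rieszKernel Function.uncurry
  fun_prop

/-- The square lies in the ball of radius 2 about each of its points, so one constant serves all of
them; in polar coordinates it is finite because t · t^(e-2) is integrable at 0. -/
theorem exists_lintegral_rieszKernel_le {e : ℝ} (he : 0 < e) :
    ∃ K ≠ ⊤, ∀ x ∈ Q, ∫⁻ y in Q, rieszKernel e x y ≤ K := by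
  have hint : IntegrableOn (fun z : Plane => ‖z‖ ^ (e - 2)) (Metric.ball 0 2) := by
    rw [integrableOn_fun_norm_addHaar volume (f := fun t : ℝ => t ^ (e - 2))]
    have h := intervalIntegral.intervalIntegrable_rpow' (a := 0) (b := 2) (r := e - 1) (by linarith)
    rw [intervalIntegrable_iff_integrableOn_Ioo_of_le two_pos.le] at h
    refine h.congr_fun (fun t ht => ?_) measurableSet_Ioo
    simp only [finrank_euclideanSpace, Fintype.card_fin, Nat.add_one_sub_one, pow_one, smul_eq_mul]
    rw [show e - 1 = 1 + (e - 2) by ring, Real.rpow_add ht.1, Real.rpow_one]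
  refine ⟨∫⁻ z in Metric.ball (0 : Plane) 2, ENNReal.ofReal (‖z‖ ^ (e - 2)), ?_, fun x hx => ?_⟩
  · have := hint.2
    rw [hasFiniteIntegral_iff_ofReal] at this
    · exact this.ne
    · exact Eventually.of_forall fun z => by positivity
  · calc ∫⁻ y in Q, rieszKernel e x y ≤ ∫⁻ y in Metric.ball x 2, rieszKernel e x y := by
          refine lintegral_mono_set fun y hy => ?_
          rw [Metric.mem_ball, dist_comm]; exact dist_lt_two hx hy
      _ = ∫⁻ y, (Metric.ball (0 : Plane) 2).indicator
            (fun z => ENNReal.ofReal (‖z‖ ^ (e - 2))) (x - y) := by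
          rw [← lintegral_indicator Metric.isOpen_ball.measurableSet]
          refine lintegral_congr fun y => ?_
          simp only [indicator, Metric.mem_ball, dist_zero_right, rieszKernel, dist_comm y x,
            dist_eq_norm x y]
      _ = _ := by
          rw [lintegral_sub_left_eq_self, lintegral_indicator Metric.isOpen_ball.measurableSet]

/-! ### Weighted Hölder estimates. -/

theorem abs_coord_sub_le (x y : Plane) (i : Fin 2) : |x i - y i| ≤ ‖x - y‖ := by
  simpa using PiLp.norm_apply_le (x - y) i

theorem abs_sinPi_sub_le (x y : Plane) (i : Fin 2) :
    |sinPi x i - sinPi y i| ≤ Real.pi * ‖x - y‖ := by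
  refine (Real.abs_sin_sub_sin_le _ _).trans ?_
  rw [← mul_sub, abs_mul, abs_of_pos Real.pi_pos]
  exact mul_le_mul_of_nonneg_left (abs_coord_sub_le x y i) Real.pi_pos.le

theorem sinProd_sub_le (x y : Plane) : sinProd x - sinProd y ≤ 2 * Real.pi * ‖x - y‖ := by
  have e : sinProd x - sinProd y =
      sinPi x 0 * (sinPi x 1 - sinPi y 1) + sinPi y 1 * (sinPi x 0 - sinPi y 0) := by
    unfold sinProd; ring
  have h : ∀ z i j, sinPi z i * (sinPi x j - sinPi y j) ≤ Real.pi * ‖x - y‖ := fun z i j => by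
    refine (le_abs_self _).trans ?_
    rw [abs_mul]
    refine (mul_le_of_le_one_left (abs_nonneg _) (Real.abs_sin_le_one _)).trans ?_
    exact abs_sinPi_sub_le x y j
  rw [e]
  linarith [h x 0 1, h y 1 0]

theorem convex_Q : Convex ℝ Q := by
  intro x hx y hy a b ha hb hab i
  exact convex_Ioo (0 : ℝ) 1 (hx i) (hy i) ha hb hab

/-- A function with power bounds on its values and derivatives is weighted Hölder continuous. -/
theorem exists_weighted_hoelder {g : Plane → ℝ} {m C θ : ℝ} (hm : 0 ≤ m) (hC : 0 ≤ C) (hθ0 : 0 < θ)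
    (hθ1 : θ ≤ 1) (hg : ∀ x ∈ Q, DifferentiableAt ℝ g x)
    (hb : ∀ x ∈ Q, |g x| ≤ C * sinProd x ^ (-m))
    (hb' : ∀ x ∈ Q, ‖fderiv ℝ g x‖ ≤ C * sinProd x ^ (-m - 1)) :
    ∃ A, 0 ≤ A ∧ ∀ x ∈ Q, ∀ y ∈ Q, |g x - g y| ≤
      A * (‖x - y‖ ^ θ * (sinProd x ^ (-(m + θ)) + sinProd y ^ (-(m + θ)))) := by
  have hpi := Real.pi_gt_three
  set L := 2 * Real.pi with hL
  have hL1 : 1 ≤ L := by linarith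
  set A := C * ((2 * L) ^ θ + 2 ^ (m + 1)) with hA
  have hA0 : 0 ≤ A := by positivity
  refine ⟨A, hA0, ?_⟩
  have main : ∀ x ∈ Q, ∀ y ∈ Q, sinProd y ≤ sinProd x → |g x - g y| ≤
      A * (‖x - y‖ ^ θ * (sinProd x ^ (-(m + θ)) + sinProd y ^ (-(m + θ)))) := by
    intro x hx y hy hxy
    have sx := sinProd_pos hx
    have sy := sinProd_pos hy
    have wx : 0 < sinProd x ^ (-(m + θ)) := by positivity
    have wy : 0 < sinProd y ^ (-(m + θ)) := by positivity
    set d := ‖x - y‖ with hd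
    have hd0 : 0 ≤ d := norm_nonneg _
    have hdθ : 0 ≤ d ^ θ := by positivity
    -- L is a Lipschitz constant of the weight S. If the points are far apart relative to S(x), the
    -- values alone suffice: S^(-m) = S^θ S^(-(m+θ)) with S ≤ 2Ld. Otherwise S ≥ S(x)/2 along the
    -- whole segment and the mean value inequality applies.
    rcases le_or_gt (sinProd x) (2 * L * d) with h | h
    · have est : ∀ z ∈ Q, sinProd z ≤ 2 * L * d →
          |g z| ≤ C * (2 * L) ^ θ * (d ^ θ * sinProd z ^ (-(m + θ))) := fun z hz hz2 => by
        have sz := sinProd_pos hz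
        refine (hb z hz).trans ?_
        rw [mul_assoc]
        refine mul_le_mul_of_nonneg_left ?_ hC
        have e : sinProd z ^ (-m) = sinProd z ^ θ * sinProd z ^ (-(m + θ)) := by
          rw [← Real.rpow_add sz]; congr 1; ring
        rw [e, ← mul_assoc, ← Real.mul_rpow (by positivity) hd0]
        exact mul_le_mul_of_nonneg_right (Real.rpow_le_rpow sz.le hz2 hθ0.le) (by positivity)
      have h1 := est x hx h
      have h2 := est y hy (hxy.trans h)
      have hA' : C * (2 * L) ^ θ ≤ A := by
        rw [hA, mul_add]
        exact le_add_of_nonneg_right (by positivity)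
      calc |g x - g y| ≤ |g x| + |g y| := abs_sub _ _
        _ ≤ C * (2 * L) ^ θ * (d ^ θ * (sinProd x ^ (-(m + θ)) + sinProd y ^ (-(m + θ)))) := by
            linarith
        _ ≤ _ := by gcongr
    · have hseg : ∀ z ∈ segment ℝ x y, z ∈ Q ∧ sinProd x / 2 ≤ sinProd z := fun z hz => by
        refine ⟨convex_Q.segment_subset hx hy hz, ?_⟩
        have h1 := sinProd_sub_le x z
        have h2 : ‖x - z‖ ≤ d := by
          have := norm_sub_le_of_mem_segment hz
          rwa [norm_sub_rev, norm_sub_rev y x] at this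
        have : L * ‖x - z‖ ≤ L * d := by gcongr
        linarith
      have hmv := (convex_segment (𝕜 := ℝ) x y).norm_image_sub_le_of_norm_fderiv_le
        (f := g) (C := C * (sinProd x / 2) ^ (-m - 1)) (fun z hz => hg z (hseg z hz).1) (fun z hz => by
          refine (hb' z (hseg z hz).1).trans (mul_le_mul_of_nonneg_left ?_ hC)
          exact Real.rpow_le_rpow_of_nonpos (by positivity) (hseg z hz).2 (by linarith))
        (right_mem_segment ℝ x y) (left_mem_segment ℝ x y)
      have e1 : (sinProd x / 2) ^ (-m - 1) = 2 ^ (m + 1) * sinProd x ^ (-m - 1) := by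
        rw [Real.div_rpow sx.le two_pos.le, show -m - 1 = -(m + 1) by ring,
          Real.rpow_neg two_pos.le]
        field_simp
      have hdS : d ≤ sinProd x := by nlinarith
      -- Here d ≤ S(x), so the surplus d^(1-θ) is traded for S(x)^(1-θ), turning the exponent -m - 1
      -- into -(m+θ).
      have e2 : d ≤ d ^ θ * sinProd x ^ (1 - θ) := by
        rcases hd0.eq_or_lt with h0 | h0
        · rw [← h0]; positivity
        · calc d = d ^ θ * d ^ (1 - θ) := by
                rw [← Real.rpow_add h0, add_sub_cancel, Real.rpow_one]
            _ ≤ _ := by gcongr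
      have e3 : sinProd x ^ (-m - 1) * sinProd x ^ (1 - θ) = sinProd x ^ (-(m + θ)) := by
        rw [← Real.rpow_add sx]; congr 1; ring
      have hA' : C * 2 ^ (m + 1) ≤ A := by
        rw [hA, mul_add]
        exact le_add_of_nonneg_left (by positivity)
      calc |g x - g y| ≤ C * (sinProd x / 2) ^ (-m - 1) * d := hmv
        _ = C * 2 ^ (m + 1) * (sinProd x ^ (-m - 1) * d) := by rw [e1]; ring
        _ ≤ C * 2 ^ (m + 1) * (sinProd x ^ (-m - 1) * (d ^ θ * sinProd x ^ (1 - θ))) := by gcongr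
        _ = C * 2 ^ (m + 1) * (d ^ θ * sinProd x ^ (-(m + θ))) := by rw [← e3]; ring
        _ ≤ _ := by
            gcongr
            exact le_add_of_nonneg_right wy.le
  intro x hx y hy
  rcases le_total (sinProd y) (sinProd x) with h | h
  · exact main x hx y hy h
  · have := main y hy x hx h
    rwa [abs_sub_comm, norm_sub_rev, add_comm (sinProd y ^ _)] at this

/-! ### Smooth contractions of the square into its interior. -/

theorem abs_sqrt_sub_sqrt_le (s t δ : ℝ) : |√(s ^ 2 + δ ^ 2) - √(t ^ 2 + δ ^ 2)| ≤ |s - t| := by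
  have main : ∀ s t : ℝ, √(s ^ 2 + δ ^ 2) ≤ √(t ^ 2 + δ ^ 2) + |s - t| := fun s t => by
    have h0 := Real.sqrt_nonneg (t ^ 2 + δ ^ 2)
    have h1 : |t| ≤ √(t ^ 2 + δ ^ 2) := Real.abs_le_sqrt (by nlinarith [sq_nonneg δ])
    have h2 := Real.sq_sqrt (by positivity : 0 ≤ t ^ 2 + δ ^ 2)
    have h3 := abs_nonneg (s - t)
    have h5 : t * (s - t) ≤ |t| * |s - t| := by rw [← abs_mul]; exact le_abs_self _
    rw [Real.sqrt_le_iff]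
    refine ⟨by positivity, ?_⟩
    nlinarith [sq_abs (s - t)]
  rw [abs_le]
  have := main s t
  have := main t s
  rw [abs_sub_comm] at this
  constructor <;> linarith

/-- A smooth contraction of the line onto a compact part of `(0, 1)`, fixing `1 / 2` and
approximating the identity on `(0, 1)`. -/
noncomputable def smoothClamp (n : ℕ) (s : ℝ) : ℝ :=
  1 / 2 + (√((s - 1 / (n + 3 : ℝ)) ^ 2 + (1 / (n + 1 : ℝ)) ^ 2) -
    √((s - (1 - 1 / (n + 3 : ℝ))) ^ 2 + (1 / (n + 1 : ℝ)) ^ 2)) / 2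

theorem contDiff_smoothClamp (n : ℕ) : ContDiff ℝ 1 (smoothClamp n) := by
  unfold smoothClamp
  have h : ∀ a : ℝ, ContDiff ℝ 1 fun s : ℝ => √((s - a) ^ 2 + (1 / (n + 1 : ℝ)) ^ 2) := fun a =>
    ContDiff.sqrt (by fun_prop) fun s => by positivity
  exact contDiff_const.add (((h _).sub (h _)).div_const 2)

/-- The formula smooths the truncation 1/2 + (|s-a| - |s-(1-a)|)/2 with a = 1/(n+3). The shift by 3
ensures a ≤ 1/3 < 1/2, and the difference of the roots is at most 1 - 2a in modulus, so the value
stays strictly inside. -/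
theorem smoothClamp_mem (n : ℕ) (s : ℝ) : smoothClamp n s ∈ Ioo (0 : ℝ) 1 := by
  have hn : (0 : ℝ) < 1 / (n + 3 : ℝ) := by positivity
  have hn2 : 1 / (n + 3 : ℝ) ≤ 1 / 3 := by
    gcongr; linarith [(Nat.cast_nonneg n : (0 : ℝ) ≤ n)]
  have h := abs_sqrt_sub_sqrt_le (s - 1 / (n + 3 : ℝ)) (s - (1 - 1 / (n + 3 : ℝ))) (1 / (n + 1 : ℝ))
  rw [show s - 1 / (n + 3 : ℝ) - (s - (1 - 1 / (n + 3 : ℝ))) = 1 - 2 * (1 / (n + 3 : ℝ)) by ring,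
    abs_of_pos (by linarith : 0 < 1 - 2 * (1 / (n + 3 : ℝ))), abs_le] at h
  unfold smoothClamp
  constructor <;> linarith [h.1, h.2]

/-- Half the difference of two 1-Lipschitz functions is 1-Lipschitz. -/
theorem abs_smoothClamp_sub_le (n : ℕ) (s t : ℝ) :
    |smoothClamp n s - smoothClamp n t| ≤ |s - t| := by
  have h1 := abs_sqrt_sub_sqrt_le (s - 1 / (n + 3 : ℝ)) (t - 1 / (n + 3 : ℝ)) (1 / (n + 1 : ℝ))
  have h2 := abs_sqrt_sub_sqrt_le (t - (1 - 1 / (n + 3 : ℝ))) (s - (1 - 1 / (n + 3 : ℝ)))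
    (1 / (n + 1 : ℝ))
  rw [sub_sub_sub_cancel_right] at h1 h2
  rw [abs_sub_comm t s] at h2
  rw [abs_le] at h1 h2 ⊢
  unfold smoothClamp
  constructor <;> linarith [h1.1, h1.2, h2.1, h2.2]

theorem smoothClamp_half (n : ℕ) : smoothClamp n (1 / 2) = 1 / 2 := by
  unfold smoothClamp
  rw [show (1 / 2 - (1 - 1 / (n + 3 : ℝ))) ^ 2 = (1 / 2 - 1 / (n + 3 : ℝ)) ^ 2 by ring]
  ring

theorem tendsto_smoothClamp {s : ℝ} (hs : s ∈ Ioo (0 : ℝ) 1) :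
    Tendsto (fun n => smoothClamp n s) atTop (𝓝 s) := by
  have t1 : Tendsto (fun n : ℕ => 1 / (n + 1 : ℝ)) atTop (𝓝 0) :=
    tendsto_one_div_add_atTop_nhds_zero_nat
  have t3 : Tendsto (fun n : ℕ => 1 / (n + 3 : ℝ)) atTop (𝓝 0) :=
    ((tendsto_one_div_add_atTop_nhds_zero_nat (𝕜 := ℝ)).comp (tendsto_add_atTop_nat 2)).congr
      fun n => by simp only [Function.comp_apply]; push_cast; congr 1; ring
  have c : Continuous fun z : ℝ × ℝ => 1 / 2 + (√((s - z.1) ^ 2 + z.2 ^ 2) -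
      √((s - (1 - z.1)) ^ 2 + z.2 ^ 2)) / 2 := by fun_prop
  have := (c.tendsto (0, 0)).comp (t3.prodMk_nhds t1)
  have e1 : √((s - 0) ^ 2 + 0 ^ 2) = s := by
    rw [sub_zero, zero_pow two_ne_zero, add_zero, Real.sqrt_sq hs.1.le]
  have e2 : √((s - (1 - 0)) ^ 2 + 0 ^ 2) = 1 - s := by
    rw [show (s - (1 - 0)) ^ 2 + 0 ^ 2 = (1 - s) ^ 2 by ring, Real.sqrt_sq (by linarith [hs.2])]
  have e : 1 / 2 + (√((s - 0) ^ 2 + 0 ^ 2) - √((s - (1 - 0)) ^ 2 + 0 ^ 2)) / 2 = s := by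
    rw [e1, e2]; ring
  exact this.trans (le_of_eq (congrArg 𝓝 e))

theorem sin_pi_mul_le {a s : ℝ} (hs : s ∈ Ioo (0 : ℝ) 1) (h : |a - 1 / 2| ≤ |s - 1 / 2|) :
    Real.sin (Real.pi * s) ≤ Real.sin (Real.pi * a) := by
  have e : ∀ t : ℝ, Real.sin (Real.pi * t) = Real.cos (Real.pi * |t - 1 / 2|) := fun t => by
    rw [← abs_of_pos Real.pi_pos, ← abs_mul, Real.cos_abs, abs_of_pos Real.pi_pos,
      ← Real.cos_sub_pi_div_two]
    congr 1; ring
  have hs2 : |s - 1 / 2| ≤ 1 / 2 := by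
    rw [abs_le]; constructor <;> linarith [hs.1, hs.2]
  have hpi := Real.pi_pos
  rw [e, e]
  exact Real.cos_le_cos_of_nonneg_of_le_pi (by positivity) (by nlinarith [abs_nonneg (s - 1 / 2)])
    (by gcongr)

/-- The coordinatewise action of `smoothClamp`. -/
noncomputable def clampQ (n : ℕ) (x : Plane) : Plane := !₂[smoothClamp n (x 0), smoothClamp n (x 1)]

theorem clampQ_apply (n : ℕ) (x : Plane) (i : Fin 2) : clampQ n x i = smoothClamp n (x i) := by
  fin_cases i <;> rfl

theorem contDiff_clampQ (n : ℕ) : ContDiff ℝ 1 (clampQ n) := by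
  rw [contDiff_euclidean]
  intro i
  simp_rw [clampQ_apply]
  exact (contDiff_smoothClamp n).comp (by fun_prop)

theorem clampQ_mem (n : ℕ) (x : Plane) : clampQ n x ∈ Q := fun i => by
  rw [clampQ_apply]; exact smoothClamp_mem n _

theorem norm_clampQ_sub_le (n : ℕ) (x y : Plane) : ‖clampQ n x - clampQ n y‖ ≤ ‖x - y‖ := by
  rw [EuclideanSpace.norm_eq, EuclideanSpace.norm_eq]
  refine Real.sqrt_le_sqrt (Finset.sum_le_sum fun i _ => ?_)
  rw [PiLp.sub_apply, PiLp.sub_apply, clampQ_apply, clampQ_apply]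
  exact pow_le_pow_left₀ (norm_nonneg _) (abs_smoothClamp_sub_le n _ _) 2

/-- A contraction fixing 1/2 brings each coordinate closer to the centre, where sin(πs) is larger.
Hence negative powers of the weight at the clamped point are bounded by those at the original point,
uniformly in `n`. -/
theorem sinProd_le_clampQ (n : ℕ) {x : Plane} (hx : x ∈ Q) : sinProd x ≤ sinProd (clampQ n x) := by
  have h : ∀ i, sinPi x i ≤ sinPi (clampQ n x) i := fun i => by
    unfold sinPi
    rw [clampQ_apply]
    refine sin_pi_mul_le (hx i) ?_
    have := abs_smoothClamp_sub_le n (x i) (1 / 2)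
    rwa [smoothClamp_half] at this
  exact mul_le_mul (h 0) (h 1) (sinPi_pos hx 1).le (sinPi_pos (clampQ_mem n x) 0).le

theorem tendsto_clampQ {x : Plane} (hx : x ∈ Q) :
    Tendsto (fun n => clampQ n x) atTop (𝓝 x) := by
  have h : Tendsto (fun n => WithLp.ofLp (clampQ n x)) atTop (𝓝 (WithLp.ofLp x)) :=
    tendsto_pi_nhds.2 fun i => (tendsto_smoothClamp (hx i)).congr fun n => (clampQ_apply n x i).symm
  exact ((PiLp.continuous_toLp 2 _).tendsto _).comp h

/-! ### Riesz potentials and the criterion for the fractional spaces. -/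

/-- Convolution of a weight with the kernel `|x - y|^(e - 2)`. -/
noncomputable def rieszPotential (e : ℝ) (w : Plane → ℝ) (x : Plane) : ℝ≥0∞ :=
  ∫⁻ y in Q, rieszKernel e x y * ENNReal.ofReal (w y)

theorem rieszKernel_comm (e : ℝ) (x y : Plane) : rieszKernel e x y = rieszKernel e y x := by
  rw [rieszKernel, norm_sub_rev, rieszKernel]

theorem measurable_rieszPotential (e : ℝ) {w : Plane → ℝ} (hw : Measurable w) :
    Measurable (rieszPotential e w) :=
  ((measurable_rieszKernel e).mul (hw.comp measurable_snd).ennreal_ofReal).lintegral_prod_right'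

theorem lintegral_rieszPotential_rpow_ne_top {e p : ℝ} (he : 0 < e) (hp : 1 ≤ p) {w : Plane → ℝ}
    (hw : Measurable w) (hwp : MemLp w (ENNReal.ofReal p) (volume.restrict Q)) :
    ∫⁻ x in Q, rieszPotential e w x ^ p ≠ ⊤ := by
  have hp0 : 0 < p := by linarith
  obtain ⟨K, hK, hKle⟩ := exists_lintegral_rieszKernel_le he
  have h1 : ∀ᵐ x ∂(volume.restrict Q), ∫⁻ y in Q, rieszKernel e x y ≤ K := by
    filter_upwards [ae_restrict_mem isOpen_Q.measurableSet] with x hx using hKle x hx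
  have h2 : ∀ᵐ y ∂(volume.restrict Q), ∫⁻ x in Q, rieszKernel e x y ≤ K := by
    filter_upwards [h1] with y hy
    simp_rw [rieszKernel_comm e _ y]
    exact hy
  have h := lintegral_kernel_rpow_le hp (measurable_rieszKernel e) hw.ennreal_ofReal h1 h2
  refine ne_top_of_le_ne_top (ENNReal.mul_ne_top (ENNReal.rpow_ne_top_of_nonneg hp0.le hK) ?_) h
  have h3 := hwp.2
  rw [eLpNorm_lt_top_iff_lintegral_rpow_enorm_lt_top (by simpa using hp0) ENNReal.ofReal_ne_top,
    ENNReal.toReal_ofReal hp0.le] at h3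
  refine ne_top_of_le_ne_top h3.ne (lintegral_mono fun x => ENNReal.rpow_le_rpow ?_ hp0.le)
  exact Real.ofReal_le_enorm _

theorem memLp_rieszPotential {e p : ℝ} (he : 0 < e) (hp : 1 ≤ p) {w : Plane → ℝ}
    (hw : Measurable w) (hwp : MemLp w (ENNReal.ofReal p) (volume.restrict Q)) :
    MemLp (fun x => (rieszPotential e w x).toReal) (ENNReal.ofReal p) (volume.restrict Q) := by
  have hp0 : 0 < p := by linarith
  refine ⟨(measurable_rieszPotential e hw).ennreal_toReal.aestronglyMeasurable, ?_⟩
  rw [eLpNorm_lt_top_iff_lintegral_rpow_enorm_lt_top (by simpa using hp0) ENNReal.ofReal_ne_top,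
    ENNReal.toReal_ofReal hp0.le]
  refine lt_of_le_of_lt (lintegral_mono fun x => ENNReal.rpow_le_rpow ?_ hp0.le)
    (lintegral_rieszPotential_rpow_ne_top he hp hw hwp).lt_top
  rw [Real.enorm_of_nonneg ENNReal.toReal_nonneg]
  exact ENNReal.ofReal_toReal_le

theorem ae_rieszPotential_ne_top {e p : ℝ} (he : 0 < e) (hp : 1 ≤ p) {w : Plane → ℝ}
    (hw : Measurable w) (hwp : MemLp w (ENNReal.ofReal p) (volume.restrict Q)) :
    ∀ᵐ x ∂(volume.restrict Q), rieszPotential e w x ≠ ⊤ := by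
  filter_upwards [ae_lt_top ((measurable_rieszPotential e hw).pow_const p)
    (lintegral_rieszPotential_rpow_ne_top he hp hw hwp)] with x hx h
  rw [h, ENNReal.top_rpow_of_pos (by linarith)] at hx
  exact hx.ne rfl

/-- The kernel bound for `fracLap` on functions with a weighted Hölder bound. -/
theorem integrableOn_weighted_kernel {e : ℝ} {w : Plane → ℝ} (hw : Measurable w)
    (hw0 : ∀ x ∈ Q, 0 ≤ w x) {K : ℝ≥0∞} (hK : K ≠ ⊤) {x : Plane} (hx : x ∈ Q)
    (hKx : ∫⁻ y in Q, rieszKernel e x y ≤ K) (hp : rieszPotential e w x ≠ ⊤) :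
    IntegrableOn (fun y => ‖x - y‖ ^ (e - 2) * (w x + w y)) Q ∧
      ∫ y in Q, ‖x - y‖ ^ (e - 2) * (w x + w y) ≤
        K.toReal * w x + (rieszPotential e w x).toReal := by
  have m1 : Measurable fun y => ‖x - y‖ ^ (e - 2) := by fun_prop
  have i1 : IntegrableOn (fun y => ‖x - y‖ ^ (e - 2)) Q := by
    refine ⟨m1.aestronglyMeasurable, ?_⟩
    rw [hasFiniteIntegral_iff_ofReal (Eventually.of_forall fun y => by positivity)]
    exact hKx.trans_lt hK.lt_top
  have n2 : 0 ≤ᵐ[volume.restrict Q] fun y => ‖x - y‖ ^ (e - 2) * w y := by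
    filter_upwards [ae_restrict_mem isOpen_Q.measurableSet] with y hy
    exact mul_nonneg (by positivity) (hw0 y hy)
  have e2 : ∫⁻ y in Q, ENNReal.ofReal (‖x - y‖ ^ (e - 2) * w y) = rieszPotential e w x := by
    refine lintegral_congr fun y => ?_
    rw [ENNReal.ofReal_mul (by positivity), rieszKernel]
  have i2 : IntegrableOn (fun y => ‖x - y‖ ^ (e - 2) * w y) Q := by
    refine ⟨(m1.mul hw).aestronglyMeasurable, ?_⟩
    rw [hasFiniteIntegral_iff_ofReal n2, e2]
    exact hp.lt_top
  have eq : (fun y => ‖x - y‖ ^ (e - 2) * (w x + w y)) =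
      fun y => ‖x - y‖ ^ (e - 2) * w x + ‖x - y‖ ^ (e - 2) * w y := by ext y; ring
  rw [eq]
  refine ⟨(i1.mul_const _).add i2, ?_⟩
  rw [integral_add (i1.mul_const _) i2, integral_mul_const,
    integral_eq_lintegral_of_nonneg_ae n2 (m1.mul hw).aestronglyMeasurable, e2,
    integral_eq_lintegral_of_nonneg_ae (Eventually.of_forall fun y => by positivity)
      m1.aestronglyMeasurable]
  gcongr
  · exact hw0 x hx
  · exact hKx

theorem measurable_fracLap (γ : ℝ) {f : Plane → ℝ} (hf : Measurable f) :
    AEStronglyMeasurable (fracLap γ f) (volume.restrict Q) := by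
  have : Measurable (Function.uncurry fun x x' : Plane => (f x - f x') / ‖x - x'‖ ^ (2 + γ)) := by
    unfold Function.uncurry
    fun_prop
  exact this.stronglyMeasurable.integral_prod_right.aestronglyMeasurable

/-- A sufficient condition for membership in the fractional space. -/
theorem memFrac_of_bounds {g : Plane → ℝ} {γ p m C : ℝ} (hγ : 0 ≤ γ) (hp : 1 ≤ p) (hm : 0 ≤ m)
    (hpm : p * (m + γ) < 1) (hC : 0 ≤ C) (hg : ContDiffOn ℝ 1 g Q)
    (hb : ∀ x ∈ Q, |g x| ≤ C * sinProd x ^ (-m))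
    (hb' : ∀ x ∈ Q, ‖fderiv ℝ g x‖ ≤ C * sinProd x ^ (-m - 1)) :
    MemFrac γ (ENNReal.ofReal p) g := by
  have hp0 : 0 < p := by linarith
  have hmp : m + γ < 1 / p := by rw [lt_div_iff₀ hp0, mul_comm]; exact hpm
  have hp1 : 1 / p ≤ 1 := by rw [div_le_one hp0]; exact hp
  -- The midpoint of γ and 1/p - m: above γ, so that the kernel |x-y|^(θ-γ-2) is locally integrable,
  -- and below 1/p - m, so that the weight S^(-(m+θ)) is in L^p.
  set θ := (γ + (1 / p - m)) / 2 with hθ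
  have hθγ : 0 < θ - γ := by linarith
  have hθ1 : θ ≤ 1 := by linarith
  have hθp : p * (m + θ) < 1 := by
    have : m + θ < 1 / p := by linarith
    rwa [lt_div_iff₀ hp0, mul_comm] at this
  obtain ⟨A, hA0, hA⟩ := exists_weighted_hoelder hm hC (by linarith : 0 < θ) hθ1
    (fun x hx => (hg.contDiffAt (isOpen_Q.mem_nhds hx)).differentiableAt (by simp)) hb hb'
  set w : Plane → ℝ := fun x => sinProd x ^ (-(m + θ)) with hw
  have hwm : Measurable w := measurable_sinProd.pow_const _
  have hw0 : ∀ x ∈ Q, 0 ≤ w x := fun x hx => (Real.rpow_pos_of_pos (sinProd_pos hx) _).le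
  have hwp : MemLp w (ENNReal.ofReal p) (volume.restrict Q) :=
    memLp_sinProd_rpow (by linarith) hp0 hθp
  -- The approximants are C¹ on the whole plane because the clamp maps the plane into the open
  -- square, and they inherit the bounds on `g` and its Hölder estimate with the same constants.
  set u : ℕ → Plane → ℝ := fun n => g ∘ clampQ n with hu
  have huc : ∀ n, ContDiff ℝ 1 (u n) := fun n =>
    hg.comp_contDiff (contDiff_clampQ n) (clampQ_mem n)
  have hul : ∀ x ∈ Q, Tendsto (fun n => u n x) atTop (𝓝 (g x)) := fun x hx =>
    ((hg.continuousOn.continuousAt (isOpen_Q.mem_nhds hx)).tendsto).comp (tendsto_clampQ hx)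
  have hub : ∀ n, ∀ x ∈ Q, |u n x| ≤ C * sinProd x ^ (-m) := fun n x hx => by
    refine (hb _ (clampQ_mem n x)).trans (mul_le_mul_of_nonneg_left ?_ hC)
    exact Real.rpow_le_rpow_of_nonpos (sinProd_pos hx) (sinProd_le_clampQ n hx) (by linarith)
  have huh : ∀ n, ∀ x ∈ Q, ∀ y ∈ Q, |u n x - u n y| ≤ A * (‖x - y‖ ^ θ * (w x + w y)) := by
    intro n x hx y hy
    refine (hA _ (clampQ_mem n x) _ (clampQ_mem n y)).trans ?_
    have hmono : ∀ z ∈ Q, w (clampQ n z) ≤ w z := fun z hz =>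
      Real.rpow_le_rpow_of_nonpos (sinProd_pos hz) (sinProd_le_clampQ n hz) (by linarith)
    have h1 := hmono x hx
    have h2 := hmono y hy
    have h3 : ‖clampQ n x - clampQ n y‖ ^ θ ≤ ‖x - y‖ ^ θ :=
      Real.rpow_le_rpow (norm_nonneg _) (norm_clampQ_sub_le n x y) (by linarith)
    refine mul_le_mul_of_nonneg_left (mul_le_mul h3 (add_le_add h1 h2) ?_ (by positivity)) hA0
    exact add_nonneg (hw0 _ (clampQ_mem n x)) (hw0 _ (clampQ_mem n y))
  have hgm : AEStronglyMeasurable g (volume.restrict Q) :=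
    hg.continuousOn.aestronglyMeasurable isOpen_Q.measurableSet
  have hconv := tendsto_eLpNorm_sub_of_dominated hp0 (u := u) (f := g)
    (H := fun x => C * sinProd x ^ (-m)) (fun n => (huc n).continuous.aestronglyMeasurable)
    ((memLp_sinProd_rpow hm hp0 (by nlinarith)).const_mul C)
    (fun n => by
      filter_upwards [ae_restrict_mem isOpen_Q.measurableSet] with x hx using hub n x hx)
    (by filter_upwards [ae_restrict_mem isOpen_Q.measurableSet] with x hx using hul x hx)
  refine ⟨hconv.2.1, fun _ => ?_⟩
  obtain ⟨K, hK, hKle⟩ := exists_lintegral_rieszKernel_le hθγ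
  have hpt : ∀ x ∈ Q, ∀ y ∈ Q, ∀ n, ‖(u n x - u n y) / ‖x - y‖ ^ (2 + γ)‖ ≤
      A * (‖x - y‖ ^ (θ - γ - 2) * (w x + w y)) := by
    intro x hx y hy n
    have hww : 0 ≤ w x + w y := add_nonneg (hw0 x hx) (hw0 y hy)
    rcases (norm_nonneg (x - y)).eq_or_lt with h | h
    -- On the diagonal the quotient is 0/0 = 0 by convention, so the bound holds there trivially.
    · have : x = y := sub_eq_zero.1 (norm_eq_zero.1 h.symm)
      subst this
      simp only [sub_self, zero_div, norm_zero]
      positivity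
    · rw [norm_div, Real.norm_eq_abs, Real.norm_of_nonneg (by positivity), div_le_iff₀ (by positivity)]
      refine (huh n x hx y hy).trans (le_of_eq ?_)
      have : ‖x - y‖ ^ θ = ‖x - y‖ ^ (θ - γ - 2) * ‖x - y‖ ^ (2 + γ) := by
        rw [← Real.rpow_add h]; congr 1; ring
      rw [this]; ring
  -- Dominated convergence is used twice: in the inner integral for almost every `x`, where the
  -- Riesz potential is finite, and in L^p, where the dominating function is controlled by Schur's
  -- test. The limit is `fracLap γ g` itself.
  have hlap := tendsto_eLpNorm_sub_of_dominated hp0 (u := fun n => fracLap γ (u n))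
    (f := fracLap γ g)
    (H := fun x => A * (K.toReal * w x + (rieszPotential (θ - γ) w x).toReal))
    (μ := volume.restrict Q) (fun n => measurable_fracLap γ (huc n).continuous.measurable)
    (((hwp.const_mul _).add (memLp_rieszPotential hθγ hp hwm hwp)).const_mul A)
    (fun n => by
      filter_upwards [ae_restrict_mem isOpen_Q.measurableSet,
        ae_rieszPotential_ne_top hθγ hp hwm hwp] with x hx hfin
      obtain ⟨hi, hle⟩ := integrableOn_weighted_kernel hwm hw0 hK hx (hKle x hx) hfin
      have h1 : ‖fracLap γ (u n) x‖ ≤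
          ∫ y in Q, A * (‖x - y‖ ^ (θ - γ - 2) * (w x + w y)) := by
        refine norm_integral_le_of_norm_le (hi.const_mul A) ?_
        filter_upwards [ae_restrict_mem isOpen_Q.measurableSet] with y hy using hpt x hx y hy n
      rw [integral_const_mul] at h1
      exact h1.trans (mul_le_mul_of_nonneg_left hle hA0))
    (by
      filter_upwards [ae_restrict_mem isOpen_Q.measurableSet,
        ae_rieszPotential_ne_top hθγ hp hwm hwp] with x hx hfin
      obtain ⟨hi, -⟩ := integrableOn_weighted_kernel hwm hw0 hK hx (hKle x hx) hfin
      refine tendsto_integral_of_dominated_convergence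
        (fun y => A * (‖x - y‖ ^ (θ - γ - 2) * (w x + w y))) (fun n => ?_) (hi.const_mul A)
        (fun n => ?_) ?_
      · have := (huc n).continuous.measurable
        exact Measurable.aestronglyMeasurable (by fun_prop)
      · filter_upwards [ae_restrict_mem isOpen_Q.measurableSet] with y hy using hpt x hx y hy n
      · filter_upwards [ae_restrict_mem isOpen_Q.measurableSet] with y hy
        exact ((hul x hx).sub (hul y hy)).div_const _)
  exact ⟨u, fracLap γ g, huc, hlap.1, hlap.2.1, hconv.2.2, hlap.2.2⟩

/-! ### Classical derivatives as weak derivatives. -/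

theorem integrable_mul_of_tsupport_subset {U : Set Plane} (hU : IsOpen U) {h φ : Plane → ℝ}
    (hh : ContinuousOn h U) (hφ : Continuous φ) (hc : HasCompactSupport φ) (hs : tsupport φ ⊆ U) :
    Integrable (fun x => h x * φ x) := by
  refine Continuous.integrable_of_hasCompactSupport ?_ hc.mul_left
  rw [continuous_iff_continuousAt]
  intro x
  by_cases hx : x ∈ U
  · exact (hh.continuousAt (hU.mem_nhds hx)).mul hφ.continuousAt
  · have h0 := notMem_tsupport_iff_eventuallyEq.1 fun h => hx (hs h)
    refine (continuousAt_const (y := (0 : ℝ))).congr ?_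
    filter_upwards [h0] with y hy
    simp [hy]

theorem setIntegral_mul_of_tsupport_subset {U : Set Plane} (h φ : Plane → ℝ)
    (hs : tsupport φ ⊆ U) : ∫ x in U, h x * φ x = ∫ x, h x * φ x :=
  setIntegral_eq_integral_of_forall_compl_eq_zero fun x hx => by
    rw [image_eq_zero_of_notMem_tsupport fun h => hx (hs h), mul_zero]

/-- Integration by parts against a test function. -/
theorem setIntegral_mul_fderiv_eq {U : Set Plane} (hU : IsOpen U) {h φ : Plane → ℝ}
    (hh : ContDiffOn ℝ 1 h U) (hφ : ContDiff ℝ 1 φ) (hc : HasCompactSupport φ) (hs : tsupport φ ⊆ U)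
    (v : Plane) : ∫ x in U, h x * fderiv ℝ φ x v = -∫ x in U, fderiv ℝ h x v * φ x := by
  have hφ' : Continuous fun x => fderiv ℝ φ x v := (hφ.continuous_fderiv (by simp)).clm_apply
    continuous_const
  have hs' : (tsupport fun x => fderiv ℝ φ x v) ⊆ U :=
    (tsupport_fderiv_apply_subset ℝ v).trans hs
  have hh' : ContinuousOn (fun x => fderiv ℝ h x v) U :=
    (hh.continuousOn_fderiv_of_isOpen hU le_rfl).clm_apply continuousOn_const
  rw [setIntegral_mul_of_tsupport_subset _ _ hs, setIntegral_mul_of_tsupport_subset _ _ hs']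
  exact integral_mul_fderiv_eq_neg_fderiv_mul_of_integrable
    (integrable_mul_of_tsupport_subset hU hh' hφ.continuous hc hs)
    (integrable_mul_of_tsupport_subset hU hh.continuousOn hφ' (hc.fderiv_apply ℝ v) hs')
    (integrable_mul_of_tsupport_subset hU hh.continuousOn hφ.continuous hc hs)
    (fun x hx => (hh.contDiffAt (hU.mem_nhds (hs hx))).differentiableAt (by simp))
    fun x _ => hφ.contDiffAt.differentiableAt (by simp)

/-- The iterated partial derivative along the coordinate directions `J`. -/
noncomputable def coordDeriv {k : ℕ} (J : Fin k → Fin 2) (f : Plane → ℝ) (x : Plane) : ℝ :=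
  iteratedFDeriv ℝ k f x fun i => EuclideanSpace.single (J i) (1 : ℝ)

theorem contDiffOn_coordDeriv {U : Set Plane} (hU : IsOpen U) {f : Plane → ℝ} {k : ℕ}
    {m n : WithTop ℕ∞} (hf : ContDiffOn ℝ n f U) (h : m + k ≤ n) (J : Fin k → Fin 2) :
    ContDiffOn ℝ m (coordDeriv J f) U := fun x hx =>
  ((ContinuousMultilinearMap.apply ℝ (fun _ : Fin k => Plane) ℝ fun i =>
    EuclideanSpace.single (J i) (1 : ℝ)).contDiff.contDiffAt.comp x
      ((hf.contDiffAt (hU.mem_nhds hx)).iteratedFDeriv_right h)).contDiffWithinAt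

theorem norm_apply_single_le {k : ℕ} (J : Fin k → Fin 2)
    (M : ContinuousMultilinearMap ℝ (fun _ : Fin k => Plane) ℝ) :
    ‖M fun i => EuclideanSpace.single (J i) (1 : ℝ)‖ ≤ ‖M‖ := by
  have := M.le_opNorm_mul_prod_of_le (m := fun i => EuclideanSpace.single (J i) (1 : ℝ))
    (b := fun _ => 1) fun i => by simp
  simpa using this

theorem abs_coordDeriv_le {k : ℕ} (J : Fin k → Fin 2) (f : Plane → ℝ) (x : Plane) :
    |coordDeriv J f x| ≤ ‖iteratedFDeriv ℝ k f x‖ := norm_apply_single_le J _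

theorem norm_fderiv_coordDeriv_le {k : ℕ} (J : Fin k → Fin 2) {f : Plane → ℝ} {x : Plane}
    (hf : ContDiffAt ℝ (k + 1 : ℕ) f x) :
    ‖fderiv ℝ (coordDeriv J f) x‖ ≤ ‖iteratedFDeriv ℝ (k + 1) f x‖ := by
  have hd : DifferentiableAt ℝ (iteratedFDeriv ℝ k f) x :=
    (hf.iteratedFDeriv_right (m := 1) (by push_cast; rw [add_comm])).differentiableAt (by simp)
  have h1 : HasFDerivAt (coordDeriv J f) _ x :=
    (ContinuousMultilinearMap.apply ℝ (fun _ : Fin k => Plane) ℝ fun i =>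
      EuclideanSpace.single (J i) (1 : ℝ)).hasFDerivAt.comp x hd.hasFDerivAt
  rw [h1.fderiv, ← norm_fderiv_iteratedFDeriv]
  refine ContinuousLinearMap.opNorm_le_bound _ (by positivity) fun e => ?_
  exact (norm_apply_single_le J _).trans (ContinuousLinearMap.le_opNorm _ e)

theorem fderiv_fderiv_apply {f : Plane → ℝ} {x : Plane} (hf : ContDiffAt ℝ 2 f x) (v e : Plane) :
    fderiv ℝ (fun y => fderiv ℝ f y v) x e = fderiv ℝ (fderiv ℝ f) x e v := by
  have hd : DifferentiableAt ℝ (fderiv ℝ f) x :=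
    (hf.fderiv_right (m := 1) (by norm_num)).differentiableAt (by simp)
  have h1 : HasFDerivAt (fun y => fderiv ℝ f y v) _ x :=
    hd.hasFDerivAt.clm_apply (hasFDerivAt_const v x)
  rw [h1.fderiv]
  simp

/-- Classical derivatives of order at most two are weak derivatives. -/
theorem hasWeakPartial_coordDeriv {U : Set Plane} (hU : IsOpen U) {f : Plane → ℝ} {k : ℕ}
    (hk : k ≤ 2) (hf : ContDiffOn ℝ 2 f U) (J : Fin k → Fin 2) :
    HasWeakPartial U k J f (coordDeriv J f) := by
  have hc : ContinuousOn (coordDeriv J f) U :=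
    (contDiffOn_coordDeriv (m := 0) hU hf (by rw [zero_add]; exact_mod_cast hk) J).continuousOn
  refine ⟨hf.continuousOn.locallyIntegrableOn hU.measurableSet,
    hc.locallyIntegrableOn hU.measurableSet, fun φ hφ hcs hsub => ?_⟩
  have hφ1 : ContDiff ℝ 1 φ := hφ.of_le (by exact_mod_cast le_top)
  have hφ2 : ContDiff ℝ 2 φ := by exact_mod_cast contDiff_infty.1 hφ 2
  have hf1 : ContDiffOn ℝ 1 f U := hf.of_le (by norm_num)
  obtain rfl | rfl | rfl : k = 0 ∨ k = 1 ∨ k = 2 := by omega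
  · simp [coordDeriv]
  · simp only [coordDeriv, iteratedFDeriv_one_apply]
    rw [setIntegral_mul_fderiv_eq hU hf1 hφ1 hcs hsub]
    simp
  · simp only [coordDeriv, iteratedFDeriv_two_apply]
    set a : Plane := EuclideanSpace.single (J 0) 1
    set b : Plane := EuclideanSpace.single (J 1) 1
    have hφb : ContDiff ℝ 1 fun x => fderiv ℝ φ x b :=
      (hφ2.fderiv_right (m := 1) (by norm_num)).clm_apply contDiff_const
    have hfa : ContDiffOn ℝ 1 (fun x => fderiv ℝ f x a) U :=
      (hf.fderiv_of_isOpen hU (m := 1) (by norm_num)).clm_apply contDiffOn_const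
    have h1 := setIntegral_mul_fderiv_eq hU hf1 hφb (hcs.fderiv_apply ℝ b)
      ((tsupport_fderiv_apply_subset ℝ b).trans hsub) a
    have h2 := setIntegral_mul_fderiv_eq hU hfa hφ1 hcs hsub b
    simp_rw [fderiv_fderiv_apply hφ2.contDiffAt] at h1
    rw [h1, h2, neg_neg, neg_one_sq, one_mul]
    -- Two integrations by parts return the derivatives in the opposite order; symmetry of the
    -- second derivative restores it.
    refine setIntegral_congr_fun hU.measurableSet fun x hx => ?_
    have hfx := hf.contDiffAt (hU.mem_nhds hx)
    rw [fderiv_fderiv_apply hfx, (hfx.isSymmSndFDerivAt (by simp)).eq]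

/-- Classical derivatives that are bounded give membership in `W^{k,∞}`. -/
theorem memSobolev_top {U : Set Plane} (hU : IsOpen U) {f : Plane → ℝ} {k : ℕ} (hk : k ≤ 2)
    (hf : ContDiffOn ℝ 2 f U)
    (hb : ∀ j ≤ k, ∃ B, ∀ x ∈ U, ‖iteratedFDeriv ℝ j f x‖ ≤ B) : MemSobolev U k ⊤ f := by
  intro j hj J
  obtain ⟨B, hB⟩ := hb j hj
  have hj2 := hj.trans hk
  refine ⟨coordDeriv J f, hasWeakPartial_coordDeriv hU hj2 hf J, memLp_top_of_bound ?_ B ?_⟩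
  · exact (contDiffOn_coordDeriv (m := 0) hU hf (by rw [zero_add]; exact_mod_cast hj2)
      J).continuousOn.aestronglyMeasurable hU.measurableSet
  · filter_upwards [ae_restrict_mem hU.measurableSet] with x hx
    exact (abs_coordDeriv_le J f x).trans (hB x hx)

theorem memSobolevLoc_top {f : Plane → ℝ} (hf : ContDiffOn ℝ 2 f Q) : MemSobolevLoc 2 ⊤ f := by
  intro U hU hc hsub
  have hUQ := subset_closure.trans hsub
  refine memSobolev_top hU le_rfl (hf.mono hUQ) fun j hj => ?_
  have hcont : ContinuousOn (iteratedFDeriv ℝ j f) (closure U) := fun x hx =>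
    ((hf.contDiffAt (isOpen_Q.mem_nhds (hsub hx))).iteratedFDeriv_right (m := 0)
      (by rw [zero_add]; exact_mod_cast hj)).continuousAt.continuousWithinAt
  obtain ⟨B, hB⟩ := hc.exists_bound_of_continuousOn hcont
  exact ⟨B, fun x hx => hB x (subset_closure hx)⟩

/-! ### Conclusion: membership in the Sobolev spaces and the optimal exponent. -/

theorem mexp_nonneg {α : ℝ} (h0 : 0 < α) : 0 ≤ mexp α := le_max_of_le_left (by linarith)

namespace PeriodProfile
variable {α r₁ C : ℝ} {T T₁ T₂ : ℝ → ℝ}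

theorem memSobolev_psiRe (h : PeriodProfile α r₁ C T T₁ T₂) (h0 : 0 < α) (h1 : α < 1) :
    MemSobolev Q 1 ⊤ (psiRe α) := by
  obtain ⟨B, -, hB⟩ := h.exists_bound_psiRe h0 h1
  refine memSobolev_top isOpen_Q (by norm_num)
    ((h.contDiffOn_psiRe h0 h1).of_le (by norm_num)) fun j hj => ⟨B, fun x hx => ?_⟩
  obtain rfl | rfl : j = 0 ∨ j = 1 := by omega
  · rw [norm_iteratedFDeriv_zero]; exact (hB x hx).1
  · exact (hB x hx).2.1

theorem memFracSobolev_psiRe (h : PeriodProfile α r₁ C T T₁ T₂) (h0 : 0 < α) (h1 : α < 1) {γ p : ℝ}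
    (hγ : 0 ≤ γ) (hp : 1 ≤ p) (hpm : p < (mexp α + γ)⁻¹) :
    MemFracSobolev (2 + γ) (ENNReal.ofReal p) (psiRe α) := by
  have hm := mexp_nonneg h0
  have hmα : 0 < mexp α := lt_of_lt_of_le (half_pos h0) (le_max_left _ _)
  have hpm' : p * (mexp α + γ) < 1 := by
    rwa [lt_inv_comm₀ (by linarith) (by positivity), ← one_div, lt_div_iff₀ (by linarith),
      mul_comm] at hpm
  -- The range of `p` is empty for γ = 1, as p ≥ 1 and m > 0 force γ < 1. So the integer part of 2 +
  -- γ is always 2 and derivatives up to order three suffice.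
  have hγ1 : γ < 1 := by nlinarith
  have hfloor : ⌊2 + γ⌋₊ = 2 := by
    rw [Nat.floor_eq_iff (by linarith)]
    constructor <;> push_cast <;> linarith
  obtain ⟨B, hB0, hB⟩ := h.exists_bound_psiRe h0 h1
  have hf := h.contDiffOn_psiRe h0 h1
  have hlow : ∀ x ∈ Q, ∀ a : ℝ, 0 ≤ a → 1 ≤ sinProd x ^ (-a) := fun x hx a ha =>
    Real.one_le_rpow_of_pos_of_le_one_of_nonpos (sinProd_pos hx) (sinProd_le_one hx) (by linarith)
  have e1 : -mexp α - 1 = -(mexp α + 1) := by ring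
  have hbound : ∀ j ≤ 2, ∀ x ∈ Q,
      ‖iteratedFDeriv ℝ j (psiRe α) x‖ ≤ B * sinProd x ^ (-mexp α) ∧
      ‖iteratedFDeriv ℝ (j + 1) (psiRe α) x‖ ≤ B * sinProd x ^ (-mexp α - 1) := by
    intro j hj x hx
    obtain ⟨b0, b1, b2, b3⟩ := hB x hx
    have l1 := le_mul_of_one_le_right hB0 (hlow x hx _ hm)
    have l2 := le_mul_of_one_le_right hB0 (hlow x hx (mexp α + 1) (by linarith))
    have l3 := mul_le_mul_of_nonneg_left
      (rpow_sinProd_anti (by linarith : mexp α ≤ mexp α + 1) hx) hB0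
    rw [← e1] at l2 l3
    obtain rfl | rfl | rfl : j = 0 ∨ j = 1 ∨ j = 2 := by omega
    · rw [norm_iteratedFDeriv_zero]
      exact ⟨b0.trans l1, b1.trans l2⟩
    · exact ⟨b1.trans l1, b2.trans l3⟩
    · exact ⟨b2, b3⟩
  intro j hj J
  rw [hfloor] at hj
  refine ⟨coordDeriv J (psiRe α), hasWeakPartial_coordDeriv isOpen_Q hj
    (hf.of_le (by norm_num)) J, ?_⟩
  rw [hfloor, show 2 + γ - ((2 : ℕ) : ℝ) = γ by push_cast; ring]
  have hj3 : (1 : WithTop ℕ∞) + j ≤ 3 := by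
    have : 1 + j ≤ 3 := by omega
    exact_mod_cast this
  refine memFrac_of_bounds hγ hp hm hpm' hB0 (contDiffOn_coordDeriv isOpen_Q hf hj3 J)
    (fun x hx => (abs_coordDeriv_le J _ x).trans (hbound j hj x hx).1) fun x hx => ?_
  refine (norm_fderiv_coordDeriv_le J ?_).trans (hbound j hj x hx).2
  refine (hf.contDiffAt (isOpen_Q.mem_nhds hx)).of_le ?_
  push_cast
  rwa [add_comm]

end PeriodProfile

theorem sqrt_five_bounds : 2 < √5 ∧ √5 < 3 := by
  constructor
  · rw [Real.lt_sqrt (by norm_num)]; norm_num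
  · rw [Real.sqrt_lt' (by norm_num)]; norm_num

theorem mexp_three_sub_sqrt_five : mexp (3 - √5) = (3 - √5) / 2 := by
  obtain ⟨h2, h3⟩ := sqrt_five_bounds
  have h5 : √5 ^ 2 = 5 := Real.sq_sqrt (by norm_num)
  refine max_eq_left ?_
  rw [div_le_iff₀ (by linarith)]
  nlinarith

/-- To the right of 3 - √5 the increasing branch α/2 is already larger than the optimal value; to
the left the decreasing branch is. -/
theorem mexp_lt {α : ℝ} (hne : α ≠ 3 - √5) : mexp (3 - √5) < mexp α := by
  obtain ⟨h2, h3⟩ := sqrt_five_bounds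
  have h5 : √5 ^ 2 = 5 := Real.sq_sqrt (by norm_num)
  rw [mexp_three_sub_sqrt_five]
  rcases hne.lt_or_gt with h | h
  · refine lt_max_of_lt_right ?_
    rw [lt_div_iff₀ (by linarith)]
    nlinarith
  · exact lt_max_of_lt_left (by linarith)

end SquareFlow

theorem lemma3p2 :
    (∀ α : ℝ, 0 < α → α < 1 →
      -- the integral that defines the reparametrized stream function converges
      (∫⁻ r in Set.Ioo (0 : ℝ) 1, SquareFlow.period (SquareFlow.psi α) r) ≠ ⊤ ∧
      SquareFlow.MemSobolev SquareFlow.Q 1 ⊤ (SquareFlow.psiRe α) ∧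
      SquareFlow.MemSobolevLoc 2 ⊤ (SquareFlow.psiRe α) ∧
      -- same level sets, positive inside, zero on the boundary
      Set.range (SquareFlow.levelSet (SquareFlow.psiRe α)) =
        Set.range (SquareFlow.levelSet (SquareFlow.psi α)) ∧
      (∀ x ∈ SquareFlow.Q, 0 < SquareFlow.psiRe α x) ∧
      ContinuousOn (SquareFlow.psiRe α) (closure SquareFlow.Q) ∧
      (∀ x ∈ frontier SquareFlow.Q, SquareFlow.psiRe α x = 0) ∧
      -- constant traversal period
      (∀ r : ℝ, 0 < r →
        ENNReal.ofReal r <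
          eLpNorm (SquareFlow.psiRe α) ⊤ (MeasureTheory.volume.restrict SquareFlow.Q) →
        SquareFlow.period (SquareFlow.psiRe α) r = 1) ∧
      -- fractional Sobolev regularity
      (∀ γ p : ℝ, 0 ≤ γ → γ ≤ 1 → 1 ≤ p → p < (SquareFlow.mexp α + γ)⁻¹ →
        SquareFlow.MemFracSobolev (2 + γ) (ENNReal.ofReal p) (SquareFlow.psiRe α))) ∧
    -- the range of exponents is largest exactly at `α = 3 - √5`
    (0 < 3 - √5 ∧ 3 - √5 < 1 ∧
      (∀ α : ℝ, 0 < α → α < 1 → α ≠ 3 - √5 →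
        SquareFlow.mexp (3 - √5) < SquareFlow.mexp α) ∧
      (∀ γ p : ℝ, 0 ≤ γ → γ < (√5 - 1) / 2 → 1 ≤ p → p < 2 / (3 - √5 + 2 * γ) →
        SquareFlow.MemFracSobolev (2 + γ) (ENNReal.ofReal p)
          (SquareFlow.psiRe (3 - √5)))) := by
  have hreg : ∀ α : ℝ, 0 < α → α < 1 → ∀ γ p : ℝ, 0 ≤ γ → 1 ≤ p →
      p < (SquareFlow.mexp α + γ)⁻¹ →
      SquareFlow.MemFracSobolev (2 + γ) (ENNReal.ofReal p) (SquareFlow.psiRe α) := by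
    intro α h0 h1 γ p hγ hp hpm
    obtain ⟨r₁, C, T, T₁, T₂, h⟩ := SquareFlow.exists_periodProfile h0 h1
    exact h.memFracSobolev_psiRe h0 h1 hγ hp hpm
  obtain ⟨h2, h3⟩ := SquareFlow.sqrt_five_bounds
  refine ⟨fun α h0 h1 => ?_, by linarith, by linarith, fun α _ _ hne => SquareFlow.mexp_lt hne,
    fun γ p hγ _ hp hpm => hreg _ (by linarith) (by linarith) γ p hγ hp ?_⟩
  · obtain ⟨r₁, C, T, T₁, T₂, h⟩ := SquareFlow.exists_periodProfile h0 h1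
    exact ⟨h.lintegral_period_ne_top, h.memSobolev_psiRe h0 h1,
      SquareFlow.memSobolevLoc_top ((h.contDiffOn_psiRe h0 h1).of_le (by norm_num)),
      h.range_levelSet_psiRe h0 h1, fun x hx => h.psiRe_pos h0 h1 hx,
      h.continuousOn_psiRe h0 h1, fun x hx => h.psiRe_frontier h0 h1 hx,
      fun r hr hr1 => h.period_psiRe h0 h1 hr hr1,
      fun γ p hγ _ hp hpm => hreg α h0 h1 γ p hγ hp hpm⟩
  -- At the optimal α the exponent is (3 - √5)/2, so the bound on `p` is the general one with
  -- numerator and denominator doubled.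
  · rw [SquareFlow.mexp_three_sub_sqrt_five]
    refine hpm.trans_eq ?_
    rw [← inv_div]
    congr 1
    ring
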